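/- Let $\mathbb F_q$ be a finite field with $q\equiv 1 \pmod 4$ elements and let $r\ge 4$. For $a\in\mathbb F_q^\times$ put $\mathrm{sgn}(a)=1$ if $a$ is a square and $-1$ otherwise, let $\chi_a(p)=(a/p)$ be the quadratic symbol for monic irreducible $p\in\mathbb F_q[x]$, $|p|=q^{\deg p}$, and let $\zeta_a\in\mathbb C$ satisfy $\zeta_a^2=\mathrm{sgn}(a)$. **Cocycle.** Let $M(u,q)=\mathrm{diag}\big(-\tfrac{1-qu}{qu(1-u)},\tfrac1{\sqrt q\,u},\tfrac{1+qu}{qu(1+u)}\big)$ and $U=\begin{pmatrix}1/2&1&1/2\\1/2&0&-1/2\\1/2&-1&1/2\end{pmatrix}$. On $\mathrm z=(z_1,z_2,z_3,z_4)$ (where $z_4$ stands for the variable $z_{r+1}$) let $w_i$ act by $z_i\mapsto 1/(qz_i)$, $z_j\mapsto\sqrt q\,z_iz_j$ if $j\neq i$ and one of $i,j$ is $4$, and $z_j\mapsto z_j$ otherwise. Put $\mathrm M_{w_i}(\mathrm z;q)=M(z_i,q)$ for $i\le 3$, $\mathrm M_{w_4}(\mathrm z;q)=UM(z_4,q)U$,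 $\mathrm M_{ww'}(\mathrm z)=\mathrm M_{w'}(\mathrm z)\mathrm M_w(w'\mathrm z)$, and $\overline{\mathrm M}_w(\mathrm z;q)=\mathrm M_w(q\mathrm z;1/q)$. Let $w=w_1w_2w_3w_4$. For $\xi=(\xi_1,\dots,\xi_r)$ put $X=\xi_1\xi_2\xi_3$ and $\mathrm z_\xi=\big(q^{-1/2}\xi_1^2,q^{-1/2}\xi_2^2,q^{-1/2}\xi_3^2,\tfrac{1}{q^{3/4}\zeta_aX}\big)$. **Local factors.** Let $$(L^{(1)},L^{(2)},L^{(3)})=(\tfrac12,\mathrm{sgn}(a),\tfrac12)\,\mathrm M_{w^{-1}}(w\mathrm z_\xi;q)\begin{pmatrix}0&1&1\\1&0&0\\0&-1&1\end{pmatrix},$$ $$S=(1-q^{-1})\Big[\frac{L^{(1)}}{q^{3/4}\zeta_aX}+\frac{L^{(2)}+L^{(3)}}{2\prod_{j=1}^r(1-q^{-1/2}\xi_j^2)}+\frac{L^{(3)}-L^{(2)}}{2\prod_{j=1}^r(1+q^{-1/2}\xi_j^2)}\Big],$$ $$R(y_1,y_2,y_3)=(1-qy_1^2y_2^2y_3^2)^{-1}\prod_{1\le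 i\le j\le3}(1-y_iy_j)^{-1},$$ $$S^{\mathrm{reg}}=S\cdot R\Big(\tfrac{\zeta_a\xi_2\xi_3}{q^{1/4}\xi_1},\tfrac{\zeta_a\xi_1\xi_3}{q^{1/4}\xi_2},\tfrac{\zeta_a\xi_1\xi_2}{q^{1/4}\xi_3}\Big)^{-1}\prod_{i=1}^3\prod_{j=4}^r\Big(1-\tfrac{\xi_i^2\xi_j^2}{q}\Big)\Big(1-\tfrac{\xi_i^{-2}\xi_j^2}{q}\Big)\prod_{4\le k\le l\le r}\Big(1-\tfrac{\xi_k^2\xi_l^2}{q}\Big).$$ For monic irreducible $p$, $S_p^{\mathrm{reg}}(\xi,\chi_a)$ is obtained from $S^{\mathrm{reg}}$ by replacing $q\mapsto|p|$, $\mathrm{sgn}(a)\mapsto\chi_a(p)$, $\zeta_a\mapsto\zeta_a^{\deg p}$, $\xi_k\mapsto\xi_k^{\deg p}$. **The functions $\mathscr G_{1,2}$.** Let $\Delta(\xi)=\big(1-\mathrm{sgn}(a)\sqrt q\,X^2\big)\prod_{1\le i\le j\le3}\big(1-\mathrm{sgn}(a)\sqrt q\,X^2/(\xi_i^2\xi_j^2)\big)$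 and $$\mathscr G_1(\xi,\zeta_a)=\frac{\prod_{j=1}^r(1-q^{1/2}\xi_j^2)}{\Delta(\xi)}\,(1,0,0)\,\overline{\mathrm M}_w(\mathrm z_\xi;q)\,{}^t(1,\mathrm{sgn}(a),1),\qquad \mathscr G_2(\xi,\zeta_a)=\frac{\xi_1\cdots\xi_r}{\Delta(\xi)}\,(0,1,0)\,\overline{\mathrm M}_w(\mathrm z_\xi;q)\,{}^t(1,\mathrm{sgn}(a),1).$$ **The integrals.** For $D\in\mathbb N=\{0,1,2,\dots\}$ and small $\rho>0$, with the integrals taken over the circles $|z_i-1|=\rho$, let $$\tilde{\mathscr L}_{1,2}(D,\zeta_a)=\frac{(-1)^{r(r+1)/2}}{(2\pi\sqrt{-1})^r}\oint\!\cdots\!\oint\frac{\mathscr G_{1,2}(\mathrm z,\zeta_a)\prod_pS_p^{\mathrm{reg}}(\mathrm z,\chi_a)}{z_4^D\cdots z_r^D}\,\frac{\prod_{i<j}(z_i-z_j)^{e_{ij}}(1-z_iz_j)\prod_{1\le k\le l\le3}(1-z_kz_l)}{\prod_{i=1}^r(1-z_i)^{2r}\prod_{k=1}^3\prod_{l=4}^r(1+z_kz_l)(z_k^{-1}+z_k^{-2}z_l)\prod_{4\le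 k\le l\le r}(1+z_kz_l)}\,\frac{d\mathrm z}{z_1^r\cdots z_r^r},$$ where $e_{ij}=1$ if $i\le3<j$ and $e_{ij}=2$ otherwise. **Proposition.** (1) For every $a\in\mathbb F_q^\times$ and every $\zeta_a$ with $\zeta_a^2=\mathrm{sgn}(a)$ there is $\rho_0>0$ such that $\prod_pS_p^{\mathrm{reg}}(\mathrm z,\chi_a)$ converges absolutely (that is, $\sum_p|S_p^{\mathrm{reg}}(\mathrm z,\chi_a)-1|<\infty$) whenever all $|z_i-1|<\rho_0$, and, for all $0<\rho<\rho_0$ and all $D\in\mathbb N$, the integrands are integrable, and $\tilde{\mathscr L}_1(D,\zeta_a)$ and $\tilde{\mathscr L}_2(D,\zeta_a)$ are polynomials in $D$, independent of $\rho$, of degree exactly $(r-3)(r+10)/2$ and with leading coefficients $$3\cdot2^{25-7r}(r-3)!\,\frac{0!\,1!\cdots(r-4)!}{7!\,9!\cdots(2r-1)!}\,\mathscr G_{1,2}(\mathbf 1,\zeta_a)\prod_pS_p^{\mathrm{reg}}(\mathbf 1,\chi_a),\qquad \mathbf 1=(1,\dots,1).$$ (2) For all $a$, $\zeta_a$ as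 above and all $p$ we have $S_p^{\mathrm{reg}}(\mathbf 1,\chi_a)=P_r\big(\chi_a(p)/\sqrt{|p|}\big)$, where $$P_r(t)=(1-t)^{(r^2+7r-14)/2}(1+t)^{(r^2+7r-28)/2}\Big[(t+t^2)(t+6t^2+t^3)+\tfrac12(1+t)^{4-r}+\tfrac12(1-t)^{-r}(1+10t+20t^2+10t^3+t^4)\Big].$$ (3) Let $\theta_0\in\mathbb F_q^\times$ be a nonsquare, and let $$Q_2(D,q)=\frac1{2^5\,3!\,(r-3)!}\sum_{a\in\{1,\theta_0\}}\ \sum_{\zeta_a^2=\mathrm{sgn}(a)}\zeta_a^D\Big\{(1-q^{1/2})^{-r}\tilde{\mathscr L}_1(D,\zeta_a)+\tilde{\mathscr L}_2(D,\zeta_a)\Big\}.$$ Then, for all sufficiently small $\rho>0$ and all $D\in\mathbb N$, $Q_2(D,q)=\sum_{a,\zeta_a}\zeta_a^D\,\Pi_{\zeta_a}(D)$ with polynomials $\Pi_{\zeta_a}$ independent of $\rho$, each of degree exactly $(r-3)(r+10)/2$ and with leading coefficient $$2^{19-7r}\,\frac{0!\,1!\cdots(r-4)!}{7!\,9!\cdots(2r-1)!}\,(1,1,0)\,\overline{\mathrm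 M}_w\big(q^{-1/2},q^{-1/2},q^{-1/2},q^{-3/4}\zeta_a^{-1};q\big)\,{}^t(1,\mathrm{sgn}(a),1)\,\big(1-\mathrm{sgn}(a)\sqrt q\big)^{-7}\prod_pP_r\Big(\frac{\chi_a(p)}{\sqrt{|p|}}\Big).$$ -/

import Mathlib

open Polynomial Finset Matrix

namespace SecTerms

noncomputable section

/-! ### The Weyl group cocycle -/

/-- The complex number `q ^ s`, for a positive real `q` and a real exponent `s`. -/
def rp (q s : ℝ) : ℂ := ((q ^ s : ℝ) : ℂ)

/-- The diagonal matrix `M(u, q)`. -/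
def baseMatrix (u : ℂ) (q : ℝ) : Matrix (Fin 3) (Fin 3) ℂ :=
  Matrix.diagonal ![-((1 - q * u) / (q * u * (1 - u))), 1 / (rp q (1 / 2) * u),
    (1 + q * u) / (q * u * (1 + u))]

/-- The involution `U`. -/
def matU : Matrix (Fin 3) (Fin 3) ℂ :=
  !![1 / 2, 1, 1 / 2; 1 / 2, 0, -1 / 2; 1 / 2, -1, 1 / 2]

/-- The action of the simple reflection `w_i` on `(z_1, …, z_n, z_{n+1})`; the last index
is the central node of the Dynkin diagram. -/
def reflect {n : ℕ} (q : ℝ) (i : Fin (n + 1)) (z : Fin (n + 1) → ℂ) : Fin (n + 1) → ℂ :=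
  fun j =>
    if j = i then 1 / (q * z i)
    else if i = Fin.last n ∨ j = Fin.last n then rp q (1 / 2) * z i * z j
    else z j

/-- The action of the product `w_{i_1} w_{i_2} ⋯ w_{i_k}`, given as the list `[i_1, …, i_k]`. -/
def wordAct {n : ℕ} (q : ℝ) (w : List (Fin (n + 1))) (z : Fin (n + 1) → ℂ) :
    Fin (n + 1) → ℂ :=
  w.foldr (reflect q) z

/-- The cocycle at a simple reflection. -/
def simpleCocycle {n : ℕ} (q : ℝ) (i : Fin (n + 1)) (z : Fin (n + 1) → ℂ) :
    Matrix (Fin 3) (Fin 3) ℂ :=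
  if i = Fin.last n then matU * baseMatrix (z i) q * matU else baseMatrix (z i) q

/-- The cocycle `M_w(z; q)`, with `M_{w w'}(z) = M_{w'}(z) M_w(w' z)`. -/
def cocycle {n : ℕ} (q : ℝ) : List (Fin (n + 1)) → (Fin (n + 1) → ℂ) →
    Matrix (Fin 3) (Fin 3) ℂ
  | [], _ => 1
  | i :: w, z => cocycle q w z * simpleCocycle q i (wordAct q w z)

/-- `M̄_w(z; q) = M_w(q z; 1 / q)`. -/
def cocycleBar {n : ℕ} (q : ℝ) (w : List (Fin (n + 1))) (z : Fin (n + 1) → ℂ) :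
    Matrix (Fin 3) (Fin 3) ℂ :=
  cocycle (1 / q) w (fun i => (q : ℂ) * z i)

/-- The element `w_1 w_2 w_3 w_{r+1}`. It only involves the four coordinates
`z_1, z_2, z_3, z_{r+1}`, which are numbered `0, 1, 2, 3` here. -/
def wAlpha : List (Fin 4) := [0, 1, 2, 3]

/-- The inverse of `w_1 w_2 w_3 w_{r+1}`. -/
def wAlphaInv : List (Fin 4) := [3, 2, 1, 0]

/-! ### Variables -/

/-- The first three coordinates of `ξ = (ξ_1, …, ξ_r)`. -/
def head {r : ℕ} (hr : 4 ≤ r) (ξ : Fin r → ℂ) : Fin 3 → ℂ :=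
  fun i => ξ (Fin.castLE (by omega) i)

/-- The positions of the coordinates `ξ_4, …, ξ_r`. -/
def tailIdx (r : ℕ) : Finset (Fin r) := univ.filter fun j => 3 ≤ (j : ℕ)

/-- The point `(q^{-1/2} ξ_1², q^{-1/2} ξ_2², q^{-1/2} ξ_3², 1 / (q^{3/4} ζ ξ_1 ξ_2 ξ_3))`. -/
def polePoint (q : ℝ) (ζ : ℂ) (x : Fin 3 → ℂ) : Fin 4 → ℂ :=
  ![rp q (-1 / 2) * x 0 ^ 2, rp q (-1 / 2) * x 1 ^ 2, rp q (-1 / 2) * x 2 ^ 2,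
    1 / (rp q (3 / 4) * ζ * (x 0 * x 1 * x 2))]

/-! ### The local factors -/

/-- The row vector `(L^{(1)}, L^{(2)}, L^{(3)})` attached to `w = w_1 w_2 w_3 w_{r+1}`, at the
point `z`, where `χ` is the value of the character:
`(1/2, χ, 1/2) M_{w⁻¹}(w z; q)` times a constant matrix. -/
def localL (q : ℝ) (χ : ℂ) (z : Fin 4 → ℂ) : Fin 3 → ℂ :=
  (![1 / 2, χ, 1 / 2] ᵥ* cocycle q wAlphaInv (wordAct q wAlpha z)) ᵥ*
    (!![0, 1, 1; 1, 0, 0; 0, -1, 1] : Matrix (Fin 3) (Fin 3) ℂ)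

/-- The factor `S^w` for `w = w_1 w_2 w_3 w_{r+1}`, as a function of the norm `q` of the prime,
of `ζ`, of the character value `χ`, and of `ξ`. -/
def localS {r : ℕ} (hr : 4 ≤ r) (q : ℝ) (ζ χ : ℂ) (ξ : Fin r → ℂ) : ℂ :=
  let x := head hr ξ
  let L := localL q χ (polePoint q ζ x)
  (1 - 1 / (q : ℂ)) *
    (L 0 / (rp q (3 / 4) * ζ * (x 0 * x 1 * x 2))
      + (L 1 + L 2) / (2 * ∏ j, (1 - rp q (-1 / 2) * ξ j ^ 2))
      + (L 2 - L 1) / (2 * ∏ j, (1 + rp q (-1 / 2) * ξ j ^ 2)))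

/-- `R(y_1, y_2, y_3) = (1 - q y_1² y_2² y_3²)⁻¹ ∏_{i ≤ j} (1 - y_i y_j)⁻¹`. -/
def localR (q : ℝ) (y : Fin 3 → ℂ) : ℂ :=
  (1 - q * (y 0 * y 1 * y 2) ^ 2)⁻¹ * ∏ i : Fin 3, ∏ j ∈ Finset.Ici i, (1 - y i * y j)⁻¹

/-- The regularized local factor. -/
def localReg {r : ℕ} (hr : 4 ≤ r) (q : ℝ) (ζ χ : ℂ) (ξ : Fin r → ℂ) : ℂ :=
  let x := head hr ξ
  localS hr q ζ χ ξ
    * (localR q ![ζ * x 1 * x 2 / (rp q (1 / 4) * x 0), ζ * x 0 * x 2 / (rp q (1 / 4) * x 1),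
        ζ * x 0 * x 1 / (rp q (1 / 4) * x 2)])⁻¹
    * (∏ i : Fin 3, ∏ j ∈ tailIdx r,
        (1 - x i ^ 2 * ξ j ^ 2 / q) * (1 - (x i ^ 2)⁻¹ * ξ j ^ 2 / q))
    * ∏ k ∈ tailIdx r, ∏ l ∈ (tailIdx r).filter (fun l => k ≤ l),
        (1 - ξ k ^ 2 * ξ l ^ 2 / q)

/-- The function `P_r(t)`. -/
def polyP (r : ℕ) (t : ℂ) : ℂ :=
  (1 - t) ^ ((r ^ 2 + 7 * r - 14) / 2) * (1 + t) ^ ((r ^ 2 + 7 * r - 28) / 2)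
    * ((t + t ^ 2) * (t + 6 * t ^ 2 + t ^ 3) + 1 / 2 * (1 + t) ^ (4 - (r : ℤ))
      + 1 / 2 * (1 - t) ^ (-(r : ℤ)) * (1 + 10 * t + 20 * t ^ 2 + 10 * t ^ 3 + t ^ 4))

/-! ### The rational function field -/

section FunctionField

variable (F : Type*) [Field F] [Fintype F]

/-- The cardinality `q` of the finite field, as a real number. -/
def qF : ℝ := (Fintype.card F : ℝ)

/-- The monic irreducible polynomials over `F`. -/
abbrev MonicPrime : Type _ := {p : F[X] // p.Monic ∧ Irreducible p}

variable {F}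

/-- `|p| = q ^ deg p`. -/
def pnorm (p : MonicPrime F) : ℝ := qF F ^ p.1.natDegree

open Classical in
/-- `sgn(a)`: `1` if `a` is a square in `F`, and `-1` otherwise. -/
def sgn (a : Fˣ) : ℂ := if IsSquare (a : F) then 1 else -1

open Classical in
/-- The quadratic symbol `(d / p)` for an irreducible polynomial `p`. -/
def quadSymbol (d p : F[X]) : ℂ :=
  if p ∣ d then 0 else if ∃ g : F[X], p ∣ g ^ 2 - d then 1 else -1

/-- `χ_a(p) = (a / p)` for a nonzero constant `a`. -/
def chi (a : Fˣ) (p : MonicPrime F) : ℂ := quadSymbol (C (a : F)) p.1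

/-- `S_p^reg(ξ, χ_a)` for an arbitrary monic irreducible `p`: in the expression for linear
primes, `q`, `sgn(a)`, `ζ_a` and `ξ_k` are replaced by `|p|`, `χ_a(p)`, `ζ_a^{deg p}` and
`ξ_k^{deg p}`. -/
def Sreg {r : ℕ} (hr : 4 ≤ r) (a : Fˣ) (ζ : ℂ) (p : MonicPrime F) (ξ : Fin r → ℂ) : ℂ :=
  localReg hr (pnorm p) (ζ ^ p.1.natDegree) (chi a p) (fun k => ξ k ^ p.1.natDegree)

/-! ### The functions `𝒢` and the integrals -/

/-- The common denominator of `𝒢_1` and `𝒢_2`. -/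
def denomG (q : ℝ) (s : ℂ) (x : Fin 3 → ℂ) : ℂ :=
  (1 - s * rp q (1 / 2) * (x 0 * x 1 * x 2) ^ 2)
    * ∏ i : Fin 3, ∏ j ∈ Finset.Ici i,
        (1 - s * rp q (1 / 2) * (x 0 * x 1 * x 2) ^ 2 / (x i ^ 2 * x j ^ 2))

/-- The column `M̄_w(q^{-1/2} ξ_1², q^{-1/2} ξ_2², q^{-1/2} ξ_3², 1/(q^{3/4} ζ ξ_1 ξ_2 ξ_3); q)`
times `(1, s, 1)`, for `w = w_1 w_2 w_3 w_{r+1}`. -/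
def gammaCol (q : ℝ) (ζ s : ℂ) (x : Fin 3 → ℂ) : Fin 3 → ℂ :=
  cocycleBar q wAlpha (polePoint q ζ x) *ᵥ ![1, s, 1]

/-- `𝒢_1(ξ, ζ_a)` (index `0`) and `𝒢_2(ξ, ζ_a)` (index `1`). -/
def calG {r : ℕ} (hr : 4 ≤ r) (q : ℝ) (ζ s : ℂ) (ν : Fin 2) (ξ : Fin r → ℂ) : ℂ :=
  ![(∏ j, (1 - rp q (1 / 2) * ξ j ^ 2)) / denomG q s (head hr ξ)
      * (![1, 0, 0] ⬝ᵥ gammaCol q ζ s (head hr ξ)),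
    (∏ j, ξ j) / denomG q s (head hr ξ)
      * (![0, 1, 0] ⬝ᵥ gammaCol q ζ s (head hr ξ))] ν

/-- The exponent `e_{ij}`: `1` if `i` is among the first three positions and `j` is not,
and `2` otherwise. -/
def expE {r : ℕ} (i j : Fin r) : ℕ := if (i : ℕ) < 3 ∧ 3 ≤ (j : ℕ) then 1 else 2

/-- The kernel of the integral that does not depend on `D`, nor on `a`. -/
def kernel {r : ℕ} (hr : 4 ≤ r) (z : Fin r → ℂ) : ℂ :=
  let x := head hr z
  ((∏ i : Fin r, ∏ j ∈ Finset.Ioi i, (z i - z j) ^ expE i j * (1 - z i * z j))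
      * ∏ k : Fin 3, ∏ l ∈ Finset.Ici k, (1 - x k * x l))
    / ((∏ i, (1 - z i) ^ (2 * r))
      * (∏ k : Fin 3, ∏ l ∈ tailIdx r, (1 + x k * z l) * ((x k)⁻¹ + (x k ^ 2)⁻¹ * z l))
      * ∏ k ∈ tailIdx r, ∏ l ∈ (tailIdx r).filter (fun l => k ≤ l), (1 + z k * z l))
    / (∏ i, z i) ^ r

/-- The integrand of `𝓛̃_1(D, ζ_a)` (index `0`) and `𝓛̃_2(D, ζ_a)` (index `1`). -/
def integrand {r : ℕ} (hr : 4 ≤ r) (a : Fˣ) (ζ : ℂ) (ν : Fin 2) (D : ℕ) (z : Fin r → ℂ) : ℂ :=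
  calG hr (qF F) ζ (sgn a) ν z * (∏' p : MonicPrime F, Sreg hr a ζ p z)
    / (∏ j ∈ tailIdx r, z j ^ D) * kernel hr z

/-- `𝓛̃_1(D, ζ_a)` (index `0`) and `𝓛̃_2(D, ζ_a)` (index `1`), computed on the circles
`|z_i - 1| = ρ`. -/
def Ltilde {r : ℕ} (hr : 4 ≤ r) (a : Fˣ) (ζ : ℂ) (ν : Fin 2) (ρ : ℝ) (D : ℕ) : ℂ :=
  (-1) ^ (r * (r + 1) / 2) / (2 * Real.pi * Complex.I) ^ r
    * torusIntegral (integrand hr a ζ ν D) (fun _ => 1) (fun _ => ρ)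

/-- `0! 1! ⋯ (r-4)! / (7! 9! ⋯ (2r-1)!)`. -/
def factRatio (r : ℕ) : ℂ :=
  (∏ k ∈ Finset.range (r - 3), (k.factorial : ℂ))
    / ∏ k ∈ Finset.Icc 4 r, ((2 * k - 1).factorial : ℂ)

/-- The constant attached to the fourth root of unity `ζ = √-1 ^ k`: it is `1` if `ζ² = 1`, and
the nonsquare `θ` if `ζ² = -1`. -/
def constOf (θ : Fˣ) (k : Fin 4) : Fˣ := if Even (k : ℕ) then 1 else θ

/-- The combination of the integrals that gives the coefficient `Q_2(D, q)`; the sum is over the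
fourth roots of unity `ζ`, with `ζ² = sgn(a)` for `a ∈ {1, θ}`. -/
def Q2 {r : ℕ} (hr : 4 ≤ r) (θ : Fˣ) (ρ : ℝ) (D : ℕ) : ℂ :=
  1 / (2 ^ 5 * (Nat.factorial 3 : ℂ) * ((r - 3).factorial : ℂ))
    * ∑ k : Fin 4, (Complex.I ^ (k : ℕ)) ^ D *
      ((1 - rp (qF F) (1 / 2)) ^ (-(r : ℤ))
          * Ltilde hr (constOf θ k) (Complex.I ^ (k : ℕ)) 0 ρ D
        + Ltilde hr (constOf θ k) (Complex.I ^ (k : ℕ)) 1 ρ D)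

end FunctionField

end

end SecTerms

/-!
The theorem is a residue computation at the single point `(1, …, 1)`, so three things have to be
known: how a residue depends on the exponent `D`, that the Euler product is holomorphic near that
point, and that no factor of the proposed leading coefficient vanishes.

*Residues.* In the coordinates `s = (z - 1) / (z + 1)` the factors `u - v` and `1 - u v` of the
kernel become, up to units, the difference and the sum of two coordinates. Hence the kernel is a
function without zeros or poles near the centre, times a homogeneous polynomial in `s`, divided by
`∏ (z_i - 1) ^ (2 r)` (`kernel_eq`). Expanding `z ^ (-D)` at `1` shows that the residue of such a
form times `∏ z_j ^ (-D)` is a polynomial in `D`. Its degree is at most the total pole order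
minus the degree of the form, and only the value of the smooth factor at the centre enters the
coefficient of that degree (`exists_residue_polynomial`). So the Euler product contributes its
value at `(1, …, 1)`, and the rest is the constant term of the homogeneous form against
`∏ exp (-t_j)`. The form is a product of three Vandermonde determinants (`numer_eq`), all terms of
the expansion of two of them contribute the same determinant (`prodFunctional_numer`), and this
one is again a Vandermonde determinant up to row and column operations (`tailDet_eq`).

*The Euler product.* With `e = |p| ^ (-1/4)`, the regularized local factor is a polynomial in `e`,
in the variables and their inverses, and in the two products `∏ (1 ∓ e ^ 2 ξ_j ^ 2)⁻¹`
(`localReg_eq_regFactor`). An identity valid in every commutative ring with `e ^ 6 = 0` says that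
it equals `1` modulo `e ^ 6` (`regPoly_eq_one`). In the ring of functions of the parameters which
grow at most polynomially, modulo `e ^ 6`, this identity becomes the bound
`S_p - 1 = O(|p| ^ (-3/2))`, polynomially in the size of the variables
(`exists_norm_regFactor_sub_one_le`). Since `S_p` depends on `z ^ deg p`, such a bound still gives
a convergent majorant when the variables are close to `1` (`exists_euler_bound`), and the product
is a holomorphic function there (`SepHol.tprod`).

*Values at the centre.* At `(1, …, 1)` the local factor is `P_r` (`Sreg_one`), which has no real
zero `t` with `t ^ 2 ≤ 1 / 5` (`polyP_ofReal_ne_zero`), so that the Euler product does not vanish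
(`tprod_Sreg_one_ne_zero`). The entries of `M̄_w (1, sgn a, 1)` and their sum are explicit; that
they do not vanish (`gammaCol_one_ne_zero`) follows from signs if `ζ` is real. If `ζ` is imaginary
one of the entries is real and the other imaginary, and the latter can only vanish if
`q ^ 2 - 34 q + 1 = 0`, which has no integral solution. Hence the degrees are exact.
-/

namespace SecTerms

noncomputable section

/-! ### Torus integrals of separately holomorphic functions -/

/-- Continuous and separately holomorphic functions on the polydisc `Metric.ball c ρ`.
This is the notion of holomorphy in several variables which is visibly stable under
locally uniform limits, and it suffices for iterated Cauchy integrals. -/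
structure SepHol {n : ℕ} (c : Fin n → ℂ) (ρ : ℝ) (f : (Fin n → ℂ) → ℂ) : Prop where
  cont : ContinuousOn f (Metric.ball c ρ)
  diff : ∀ z ∈ Metric.ball c ρ, ∀ i,
    DifferentiableOn ℂ (fun w => f (Function.update z i w)) (Metric.ball (c i) ρ)

lemma update_mem_ball {n : ℕ} {c z : Fin n → ℂ} {ρ : ℝ} (hz : z ∈ Metric.ball c ρ) (i : Fin n)
    {w : ℂ} (hw : w ∈ Metric.ball (c i) ρ) : Function.update z i w ∈ Metric.ball c ρ := by
  have hρ : 0 < ρ := Metric.pos_of_mem_ball hz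
  rw [Metric.mem_ball, dist_pi_lt_iff hρ] at hz ⊢
  intro j
  by_cases h : j = i
  · subst h; simpa using hw
  · simpa [h] using hz j

namespace SepHol

variable {n : ℕ} {c : Fin n → ℂ} {ρ : ℝ} {f g : (Fin n → ℂ) → ℂ}

lemma of_differentiableOn (hf : DifferentiableOn ℂ f (Metric.ball c ρ)) : SepHol c ρ f where
  cont := hf.continuousOn
  diff z hz i := hf.comp
    (fun w _ => (hasFDerivAt_update z w).differentiableAt.differentiableWithinAt)
    (fun _ hw => update_mem_ball hz i hw)

lemma mul (hf : SepHol c ρ f) (hg : SepHol c ρ g) : SepHol c ρ (fun z => f z * g z) where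
  cont := hf.cont.mul hg.cont
  diff z hz i := (hf.diff z hz i).mul (hg.diff z hz i)

lemma finset_prod {ι : Type*} (s : Finset ι) {f : ι → (Fin n → ℂ) → ℂ}
    (hf : ∀ j ∈ s, SepHol c ρ (f j)) : SepHol c ρ (fun z => ∏ j ∈ s, f j z) := by
  induction s using Finset.cons_induction with
  | empty => simpa using of_differentiableOn (differentiableOn_const 1)
  | cons a s ha ih =>
    simp only [Finset.prod_cons]
    exact (hf a (Finset.mem_cons_self a s)).mul (ih fun j hj => hf j (Finset.mem_cons_of_mem hj))

lemma mono {ρ' : ℝ} (hf : SepHol c ρ f) (h : ρ' ≤ ρ) : SepHol c ρ' f where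
  cont := hf.cont.mono (Metric.ball_subset_ball h)
  diff z hz i := (hf.diff z (Metric.ball_subset_ball h hz) i).mono (Metric.ball_subset_ball h)

end SepHol

lemma torusIntegral_congr {n : ℕ} {f g : (Fin n → ℂ) → ℂ} {c : Fin n → ℂ} {R : Fin n → ℝ}
    (h : ∀ θ, f (torusMap c R θ) = g (torusMap c R θ)) :
    torusIntegral f c R = torusIntegral g c R := by
  simp only [torusIntegral, h]

/-- The torus integral as an iterated integral, with one circle integral inside. -/
theorem torusIntegral_succAbove_symm {n : ℕ} {f : (Fin (n + 1) → ℂ) → ℂ} {c : Fin (n + 1) → ℂ}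
    {R : Fin (n + 1) → ℝ} (hf : TorusIntegrable f c R) (i : Fin (n + 1)) :
    torusIntegral f c R =
      torusIntegral (fun y => circleIntegral (fun x => f (i.insertNth x y)) (c i) (R i))
        (c ∘ i.succAbove) (R ∘ i.succAbove) := by
  set e : ℝ × (Fin n → ℝ) ≃ᵐ (Fin (n + 1) → ℝ) :=
    (MeasurableEquiv.piFinSuccAbove (fun _ => ℝ) i).symm
  have hem : MeasureTheory.MeasurePreserving e :=
    (MeasureTheory.volume_preserving_piFinSuccAbove (fun _ : Fin (n + 1) => ℝ) i).symm _
  have heπ : (e ⁻¹' Set.Icc 0 fun _ => 2 * Real.pi) =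
      Set.Icc 0 (2 * Real.pi) ×ˢ Set.Icc (0 : Fin n → ℝ) fun _ => 2 * Real.pi :=
    ((Fin.insertNthOrderIso (fun _ => ℝ) i).preimage_Icc _ _).trans (Set.Icc_prod_eq _ _)
  rw [torusIntegral, ← hem.map_eq, MeasureTheory.setIntegral_map_equiv, heπ,
    MeasureTheory.Measure.volume_eq_prod, ← MeasureTheory.setIntegral_prod_swap,
    MeasureTheory.setIntegral_prod, torusIntegral]
  · refine MeasureTheory.setIntegral_congr_fun measurableSet_Icc fun θ _ => ?_
    simp +unfoldPartialApp only [e, circleIntegral_def_Icc, Prod.swap,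
      deriv_circleMap, i.prod_univ_succAbove _, torusMap, circleMap_zero]
    rw [← MeasureTheory.integral_smul]
    refine MeasureTheory.setIntegral_congr_fun measurableSet_Icc fun Θ _ => ?_
    simp only [MeasurableEquiv.piFinSuccAbove_symm_apply, i.insertNth_apply_same,
      i.insertNth_apply_succAbove, (· ∘ ·), Fin.insertNthEquiv, Equiv.coe_fn_mk, smul_smul]
    rw [mul_comm]
    congr 2
    simp only [funext_iff, i.forall_iff_succAbove, circleMap, Fin.insertNth_apply_same,
      Fin.insertNth_apply_succAbove, imp_true_iff, and_self_iff]
  · have := hf.function_integrable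
    rw [← hem.integrableOn_comp_preimage e.measurableEmbedding, heπ] at this
    exact MeasureTheory.IntegrableOn.swap this

lemma torusMap_mem_ball {n : ℕ} {c : Fin n → ℂ} {ρ : ℝ} (hρ : 0 < ρ) {R : Fin n → ℝ}
    (hR : ∀ i, 0 < R i ∧ R i < ρ) (θ : Fin n → ℝ) : torusMap c R θ ∈ Metric.ball c ρ := by
  rw [Metric.mem_ball, dist_pi_lt_iff hρ]
  intro i
  simpa [torusMap, dist_eq_norm, abs_of_pos (hR i).1] using (hR i).2

lemma torusMap_sub_ne_zero {n : ℕ} {c : Fin n → ℂ} {R : Fin n → ℝ}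
    (hR : ∀ i, 0 < R i) (θ : Fin n → ℝ) (i : Fin n) : torusMap c R θ i - c i ≠ 0 := by
  simp [torusMap, (hR i).ne']

lemma torusIntegrable_of_continuousOn {n : ℕ} {c : Fin n → ℂ} {ρ : ℝ} (hρ : 0 < ρ)
    {R : Fin n → ℝ} (hR : ∀ i, 0 < R i ∧ R i < ρ) {g : (Fin n → ℂ) → ℂ}
    (hg : ContinuousOn g {z | z ∈ Metric.ball c ρ ∧ ∀ i, z i - c i ≠ 0}) :
    TorusIntegrable g c R := by
  refine Continuous.integrableOn_Icc (hg.comp_continuous ?_ fun θ =>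
    ⟨torusMap_mem_ball hρ hR θ, torusMap_sub_ne_zero (fun i => (hR i).1) θ⟩)
  unfold torusMap
  fun_prop

/-- The function `h / ∏ (z_i - c_i) ^ K`, with the same pole order in all variables. -/
def polar {n : ℕ} (c : Fin n → ℂ) (K : ℕ) (h : (Fin n → ℂ) → ℂ) (z : Fin n → ℂ) : ℂ :=
  h z / ∏ i, (z i - c i) ^ K

lemma SepHol.torusIntegrable_polar {n : ℕ} {c : Fin n → ℂ} {ρ : ℝ} (hρ : 0 < ρ)
    {R : Fin n → ℝ} (hR : ∀ i, 0 < R i ∧ R i < ρ) {h : (Fin n → ℂ) → ℂ} (hh : SepHol c ρ h)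
    (K : ℕ) : TorusIntegrable (polar c K h) c R := by
  refine torusIntegrable_of_continuousOn hρ hR ?_
  unfold polar
  refine (hh.cont.mono fun z hz => hz.1).div (by fun_prop) fun z hz => ?_
  exact Finset.prod_ne_zero_iff.2 fun i _ => pow_ne_zero _ (hz.2 i)

lemma circleIntegral_eq_of_differentiableOn_punctured {c : ℂ} {ρ r s : ℝ} {f : ℂ → ℂ}
    (hf : DifferentiableOn ℂ f (Metric.ball c ρ \ {c})) (hr : 0 < r) (hr' : r < ρ) (hs : 0 < s)
    (hs' : s < ρ) : circleIntegral f c r = circleIntegral f c s := by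
  wlog hle : r ≤ s generalizing r s
  · exact (this hs hs' hr hr' (le_of_not_ge hle)).symm
  have hopen : IsOpen (Metric.ball c ρ \ {c}) := Metric.isOpen_ball.sdiff isClosed_singleton
  refine (Complex.circleIntegral_eq_of_differentiable_on_annulus_off_countable hr hle
    Set.countable_empty (hf.continuousOn.mono ?_) fun z hz => ?_).symm
  · rintro z ⟨h1, h2⟩
    refine ⟨Metric.closedBall_subset_ball hs' h1, fun h => h2 ?_⟩
    rw [Set.mem_singleton_iff.1 h]
    exact Metric.mem_ball_self hr
  · refine hf.differentiableAt (hopen.mem_nhds ⟨Metric.ball_subset_ball hs'.le hz.1.1, fun h => ?_⟩)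
    refine hz.1.2 ?_
    rw [Set.mem_singleton_iff.1 h]
    exact Metric.mem_closedBall_self hr.le

lemma insertNth_eq_update {n : ℕ} (i : Fin (n + 1)) (x a : ℂ) (y : Fin n → ℂ) :
    (i.insertNth x y : Fin (n + 1) → ℂ) =
      Function.update (i.insertNth a y : Fin (n + 1) → ℂ) i x := by
  ext j
  rcases Fin.eq_self_or_eq_succAbove i j with rfl | ⟨k, rfl⟩
  · simp
  · rw [Fin.insertNth_apply_succAbove, Function.update_of_ne (Fin.succAbove_ne i k),
      Fin.insertNth_apply_succAbove]

lemma insertNth_mem_ball {n : ℕ} {c : Fin (n + 1) → ℂ} {ρ : ℝ} (i : Fin (n + 1)) {x : ℂ}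
    {y : Fin n → ℂ} (hx : x ∈ Metric.ball (c i) ρ) (hy : y ∈ Metric.ball (c ∘ i.succAbove) ρ) :
    (i.insertNth x y : Fin (n + 1) → ℂ) ∈ Metric.ball c ρ := by
  have hρ : 0 < ρ := Metric.pos_of_mem_ball hy
  rw [Metric.mem_ball, dist_pi_lt_iff hρ] at hy ⊢
  intro j
  rcases Fin.eq_self_or_eq_succAbove i j with rfl | ⟨k, rfl⟩
  · simpa using hx
  · simpa using hy k

lemma SepHol.differentiableOn_insertNth {n : ℕ} {c : Fin (n + 1) → ℂ} {ρ : ℝ}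
    {h : (Fin (n + 1) → ℂ) → ℂ} (hh : SepHol c ρ h) (i : Fin (n + 1)) {y : Fin n → ℂ}
    (hy : y ∈ Metric.ball (c ∘ i.succAbove) ρ) :
    DifferentiableOn ℂ (fun x => h (i.insertNth x y)) (Metric.ball (c i) ρ) := by
  have hρ : 0 < ρ := Metric.pos_of_mem_ball hy
  exact (hh.diff _ (insertNth_mem_ball i (Metric.mem_ball_self hρ) hy) i).congr
    fun x _ => congrArg h (insertNth_eq_update i x (c i) y)

lemma SepHol.insertNth_center {n : ℕ} {c : Fin (n + 1) → ℂ} {ρ : ℝ} (hρ : 0 < ρ)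
    {h : (Fin (n + 1) → ℂ) → ℂ} (hh : SepHol c ρ h) (i : Fin (n + 1)) :
    SepHol (c ∘ i.succAbove) ρ (fun y => h (i.insertNth (c i) y)) where
  cont := by
    refine hh.cont.comp (Continuous.continuousOn ?_) fun y hy =>
      insertNth_mem_ball i (Metric.mem_ball_self hρ) hy
    exact Continuous.finInsertNth i continuous_const continuous_id
  diff y hy j := by
    refine (hh.diff _ (insertNth_mem_ball i (Metric.mem_ball_self hρ) hy) (i.succAbove j)).congr
      fun w _ => ?_
    simp [Fin.insertNth_update]

lemma polar_insertNth {n : ℕ} {c : Fin (n + 1) → ℂ} (K : ℕ) (h : (Fin (n + 1) → ℂ) → ℂ)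
    (i : Fin (n + 1)) (x : ℂ) (y : Fin n → ℂ) :
    polar c K h (i.insertNth x y) =
      h (i.insertNth x y) / (x - c i) ^ K / ∏ j, (y j - c (i.succAbove j)) ^ K := by
  simp [polar, i.prod_univ_succAbove, div_div]

/-- Changing one of the radii does not change the integral. -/
lemma SepHol.torusIntegral_polar_update {n : ℕ} {c : Fin n → ℂ} {ρ : ℝ} (hρ : 0 < ρ)
    {R : Fin n → ℝ} (hR : ∀ i, 0 < R i ∧ R i < ρ) {h : (Fin n → ℂ) → ℂ} (hh : SepHol c ρ h)
    (K : ℕ) (i : Fin n) {s : ℝ} (hs : 0 < s) (hs' : s < ρ) :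
    torusIntegral (polar c K h) c (Function.update R i s) = torusIntegral (polar c K h) c R := by
  obtain _ | n := n
  · exact i.elim0
  have hR' : ∀ j, 0 < Function.update R i s j ∧ Function.update R i s j < ρ := by
    intro j
    by_cases hj : j = i
    · subst hj; simp [hs, hs']
    · simp [hj, hR j]
  rw [torusIntegral_succAbove_symm (hh.torusIntegrable_polar hρ hR K) i,
    torusIntegral_succAbove_symm (hh.torusIntegrable_polar hρ hR' K) i]
  have : Function.update R i s ∘ i.succAbove = R ∘ i.succAbove := by
    ext j; simp [Fin.succAbove_ne]
  rw [this]
  refine torusIntegral_congr fun θ => ?_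
  have hy := torusMap_mem_ball (c := c ∘ i.succAbove) hρ (R := R ∘ i.succAbove)
    (fun j => hR _) θ
  refine circleIntegral_eq_of_differentiableOn_punctured (ρ := ρ) ?_ (by simpa) (by simpa)
    (hR i).1 (hR i).2
  simp_rw [polar_insertNth]
  refine DifferentiableOn.div_const (DifferentiableOn.div
    ((hh.differentiableOn_insertNth i hy).mono sdiff_le) (by fun_prop) fun x hx => ?_) _
  exact pow_ne_zero _ (sub_ne_zero.2 hx.2)

/-- The radii do not matter: they are changed one at a time. -/
theorem SepHol.torusIntegral_polar_radius {n : ℕ} {c : Fin n → ℂ} {ρ : ℝ} (hρ : 0 < ρ)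
    {R R' : Fin n → ℝ} (hR : ∀ i, 0 < R i ∧ R i < ρ) (hR' : ∀ i, 0 < R' i ∧ R' i < ρ)
    {h : (Fin n → ℂ) → ℂ} (hh : SepHol c ρ h) (K : ℕ) :
    torusIntegral (polar c K h) c R' = torusIntegral (polar c K h) c R := by
  have key : ∀ s : Finset (Fin n),
      torusIntegral (polar c K h) c (s.piecewise R' R) = torusIntegral (polar c K h) c R := by
    intro s
    induction s using Finset.induction_on with
    | empty => simp
    | insert i s _ ih =>
      rw [Finset.piecewise_insert, hh.torusIntegral_polar_update hρ _ K i (hR' i).1 (hR' i).2, ih]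
      intro j
      by_cases hj : j ∈ s
      · simpa [hj] using hR' j
      · simpa [hj] using hR j
  simpa using key Finset.univ

/-- A torus integral vanishes if there is no pole in one of the variables. -/
theorem SepHol.torusIntegral_polar_eq_zero {n : ℕ} {c : Fin n → ℂ} {ρ : ℝ} (hρ : 0 < ρ)
    {R : Fin n → ℝ} (hR : ∀ i, 0 < R i ∧ R i < ρ) {h : (Fin n → ℂ) → ℂ} (hh : SepHol c ρ h)
    (K : ℕ) (i : Fin n) :
    torusIntegral (polar c K fun z => h z * (z i - c i) ^ K) c R = 0 := by
  obtain _ | n := n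
  · exact i.elim0
  have hh' : SepHol c ρ fun z => h z * (z i - c i) ^ K :=
    hh.mul (.of_differentiableOn (by fun_prop))
  rw [torusIntegral_succAbove_symm (hh'.torusIntegrable_polar hρ hR K) i]
  refine (torusIntegral_congr (g := fun _ => 0) fun θ => ?_).trans (by simp [torusIntegral])
  have hy := torusMap_mem_ball (c := c ∘ i.succAbove) hρ (R := R ∘ i.succAbove)
    (fun j => hR _) θ
  set y := torusMap (c ∘ i.succAbove) (R ∘ i.succAbove) θ
  have hd := (hh.differentiableOn_insertNth i hy).div_const
    (∏ j, (y j - c (i.succAbove j)) ^ K)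
  rw [← Complex.circleIntegral_eq_zero_of_differentiable_on_off_countable (hR i).1.le
    Set.countable_empty (hd.continuousOn.mono (Metric.closedBall_subset_ball (hR i).2))
    fun z hz => hd.differentiableAt (Metric.isOpen_ball.mem_nhds
      (Metric.ball_subset_ball (hR i).2.le hz.1))]
  refine circleIntegral.integral_congr (hR i).1.le fun x hx => ?_
  have hx' : x - c i ≠ 0 := by
    rw [← norm_ne_zero_iff, ← dist_eq_norm, Metric.mem_sphere.1 hx]
    exact (hR i).1.ne'
  simp only [polar_insertNth, Fin.insertNth_apply_same]
  rw [mul_div_assoc, div_self (pow_ne_zero _ hx'), mul_one]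

/-- The Cauchy formula for a torus: simple poles in all variables. -/
theorem SepHol.torusIntegral_polar_one {n : ℕ} {c : Fin n → ℂ} {ρ : ℝ} (hρ : 0 < ρ)
    {R : Fin n → ℝ} (hR : ∀ i, 0 < R i ∧ R i < ρ) {h : (Fin n → ℂ) → ℂ} (hh : SepHol c ρ h) :
    torusIntegral (polar c 1 h) c R = (2 * Real.pi * Complex.I) ^ n * h c := by
  induction n with
  | zero => simp [polar]
  | succ n ih =>
    rw [torusIntegral_succAbove_symm (hh.torusIntegrable_polar hρ hR 1) 0]
    refine (torusIntegral_congr (g := fun y => 2 * Real.pi * Complex.I *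
      polar (c ∘ (0 : Fin (n + 1)).succAbove) 1
        (fun y => h ((0 : Fin (n + 1)).insertNth (c 0) y)) y) fun θ => ?_).trans ?_
    · have hy := torusMap_mem_ball (c := c ∘ (0 : Fin (n + 1)).succAbove) hρ
        (R := R ∘ (0 : Fin (n + 1)).succAbove) (fun j => hR _) θ
      set y := torusMap (c ∘ (0 : Fin (n + 1)).succAbove) (R ∘ (0 : Fin (n + 1)).succAbove) θ
      have hd := (hh.differentiableOn_insertNth 0 hy).div_const
        (∏ j, (y j - c ((0 : Fin (n + 1)).succAbove j)) ^ 1)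
      have := Complex.circleIntegral_div_sub_of_differentiable_on_off_countable
        Set.countable_empty (Metric.mem_ball_self (hR 0).1)
        (hd.continuousOn.mono (Metric.closedBall_subset_ball (hR 0).2))
        fun z hz => hd.differentiableAt (Metric.isOpen_ball.mem_nhds
          (Metric.ball_subset_ball (hR 0).2.le hz.1))
      simp only [polar]
      refine Eq.trans ?_ this
      congr 1
      ext x
      simp [Fin.prod_univ_succ, div_div, mul_comm]
    · rw [torusIntegral_const_mul,
        ih (R := R ∘ (0 : Fin (n + 1)).succAbove) (fun j => hR _) (hh.insertNth_center hρ 0),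
        pow_succ']
      have : ((0 : Fin (n + 1)).insertNth (c 0) (c ∘ (0 : Fin (n + 1)).succAbove)
          : Fin (n + 1) → ℂ) = c := Fin.insertNth_self_removeNth 0 c
      rw [this]
      ring

/-! ### Residues depending polynomially on an exponent -/

/-- The binomial coefficient `binom(-X, k)` as a polynomial in `X`: the `k`-th Taylor
coefficient of `z ↦ z ^ (-X)` at `1`. -/
def negBinom (k : ℕ) : ℂ[X] := C ((-1) ^ k / (k.factorial : ℂ)) * ascPochhammer ℂ k

lemma natDegree_negBinom_le (k : ℕ) : (negBinom k).natDegree ≤ k :=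
  (natDegree_C_mul_le _ _).trans (ascPochhammer_natDegree ℂ k).le

lemma coeff_negBinom_self (k : ℕ) : (negBinom k).coeff k = (-1) ^ k / (k.factorial : ℂ) := by
  have h := (monic_ascPochhammer ℂ k).coeff_natDegree
  rw [ascPochhammer_natDegree] at h
  rw [negBinom, coeff_C_mul, h, mul_one]

lemma eval_zero_negBinom (k : ℕ) : (negBinom k).eval 0 = if k = 0 then 1 else 0 := by
  rcases eq_or_ne k 0 with rfl | h
  · simp [negBinom]
  · simp [negBinom, h]

/-- Pascal's rule for `binom(-X, k)`. -/
lemma eval_negBinom_succ (k : ℕ) (x : ℂ) :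
    (negBinom (k + 1)).eval (x + 1) + (negBinom k).eval (x + 1) = (negBinom (k + 1)).eval x := by
  have h1 : (ascPochhammer ℂ (k + 1)).eval (x + 1) =
      (ascPochhammer ℂ k).eval (x + 1) * (x + 1 + k) := by
    rw [ascPochhammer_succ_eval]
  have h2 : (ascPochhammer ℂ (k + 1)).eval x = x * (ascPochhammer ℂ k).eval (x + 1) := by
    rw [ascPochhammer_succ_left]; simp [eval_comp]
  have h3 : ((k : ℂ) + 1) ≠ 0 := Nat.cast_add_one_ne_zero k
  have h4 : (k.factorial : ℂ) ≠ 0 := Nat.cast_ne_zero.2 k.factorial_ne_zero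
  simp only [negBinom, eval_mul, eval_C, h1, h2, Nat.factorial_succ, Nat.cast_mul, Nat.cast_succ,
    pow_succ]
  field_simp
  ring

/-- The relation `(1 + t) (1 + t) ^ (-x - 1) = (1 + t) ^ (-x)` for truncated binomial series. -/
lemma one_add_mul_sum_negBinom (K : ℕ) (x t : ℂ) :
    (1 + t) * ∑ k ∈ range (K + 1), (negBinom k).eval (x + 1) * t ^ k =
      ∑ k ∈ range (K + 1), (negBinom k).eval x * t ^ k
        + (negBinom K).eval (x + 1) * t ^ (K + 1) := by
  induction K with
  | zero => simp [negBinom]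
  | succ K ih =>
    rw [Finset.sum_range_succ, mul_add, ih, Finset.sum_range_succ _ (K + 1),
      ← eval_negBinom_succ K x]
    ring

/-- The Taylor expansion of `z ^ (-D)` at `1`, with holomorphic remainder. -/
lemma exists_inv_pow_eq_sum_negBinom (K D : ℕ) :
    ∃ R : ℂ → ℂ, DifferentiableOn ℂ R {0}ᶜ ∧ ∀ z : ℂ, z ≠ 0 →
      (z ^ D)⁻¹ = ∑ k ∈ range K, (negBinom k).eval (D : ℂ) * (z - 1) ^ k + (z - 1) ^ K * R z := by
  obtain _ | K := K
  · exact ⟨fun z => (z ^ D)⁻¹, (by fun_prop : DifferentiableOn ℂ (fun z : ℂ => z ^ D) _).inv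
      fun z hz => pow_ne_zero _ hz, by simp⟩
  induction D with
  | zero =>
    refine ⟨fun _ => 0, by fun_prop, fun z _ => ?_⟩
    simp [eval_zero_negBinom, ite_mul]
  | succ D ih =>
    obtain ⟨R, hR, h⟩ := ih
    refine ⟨fun z => z⁻¹ * (R z - (negBinom K).eval ((D : ℂ) + 1)),
      (differentiableOn_inv.mono fun z hz => hz).mul (hR.sub_const _), fun z hz => ?_⟩
    have h1 := one_add_mul_sum_negBinom K (D : ℂ) (z - 1)
    rw [pow_succ, mul_inv, h z hz, Nat.cast_succ]
    rw [show 1 + (z - 1) = z by ring] at h1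
    rw [← mul_right_inj' hz]
    have hz' : z * z⁻¹ = 1 := mul_inv_cancel₀ hz
    rw [mul_add, h1]
    linear_combination (∑ k ∈ range (K + 1), (negBinom k).eval (D : ℂ) * (z - 1) ^ k +
      (z - 1) ^ (K + 1) * (negBinom K).eval ((D : ℂ) + 1)) * hz'

lemma ne_zero_of_mem_ball_one {z : ℂ} {ρ : ℝ} (hρ : ρ ≤ 1) (hz : z ∈ Metric.ball 1 ρ) : z ≠ 0 := by
  rintro rfl
  simp at hz
  linarith

variable {n : ℕ}

lemma apply_mem_ball {c z : Fin n → ℂ} {ρ : ℝ} (hz : z ∈ Metric.ball c ρ) (i : Fin n) :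
    z i ∈ Metric.ball (c i) ρ :=
  lt_of_le_of_lt (dist_le_pi_dist z c i) hz

lemma DifferentiableOn.comp_apply {f : ℂ → ℂ} {s : Set ℂ} (hf : DifferentiableOn ℂ f s)
    (c : Fin n → ℂ) (ρ : ℝ) (i : Fin n) (h : Metric.ball (c i) ρ ⊆ s) :
    DifferentiableOn ℂ (fun z : Fin n → ℂ => f (z i)) (Metric.ball c ρ) :=
  hf.comp (by fun_prop) fun _ hz => h (apply_mem_ball hz i)

lemma torusIntegral_finset_sum {ι : Type*} (s : Finset ι) {f : ι → (Fin n → ℂ) → ℂ}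
    {c : Fin n → ℂ} {R : Fin n → ℝ} (hf : ∀ j ∈ s, TorusIntegrable (f j) c R) :
    torusIntegral (fun z => ∑ j ∈ s, f j z) c R = ∑ j ∈ s, torusIntegral (f j) c R := by
  simp only [torusIntegral, Finset.smul_sum]
  exact MeasureTheory.integral_finsetSum _ fun j hj => (hf j hj).function_integrable

/-- In a torus integral with poles of order `K`, powers `z_i ^ (-δ_i)` may be replaced by their
Taylor polynomials of degree less than `K`. -/
lemma torusIntegral_polar_inv_pow {ρ r : ℝ} (hρ : ρ ≤ 1) (hr : 0 < r) (hr' : r < ρ) (K : ℕ)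
    (δ : Fin n → ℕ) (s : Finset (Fin n)) {Φ : (Fin n → ℂ) → ℂ}
    (hΦ : SepHol (fun _ => 1) ρ Φ) :
    torusIntegral (polar (fun _ => 1) K fun z => Φ z * ∏ i ∈ s, (z i ^ δ i)⁻¹)
        (fun _ => 1) (fun _ => r) =
      torusIntegral (polar (fun _ => 1) K fun z => Φ z *
        ∏ i ∈ s, ∑ k ∈ range K, (negBinom k).eval (δ i : ℂ) * (z i - 1) ^ k)
        (fun _ => 1) (fun _ => r) := by
  have hρ0 : 0 < ρ := hr.trans hr'
  have hR : ∀ i : Fin n, 0 < (fun _ => r) i ∧ (fun _ => r) i < ρ := fun _ => ⟨hr, hr'⟩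
  induction s using Finset.induction_on generalizing Φ with
  | empty => simp
  | insert j s hj ih =>
    have hsub : Metric.ball ((fun _ => 1 : Fin n → ℂ) j) ρ ⊆ {0}ᶜ :=
      fun z hz => ne_zero_of_mem_ball_one hρ hz
    obtain ⟨R, hRd, hRe⟩ := exists_inv_pow_eq_sum_negBinom K (δ j)
    have h1 : SepHol (fun _ => 1) ρ fun z : Fin n → ℂ => (z j ^ δ j)⁻¹ :=
      .of_differentiableOn (DifferentiableOn.inv (by fun_prop) fun z hz =>
        pow_ne_zero _ (hsub (apply_mem_ball hz j)))
    have h2 : SepHol (fun _ => 1) ρ fun z : Fin n → ℂ => R (z j) :=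
      .of_differentiableOn (DifferentiableOn.comp_apply hRd _ ρ j hsub)
    have h3 : SepHol (fun _ => 1) ρ fun z : Fin n → ℂ =>
        ∏ i ∈ s, ∑ k ∈ range K, (negBinom k).eval (δ i : ℂ) * (z i - 1) ^ k :=
      .finset_prod s fun i _ => .of_differentiableOn (by fun_prop)
    have h4 : SepHol (fun _ => 1) ρ fun z : Fin n → ℂ =>
        ∑ k ∈ range K, (negBinom k).eval (δ j : ℂ) * (z j - 1) ^ k :=
      .of_differentiableOn (by fun_prop)
    have h5 : SepHol (fun _ => 1) ρ fun z : Fin n → ℂ => (z j - 1) ^ K :=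
      .of_differentiableOn (by fun_prop)
    have e1 := ih (hΦ.mul h1)
    simp only [Finset.prod_insert hj, ← mul_assoc]
    rw [e1]
    have h6 := (hΦ.mul h2).mul h3
    have e2 := h6.torusIntegral_polar_eq_zero hρ0 hR K j
    rw [← sub_eq_zero, ← e2, ← torusIntegral_sub]
    · refine torusIntegral_congr fun θ => ?_
      have hz := hsub (apply_mem_ball (torusMap_mem_ball (c := fun _ => 1) hρ0 hR θ) j)
      simp only [polar, ← sub_div]
      rw [hRe _ hz]
      ring
    · exact ((hΦ.mul h1).mul h3).torusIntegrable_polar hρ0 hR K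
    · exact ((hΦ.mul h4).mul h3).torusIntegrable_polar hρ0 hR K

/-- The Taylor coefficients of a separately holomorphic function, as far as they are seen by
torus integrals with poles of order `K`. -/
lemma SepHol.exists_torusCoeff {ρ : ℝ} (hρ : 0 < ρ) {Φ : (Fin n → ℂ) → ℂ}
    (hΦ : SepHol (fun _ => 1) ρ Φ) {K : ℕ} (hK : 0 < K) :
    ∃ c : (Fin n → ℕ) → ℂ, (∀ ν, (∃ i, K ≤ ν i) → c ν = 0) ∧ c (fun _ => K - 1) = Φ (fun _ => 1) ∧
      ∀ r : ℝ, 0 < r → r < ρ → ∀ ν : Fin n → ℕ,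
        torusIntegral (polar (fun _ => 1) K fun z => Φ z * ∏ i, (z i - 1) ^ ν i)
          (fun _ => 1) (fun _ => r) = (2 * Real.pi * Complex.I) ^ n * c ν := by
  have hpi : (2 * Real.pi * Complex.I : ℂ) ^ n ≠ 0 := pow_ne_zero _ Complex.two_pi_I_ne_zero
  have hR : ∀ i : Fin n, 0 < (fun _ => ρ / 2) i ∧ (fun _ => ρ / 2) i < ρ :=
    fun _ => ⟨half_pos hρ, half_lt_self hρ⟩
  have hprod : ∀ ν : Fin n → ℕ, SepHol (fun _ => 1) ρ fun z => Φ z * ∏ i, (z i - 1) ^ ν i :=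
    fun ν => hΦ.mul (.finset_prod _ fun i _ => .of_differentiableOn (by fun_prop))
  refine ⟨fun ν => torusIntegral (polar (fun _ => 1) K fun z => Φ z * ∏ i, (z i - 1) ^ ν i)
          (fun _ => 1) (fun _ => ρ / 2) / (2 * Real.pi * Complex.I) ^ n, ?_, ?_, ?_⟩
  · rintro ν ⟨i, hi⟩
    have : SepHol (fun _ => 1) ρ fun z => Φ z *
        ((z i - 1) ^ (ν i - K) * ∏ j ∈ univ.erase i, (z j - 1) ^ ν j) :=
      hΦ.mul ((SepHol.of_differentiableOn (by fun_prop)).mul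
        (.finset_prod _ fun i _ => .of_differentiableOn (by fun_prop)))
    have e := this.torusIntegral_polar_eq_zero hρ hR K i
    beta_reduce
    rw [div_eq_zero_iff]
    left
    rw [← e]
    congr 2
    ext z
    rw [← Finset.mul_prod_erase _ _ (Finset.mem_univ i)]
    obtain ⟨k, hk⟩ := Nat.exists_eq_add_of_le hi
    rw [hk, Nat.add_sub_cancel_left, pow_add]
    ring
  · beta_reduce
    rw [div_eq_iff hpi, mul_comm, ← hΦ.torusIntegral_polar_one hρ hR]
    refine torusIntegral_congr fun θ => ?_
    have h := torusMap_sub_ne_zero (c := fun _ => 1) (fun i => (hR i).1) θ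
    simp only [polar]
    rw [div_eq_div_iff (Finset.prod_ne_zero_iff.2 fun i _ => pow_ne_zero _ (h i))
      (Finset.prod_ne_zero_iff.2 fun i _ => pow_ne_zero _ (h i)), mul_assoc,
      ← Finset.prod_mul_distrib]
    simp only [← pow_add, Nat.sub_add_cancel hK]
  · intro r hr hr' ν
    rw [mul_div_cancel₀ _ hpi]
    exact (hprod ν).torusIntegral_polar_radius hρ hR (fun _ => ⟨hr, hr'⟩) K

/-- The weight of a variable `t_i` with exponent `e` in the extraction of the leading
coefficient: for `i ∈ T` the coefficient of `t ^ (K - 1)` in `t ^ e * exp (-t)`, and otherwise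
the coefficient of `t ^ (K - 1)` in `t ^ e`. -/
def leadWeight (K : ℕ) (T : Finset (Fin n)) (i : Fin n) (e : ℕ) : ℂ :=
  if i ∈ T then if e < K then (-1) ^ (K - 1 - e) / ((K - 1 - e).factorial : ℂ) else 0
  else if e + 1 = K then 1 else 0

/-- The linear functional on polynomials which is multiplicative over the variables,
with value `w i e` at `X_i ^ e`. -/
def prodFunctional (w : Fin n → ℕ → ℂ) : MvPolynomial (Fin n) ℂ →ₗ[ℂ] ℂ :=
  (MvPolynomial.basisMonomials (Fin n) ℂ).constr ℂ fun μ => ∏ i, w i (μ i)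

lemma prodFunctional_monomial (w : Fin n → ℕ → ℂ) (μ : Fin n →₀ ℕ) (a : ℂ) :
    prodFunctional w (MvPolynomial.monomial μ a) = a * ∏ i, w i (μ i) := by
  have h : prodFunctional w (MvPolynomial.monomial μ 1) = ∏ i, w i (μ i) := by
    have := (MvPolynomial.basisMonomials (Fin n) ℂ).constr_basis ℂ (fun μ => ∏ i, w i (μ i)) μ
    simpa [prodFunctional] using this
  rw [← h, ← smul_eq_mul, ← map_smul, MvPolynomial.smul_monomial, smul_eq_mul, mul_one]

/-- The factor of the residue polynomial contributed by the variable `i`: the Taylor coefficient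
of `z_i ^ (-X)` if `i ∈ T`, and of `1` otherwise. -/
def tailBinom (T : Finset (Fin n)) (i : Fin n) (k : ℕ) : ℂ[X] :=
  if i ∈ T then negBinom k else C (if k = 0 then 1 else 0)

lemma natDegree_tailBinom_le (T : Finset (Fin n)) (i : Fin n) (k : ℕ) :
    (tailBinom T i k).natDegree ≤ k := by
  unfold tailBinom
  split_ifs
  · exact natDegree_negBinom_le k
  all_goals simp

lemma natDegree_prod_tailBinom_le (T : Finset (Fin n)) (β : Fin n → ℕ) :
    (∏ i, tailBinom T i (β i)).natDegree ≤ ∑ i, β i :=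
  (natDegree_prod_le _ _).trans (Finset.sum_le_sum fun i _ => natDegree_tailBinom_le T i _)

lemma coeff_prod_tailBinom (T : Finset (Fin n)) (β : Fin n → ℕ) :
    (∏ i, tailBinom T i (β i)).coeff (∑ i, β i) = ∏ i, (tailBinom T i (β i)).coeff (β i) := by
  suffices h : ∀ s : Finset (Fin n), (∏ i ∈ s, tailBinom T i (β i)).coeff (∑ i ∈ s, β i) =
      ∏ i ∈ s, (tailBinom T i (β i)).coeff (β i) from h univ
  intro s
  induction s using Finset.cons_induction with
  | empty => simp
  | cons a s ha ih =>
    rw [Finset.prod_cons, Finset.sum_cons, Finset.prod_cons, ← ih]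
    exact coeff_mul_add_eq_of_natDegree_le (natDegree_tailBinom_le T a _)
      ((natDegree_prod_le _ _).trans (Finset.sum_le_sum fun i _ => natDegree_tailBinom_le T i _))

/-- Residues of one monomial: the torus integral is a polynomial in `D`. Its degree is bounded by
the total pole order left over by the monomial. -/
lemma exists_residue_monomial {ρ : ℝ} (hρ0 : 0 < ρ) (hρ : ρ ≤ 1) {K : ℕ} (hK : 0 < K)
    (T : Finset (Fin n)) {Φ : (Fin n → ℂ) → ℂ} (hΦ : SepHol (fun _ => 1) ρ Φ)
    (μ : Fin n → ℕ) {N : ℕ} (hN : ∑ i, μ i + N = n * (K - 1)) :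
    ∃ Q : ℂ[X], Q.natDegree ≤ N ∧
      Q.coeff N = Φ (fun _ => 1) * ∏ i, leadWeight K T i (μ i) ∧
      ∀ r : ℝ, 0 < r → r < ρ → ∀ D : ℕ,
        torusIntegral (polar (fun _ => 1) K fun z => Φ z * (∏ i, (z i - 1) ^ μ i) *
          ∏ i ∈ T, (z i ^ D)⁻¹) (fun _ => 1) (fun _ => r) =
          (2 * Real.pi * Complex.I) ^ n * Q.eval (D : ℂ) := by
  obtain ⟨c, hc0, hc1, hc⟩ := hΦ.exists_torusCoeff hρ0 hK
  -- the terms with total exponent too large for the pole vanish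
  have hvanish : ∀ β : Fin n → ℕ, c (fun i => μ i + β i) ≠ 0 → ∀ i, μ i + β i ≤ K - 1 := by
    intro β h i
    by_contra! hi
    exact h (hc0 _ ⟨i, by omega⟩)
  have hsum : ∀ β : Fin n → ℕ, c (fun i => μ i + β i) ≠ 0 → ∑ i, β i ≤ N := by
    intro β h
    have := Finset.sum_le_sum fun i (_ : i ∈ univ) => hvanish β h i
    simp [Finset.sum_add_distrib] at this
    omega
  set S := Fintype.piFinset fun _ : Fin n => range K with hS
  refine ⟨∑ β ∈ S, C (c fun i => μ i + β i) * ∏ i, tailBinom T i (β i), ?_, ?_, ?_⟩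
  · refine natDegree_sum_le_of_forall_le _ _ fun β _ => ?_
    by_cases h : c (fun i => μ i + β i) = 0
    · simp [h]
    · exact (natDegree_C_mul_le _ _).trans ((natDegree_prod_tailBinom_le T β).trans (hsum β h))
  · simp only [finsetSum_coeff, coeff_C_mul]
    -- the degree `N` is only reached by `β_i = K - 1 - μ_i`, where the coefficient of `Φ` is its
    -- value at the centre
    by_cases hμ : ∀ i, μ i < K
    · rw [Finset.sum_eq_single fun i => K - 1 - μ i]
      · have h1 : ∑ i, (K - 1 - μ i) = N := by
          have : ∑ i, (μ i + (K - 1 - μ i)) = n * (K - 1) := by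
            rw [Finset.sum_congr rfl fun i _ => Nat.add_sub_cancel' (by have := hμ i; omega)]
            simp
          rw [Finset.sum_add_distrib] at this
          omega
        have h2 : (fun i => μ i + (K - 1 - μ i)) = fun _ => K - 1 :=
          funext fun i => Nat.add_sub_cancel' (by have := hμ i; omega)
        rw [h2, hc1, ← h1, coeff_prod_tailBinom]
        congr 1
        refine Finset.prod_congr rfl fun i _ => ?_
        have := hμ i
        unfold tailBinom leadWeight
        split_ifs with ha hb hb
        · exact coeff_negBinom_self _
        · simp [show K - 1 - μ i = 0 by omega]
        · omega
        · omega
        · simp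
      · intro β _ hβ
        by_cases h : c (fun i => μ i + β i) = 0
        · simp [h]
        · have hlt : ∑ i, β i < N := by
            refine lt_of_le_of_ne (hsum β h) fun he => hβ ?_
            have h1 : ∑ i, (μ i + β i) = ∑ i : Fin n, (K - 1) := by
              simp [Finset.sum_add_distrib, he, hN]
            have h2 := (Finset.sum_eq_sum_iff_of_le fun i _ => hvanish β h i).1 h1
            ext i
            have := h2 i (Finset.mem_univ i)
            omega
          rw [coeff_eq_zero_of_natDegree_lt ((natDegree_prod_tailBinom_le T β).trans_lt hlt),
            mul_zero]
      · intro h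
        exact absurd (Fintype.mem_piFinset.2 fun i => Finset.mem_range.2 (by omega)) h
    · push Not at hμ
      obtain ⟨i, hi⟩ := hμ
      have : leadWeight K T i (μ i) = 0 := by
        unfold leadWeight
        split_ifs <;> first | rfl | omega
      rw [Finset.prod_eq_zero (Finset.mem_univ i) this, mul_zero]
      exact Finset.sum_eq_zero fun β _ => by rw [hc0 _ ⟨i, by omega⟩, zero_mul]
  · intro r hr hr' D
    have hR : ∀ i : Fin n, 0 < (fun _ => r) i ∧ (fun _ => r) i < ρ := fun _ => ⟨hr, hr'⟩
    set δ : Fin n → ℕ := fun i => if i ∈ T then D else 0 with hδ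
    have hδT : ∀ z : Fin n → ℂ, ∏ i ∈ T, (z i ^ D)⁻¹ = ∏ i, (z i ^ δ i)⁻¹ := by
      intro z
      rw [← Finset.prod_subset (Finset.subset_univ T)]
      · exact Finset.prod_congr rfl fun i hi => by simp [hδ, hi]
      · intro i _ hi; simp [hδ, hi]
    have hev : ∀ i k, (negBinom k).eval (δ i : ℂ) = (tailBinom T i k).eval (D : ℂ) := by
      intro i k
      unfold tailBinom
      by_cases hi : i ∈ T
      · simp [hδ, hi]
      · simp [hδ, hi, eval_zero_negBinom, apply_ite (eval (D : ℂ))]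
    simp only [hδT]
    rw [torusIntegral_polar_inv_pow hρ hr hr' K δ univ
      (hΦ.mul (.finset_prod _ fun i _ => .of_differentiableOn (by fun_prop)))]
    have hexp : ∀ z : Fin n → ℂ, polar (fun _ => 1) K (fun z => Φ z * (∏ i, (z i - 1) ^ μ i) *
        ∏ i, ∑ k ∈ range K, (negBinom k).eval (δ i : ℂ) * (z i - 1) ^ k) z =
        ∑ β ∈ S, (∏ i, tailBinom T i (β i)).eval (D : ℂ) *
          polar (fun _ => 1) K (fun z => Φ z * ∏ i, (z i - 1) ^ (μ i + β i)) z := by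
      intro z
      simp only [polar, hev, Finset.prod_univ_sum, ← hS, eval_prod, Finset.prod_mul_distrib,
        Finset.mul_sum, Finset.sum_div, pow_add]
      exact Finset.sum_congr rfl fun β _ => by ring
    rw [funext hexp]
    rw [torusIntegral_finset_sum, eval_finsetSum, Finset.mul_sum]
    · refine Finset.sum_congr rfl fun β _ => ?_
      rw [torusIntegral_const_mul, hc r hr hr', eval_mul, eval_C]
      ring
    · intro β _
      have : SepHol (fun _ => 1) ρ fun z => (∏ i, tailBinom T i (β i)).eval (D : ℂ) *
          (Φ z * ∏ i, (z i - 1) ^ (μ i + β i)) :=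
        (SepHol.of_differentiableOn (by fun_prop)).mul
          (hΦ.mul (.finset_prod _ fun i _ => .of_differentiableOn (by fun_prop)))
      simp only [polar, ← mul_div_assoc]
      exact this.torusIntegrable_polar hρ0 hR K

/-- The residue of `Φ(z) H(s(z)) / ∏_{i ∈ T} z_i ^ D`, for a homogeneous polynomial `H` in the
Cayley coordinates `s = (z - 1) / (z + 1)`, with poles of order `K`: it is a polynomial
in `D`, and its top coefficient only depends on the value of `Φ` at the centre. -/
theorem exists_residue_polynomial {ρ : ℝ} (hρ0 : 0 < ρ) (hρ : ρ ≤ 1) {K : ℕ} (hK : 0 < K)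
    (T : Finset (Fin n)) {Φ : (Fin n → ℂ) → ℂ} (hΦ : SepHol (fun _ => 1) ρ Φ)
    {H : MvPolynomial (Fin n) ℂ} {d N : ℕ} (hH : H.IsHomogeneous d) (hN : d + N = n * (K - 1)) :
    ∃ Q : ℂ[X], Q.natDegree ≤ N ∧
      Q.coeff N = Φ (fun _ => 1) / 2 ^ d * prodFunctional (leadWeight K T) H ∧
      ∀ r : ℝ, 0 < r → r < ρ → ∀ D : ℕ,
        torusIntegral (polar (fun _ => 1) K fun z => Φ z *
          MvPolynomial.eval (fun i => (z i - 1) / (z i + 1)) H * ∏ i ∈ T, (z i ^ D)⁻¹)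
          (fun _ => 1) (fun _ => r) = (2 * Real.pi * Complex.I) ^ n * Q.eval (D : ℂ) := by
  have hne : ∀ z ∈ Metric.ball (fun _ => 1 : Fin n → ℂ) ρ, ∀ i, z i + 1 ≠ 0 := by
    intro z hz i h
    have h1 := apply_mem_ball hz i
    rw [eq_neg_of_add_eq_zero_left h, Metric.mem_ball, dist_eq_norm] at h1
    norm_num at h1
    linarith
  have hne0 : ∀ z ∈ Metric.ball (fun _ => 1 : Fin n → ℂ) ρ, ∀ i, z i ≠ 0 :=
    fun z hz i => ne_zero_of_mem_ball_one hρ (apply_mem_ball hz i)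
  have hΦμ : ∀ μ : Fin n →₀ ℕ, SepHol (fun _ => 1) ρ fun z => Φ z *
      ∏ i, ((z i + 1) ^ μ i)⁻¹ := fun μ =>
    hΦ.mul (.finset_prod _ fun i _ => .of_differentiableOn (DifferentiableOn.inv (by fun_prop)
      fun z hz => pow_ne_zero _ (hne z hz i)))
  have hdeg : ∀ μ ∈ H.support, ∑ i, μ i = d := by
    intro μ hμ
    have := hH (MvPolynomial.mem_support_iff.1 hμ)
    rw [← Finsupp.degree_eq_sum, Finsupp.degree_eq_weight_one]
    exact this
  -- a monomial `s ^ μ` is `(z - 1) ^ μ` times the smooth factor `(z + 1) ^ (-μ)`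
  have hmono : ∀ μ : Fin n →₀ ℕ, ∃ Q : ℂ[X], μ ∈ H.support → (Q.natDegree ≤ N ∧
      Q.coeff N = Φ (fun _ => 1) / 2 ^ d * ∏ i, leadWeight K T i (μ i) ∧
      ∀ r : ℝ, 0 < r → r < ρ → ∀ D : ℕ,
        torusIntegral (polar (fun _ => 1) K fun z => Φ z * (∏ i, ((z i + 1) ^ μ i)⁻¹) *
          (∏ i, (z i - 1) ^ μ i) * ∏ i ∈ T, (z i ^ D)⁻¹) (fun _ => 1) (fun _ => r) =
          (2 * Real.pi * Complex.I) ^ n * Q.eval (D : ℂ)) := by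
    intro μ
    by_cases hμ : μ ∈ H.support
    · obtain ⟨Q, h1, h2, h3⟩ := exists_residue_monomial hρ0 hρ hK T (hΦμ μ) μ
        (N := N) (by rw [hdeg μ hμ, hN])
      refine ⟨Q, fun _ => ⟨h1, ?_, h3⟩⟩
      rw [h2, ← hdeg μ hμ, ← Finset.prod_pow_eq_pow_sum]
      norm_num [div_eq_mul_inv]
    · exact ⟨0, fun h => absurd h hμ⟩
  choose Q hQ using hmono
  refine ⟨∑ μ ∈ H.support, C (H.coeff μ) * Q μ, ?_, ?_, ?_⟩
  · exact natDegree_sum_le_of_forall_le _ _ fun μ hμ =>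
      (natDegree_C_mul_le _ _).trans (hQ μ hμ).1
  · conv_rhs => rw [H.as_sum]
    rw [finsetSum_coeff, map_sum, Finset.mul_sum]
    refine Finset.sum_congr rfl fun μ hμ => ?_
    rw [coeff_C_mul, (hQ μ hμ).2.1, prodFunctional_monomial]
    ring
  · intro r hr hr' D
    have hR : ∀ i : Fin n, 0 < (fun _ => r) i ∧ (fun _ => r) i < ρ := fun _ => ⟨hr, hr'⟩
    have hexp : ∀ z : Fin n → ℂ, polar (fun _ => 1) K (fun z => Φ z *
          MvPolynomial.eval (fun i => (z i - 1) / (z i + 1)) H * ∏ i ∈ T, (z i ^ D)⁻¹) z =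
        ∑ μ ∈ H.support, H.coeff μ * polar (fun _ => 1) K (fun z => Φ z *
          (∏ i, ((z i + 1) ^ μ i)⁻¹) * (∏ i, (z i - 1) ^ μ i) * ∏ i ∈ T, (z i ^ D)⁻¹) z := by
      intro z
      simp only [polar, MvPolynomial.eval_eq', div_pow, Finset.mul_sum, Finset.sum_mul,
        Finset.sum_div, Finset.prod_div_distrib, Finset.prod_inv_distrib]
      exact Finset.sum_congr rfl fun μ _ => by ring
    rw [funext hexp]
    rw [torusIntegral_finset_sum, eval_finsetSum, Finset.mul_sum]
    · refine Finset.sum_congr rfl fun μ hμ => ?_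
      rw [torusIntegral_const_mul, (hQ μ hμ).2.2 r hr hr', eval_mul, eval_C]
      ring
    · intro μ _
      have : SepHol (fun _ => 1) ρ fun z => H.coeff μ * (Φ z * (∏ i, ((z i + 1) ^ μ i)⁻¹) *
          (∏ i, (z i - 1) ^ μ i) * ∏ i ∈ T, (z i ^ D)⁻¹) := by
        refine (SepHol.of_differentiableOn (by fun_prop)).mul
          (((hΦμ μ).mul (.finset_prod _ fun i _ => .of_differentiableOn (by fun_prop))).mul
          (.finset_prod _ fun i _ => .of_differentiableOn (DifferentiableOn.inv (by fun_prop)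
            fun z hz => pow_ne_zero _ (hne0 z hz i))))
      simp only [polar, ← mul_div_assoc]
      exact this.torusIntegrable_polar hρ0 hR K

/-! ### A constant term evaluated by Vandermonde determinants -/

lemma prod_Ioi_eq_ite {M : Type*} [CommMonoid M] {n : ℕ} (i : Fin n) (f : Fin n → M) :
    ∏ j ∈ Ioi i, f j = ∏ j, if i < j then f j else 1 := by
  rw [← Finset.prod_filter]
  congr 1
  ext j
  simp

/-- The pairs with `expE i j = 2` are those on the same side of the division into the first three
and the remaining indices. -/
lemma prod_Ioi_pow_expE {M : Type*} [CommMonoid M] {m : ℕ} (f : Fin (3 + m) → Fin (3 + m) → M) :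
    ∏ i, ∏ j ∈ Ioi i, f i j ^ (expE i j - 1) =
      (∏ i : Fin 3, ∏ j ∈ Ioi i, f (Fin.castAdd m i) (Fin.castAdd m j)) *
        ∏ i : Fin m, ∏ j ∈ Ioi i, f (Fin.natAdd 3 i) (Fin.natAdd 3 j) := by
  simp only [prod_Ioi_eq_ite]
  rw [Fin.prod_univ_add]
  congr 1
  · refine Finset.prod_congr rfl fun i _ => ?_
    rw [Fin.prod_univ_add]
    refine (congrArg₂ (· * ·) (Finset.prod_congr rfl fun j _ => ?_)
      (Finset.prod_eq_one fun j _ => ?_)).trans (mul_one _)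
    · have h : Fin.castAdd m i < Fin.castAdd m j ↔ i < j := Iff.rfl
      simp [expE, h, show ¬ 3 ≤ (j : ℕ) by omega]
    · simp [expE]
  · refine Finset.prod_congr rfl fun i _ => ?_
    rw [Fin.prod_univ_add]
    refine (congrArg₂ (· * ·) (Finset.prod_eq_one fun j _ => ?_)
      (Finset.prod_congr rfl fun j _ => ?_)).trans (one_mul _)
    · have : ¬ (3 + (i : ℕ) < (j : ℕ)) := by omega
      simp [Fin.lt_def, this]
    · simp [expE]

section Numerator

variable {R : Type*} [CommRing R] {m : ℕ}

/-- The numerator of the integration kernel in Cayley coordinates. -/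
def numer (x : Fin (3 + m) → R) : R :=
  (∏ i, ∏ j ∈ Ioi i, (x i - x j) ^ expE i j * (x i + x j)) *
    ∏ k : Fin 3, ∏ l ∈ Ici k, (x (Fin.castAdd m k) + x (Fin.castAdd m l))

/-- The numerator as a product of three Vandermonde determinants: in the squares of all variables,
in the squares of the first three, and in the remaining variables. -/
lemma numer_eq (x : Fin (3 + m) → R) :
    numer x = 8 * (∏ i, ∏ j ∈ Ioi i, (x i ^ 2 - x j ^ 2)) *
      ((∏ k : Fin 3, x (Fin.castAdd m k)) *
        (∏ i : Fin 3, ∏ j ∈ Ioi i, (x (Fin.castAdd m i) ^ 2 - x (Fin.castAdd m j) ^ 2)) *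
        ∏ i : Fin m, ∏ j ∈ Ioi i, (x (Fin.natAdd 3 i) - x (Fin.natAdd 3 j))) := by
  have h1 : (∏ i : Fin (3 + m), ∏ j ∈ Ioi i, (x i - x j) ^ expE i j * (x i + x j)) =
      (∏ i, ∏ j ∈ Ioi i, (x i ^ 2 - x j ^ 2)) *
        ∏ i, ∏ j ∈ Ioi i, (x i - x j) ^ (expE i j - 1) := by
    simp_rw [← Finset.prod_mul_distrib]
    refine Finset.prod_congr rfl fun i _ => Finset.prod_congr rfl fun j _ => ?_
    unfold expE
    split_ifs <;> ring
  rw [numer, h1, prod_Ioi_pow_expE fun i j => x i - x j]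
  have h3 : (Ici (0 : Fin 3)) = {0, 1, 2} := by decide
  have h4 : (Ici (1 : Fin 3)) = {1, 2} := by decide
  have h5 : (Ici (2 : Fin 3)) = {2} := by decide
  have h6 : (Ioi (0 : Fin 3)) = {1, 2} := by decide
  have h7 : (Ioi (1 : Fin 3)) = {2} := by decide
  have h8 : (Ioi (2 : Fin 3)) = ∅ := by decide
  simp [Fin.prod_univ_three, h3, h4, h5, h6, h7, h8]
  ring

end Numerator

/-- The degree of the numerator, counted factor by factor. -/
def numerDeg (m : ℕ) : ℕ :=
  (∑ i : Fin (3 + m), ∑ j ∈ Ioi i, (expE i j + 1)) + ∑ k : Fin 3, ∑ _l ∈ Ici k, 1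

lemma numer_isHomogeneous (m : ℕ) :
    (numer (MvPolynomial.X : Fin (3 + m) → MvPolynomial (Fin (3 + m)) ℂ)).IsHomogeneous
      (numerDeg m) := by
  have hX := fun i : Fin (3 + m) => MvPolynomial.isHomogeneous_X ℂ i
  refine .mul (.prod _ _ _ fun i _ => .prod _ _ _ fun j _ => .mul ?_ ((hX i).add (hX j)))
    (.prod _ _ _ fun k _ => .prod _ _ _ fun l _ => (hX _).add (hX _))
  simpa using ((hX i).sub (hX j)).pow (expE i j)

lemma sum_card_Ioi (n : ℕ) : ∑ i : Fin n, #(Ioi i) = n * (n - 1) / 2 := by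
  simp only [Fin.card_Ioi]
  rw [Fin.sum_univ_eq_sum_range (fun i => n - 1 - i), Finset.sum_range_reflect (fun i => i) n,
    Finset.sum_range_id]

/-- The degree in `D` of the residue polynomial: it is the total pole order, of which the numerator
cancels `numerDeg m`. -/
lemma numerDeg_add (m : ℕ) :
    numerDeg m + m * (m + 13) / 2 = (3 + m) * (2 * (3 + m) - 1) := by
  have h1 : ∑ i : Fin (3 + m), ∑ j ∈ Ioi i, (expE i j - 1) = 3 + m * (m - 1) / 2 := by
    have h := prod_Ioi_pow_expE (m := m) fun _ _ => 2
    simp only [Finset.prod_pow_eq_pow_sum, Finset.prod_const, sum_card_Ioi, ← pow_add] at h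
    exact Nat.pow_right_injective le_rfl h
  have h2 : ∑ i : Fin (3 + m), ∑ j ∈ Ioi i, (expE i j + 1) =
      ∑ i : Fin (3 + m), ∑ j ∈ Ioi i, (expE i j - 1) + ∑ i : Fin (3 + m), ∑ j ∈ Ioi i, 2 := by
    simp_rw [← Finset.sum_add_distrib]
    refine Finset.sum_congr rfl fun i _ => Finset.sum_congr rfl fun j _ => ?_
    unfold expE
    split_ifs <;> rfl
  have h3 : ∑ k : Fin 3, ∑ _l ∈ Ici k, 1 = 6 := by decide
  have h4 : ∑ i : Fin (3 + m), ∑ j ∈ Ioi i, 2 = (3 + m) * (2 + m) := by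
    simp only [Finset.sum_const, smul_eq_mul, ← Finset.sum_mul, sum_card_Ioi]
    rw [Nat.div_mul_cancel (Nat.even_mul_pred_self _).two_dvd]
    congr 1
    omega
  rw [numerDeg, h2, h1, h3, h4]
  have h5 : m * (m - 1) / 2 + m * (m + 13) / 2 = m * (m + 6) := by
    obtain _ | m := m
    · rfl
    have e1 : (m + 1) * (m + 1 - 1) / 2 * 2 = (m + 1) * (m + 1 - 1) :=
      Nat.div_mul_cancel (Nat.even_mul_pred_self _).two_dvd
    have e2 : (m + 1) * (m + 1 + 13) / 2 * 2 = (m + 1) * (m + 1 + 13) := by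
      refine Nat.div_mul_cancel (even_iff_two_dvd.1 ?_)
      rw [Nat.even_mul]
      rcases Nat.even_or_odd (m + 1) with h | h
      · exact Or.inl h
      · exact Or.inr (h.add_odd (by decide))
    rw [Nat.add_sub_cancel] at e1 ⊢
    nlinarith
  have h6 : 2 * (3 + m) - 1 = 2 * m + 5 := by omega
  rw [h6]
  nlinarith

lemma prodFunctional_prod_X_pow {n : ℕ} (w : Fin n → ℕ → ℂ) (ν : Fin n → ℕ) :
    prodFunctional w (∏ i, MvPolynomial.X i ^ ν i) = ∏ i, w i (ν i) := by
  have : (∏ i, MvPolynomial.X i ^ ν i : MvPolynomial (Fin n) ℂ) =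
      MvPolynomial.monomial (Finsupp.equivFunOnFinite.symm ν) 1 := by
    rw [MvPolynomial.monomial_eq, Finsupp.prod_fintype _ _ (by simp)]
    simp
  rw [this, prodFunctional_monomial]
  simp

lemma prodFunctional_intCast_mul {n : ℕ} (w : Fin n → ℕ → ℂ) (k : ℤ)
    (p : MvPolynomial (Fin n) ℂ) : prodFunctional w (k * p) = k * prodFunctional w p := by
  rw [← zsmul_eq_mul, map_zsmul, zsmul_eq_mul]

/-- A multiplicative functional turns an alternant times a monomial into a determinant. -/
lemma prodFunctional_det_mul {n : ℕ} (w : Fin n → ℕ → ℂ) (a e : Fin n → ℕ) :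
    prodFunctional w ((of fun i j => MvPolynomial.X i ^ a j :
        Matrix (Fin n) (Fin n) (MvPolynomial (Fin n) ℂ)).det * ∏ i, MvPolynomial.X i ^ e i) =
      (of fun i j => w i (a j + e i) : Matrix (Fin n) (Fin n) ℂ).det := by
  rw [← det_transpose, ← det_transpose (of fun i j => w i (a j + e i)), det_apply', det_apply',
    Finset.sum_mul, map_sum]
  refine Finset.sum_congr rfl fun σ _ => ?_
  rw [mul_assoc, prodFunctional_intCast_mul, ← Finset.prod_mul_distrib]
  simp only [transpose_apply, of_apply, ← pow_add]
  rw [prodFunctional_prod_X_pow]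

lemma castAdd_notMem_tailIdx {m : ℕ} (k : Fin 3) : Fin.castAdd m k ∉ tailIdx (3 + m) := by
  simp [tailIdx]

lemma natAdd_mem_tailIdx {m : ℕ} (j : Fin m) : Fin.natAdd 3 j ∈ tailIdx (3 + m) := by
  simp [tailIdx]

/-- The weights of the tail variables: the coefficient of `t ^ (2 r - 1)` in `t ^ e * exp (-t)`, where
`r = 3 + m`. -/
def tailWeight (m e : ℕ) : ℂ :=
  if e < 2 * (3 + m) then (-1) ^ (2 * m + 5 - e) / ((2 * m + 5 - e).factorial : ℂ) else 0

lemma leadWeight_castAdd {m : ℕ} (k : Fin 3) (e : ℕ) :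
    leadWeight (2 * (3 + m)) (tailIdx (3 + m)) (Fin.castAdd m k) e =
      if e + 1 = 2 * (3 + m) then 1 else 0 := by
  rw [leadWeight, if_neg (castAdd_notMem_tailIdx k)]

lemma leadWeight_natAdd {m : ℕ} (j : Fin m) (e : ℕ) :
    leadWeight (2 * (3 + m)) (tailIdx (3 + m)) (Fin.natAdd 3 j) e = tailWeight m e := by
  rw [leadWeight, if_pos (natAdd_mem_tailIdx j), tailWeight]
  simp only [show 2 * (3 + m) - 1 = 2 * m + 5 by omega]

/-- The determinant left over from the variables outside the first three. -/
def tailDet (m : ℕ) : ℂ := (of fun j l : Fin m => tailWeight m (2 * l + j)).det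

/-- The exponents in a term of the expansion of the second and third Vandermonde determinant of
the numerator. -/
def termExp {m : ℕ} (τ : Equiv.Perm (Fin 3)) (π : Equiv.Perm (Fin m)) : Fin (3 + m) → ℕ :=
  Fin.append (fun k => 2 * (τ k : ℕ) + 1) fun j => ((π j).rev : ℕ)

/-- Each term contributes the same determinant: the first three rows form a permutation matrix,
so that the matrix is block triangular. -/
lemma det_leadWeight_termExp {m : ℕ} (τ : Equiv.Perm (Fin 3)) (π : Equiv.Perm (Fin m)) :
    (of fun i j : Fin (3 + m) => leadWeight (2 * (3 + m)) (tailIdx (3 + m)) i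
      (2 * (j.rev : ℕ) + termExp τ π i)).det =
      (Equiv.Perm.sign τ : ℤ) * (Equiv.Perm.sign π : ℤ) * tailDet m := by
  rw [← det_submatrix_equiv_self finSumFinEquiv]
  set D : Matrix (Fin m) (Fin m) ℂ := of fun j l => tailWeight m (2 * (l.rev : ℕ) + (j.rev : ℕ))
    with hD
  have hdet : D.det = tailDet m := by
    rw [tailDet, ← det_submatrix_equiv_self Fin.revPerm]
    congr 1
    ext j l
    simp only [hD, submatrix_apply, of_apply, Fin.revPerm_apply, Fin.rev_rev]
  have : (of fun i j : Fin (3 + m) => leadWeight (2 * (3 + m)) (tailIdx (3 + m)) i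
      (2 * (j.rev : ℕ) + termExp τ π i)).submatrix finSumFinEquiv finSumFinEquiv =
      fromBlocks ((1 : Matrix (Fin 3) (Fin 3) ℂ).submatrix τ id) 0
        (of fun (j : Fin m) (k : Fin 3) => tailWeight m
          (2 * ((Fin.castAdd m k).rev : ℕ) + ((π j).rev : ℕ))) (D.submatrix π id) := by
    ext i j
    rcases i with k | i <;> rcases j with l | j
    · simp only [submatrix_apply, of_apply, finSumFinEquiv_apply_left, leadWeight_castAdd,
        fromBlocks_apply₁₁, termExp, Fin.append_left, one_apply, id, Fin.val_rev, Fin.ext_iff,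
        Fin.val_castAdd]
      congr 1
      apply propext
      omega
    · simp only [submatrix_apply, of_apply, finSumFinEquiv_apply_left, finSumFinEquiv_apply_right,
        leadWeight_castAdd, fromBlocks_apply₁₂, termExp, Fin.append_left, Fin.val_rev,
        Fin.val_natAdd, Matrix.zero_apply]
      rw [if_neg (by omega)]
    · simp only [submatrix_apply, of_apply, finSumFinEquiv_apply_left, finSumFinEquiv_apply_right,
        leadWeight_natAdd, fromBlocks_apply₂₁, termExp, Fin.append_right]
    · simp only [submatrix_apply, of_apply, finSumFinEquiv_apply_right,
        leadWeight_natAdd, fromBlocks_apply₂₂, termExp, Fin.append_right, hD, id]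
      congr 3
      simp only [Fin.val_rev, Fin.val_natAdd]
      omega
  rw [this, det_fromBlocks_zero₁₂, det_permute, det_permute, hdet, det_one]
  ring

lemma prod_Ioi_sub_eq_det {R : Type*} [CommRing R] {n : ℕ} (x : Fin n → R) :
    ∏ i, ∏ j ∈ Ioi i, (x i - x j) = (of fun i j => x i ^ (j.rev : ℕ)).det := by
  have h := det_projVandermonde (1 : Fin n → R) x
  simp only [Pi.one_apply, one_mul] at h
  rw [← h]
  congr 1
  ext i j
  simp [projVandermonde_apply]

/-- The product of the second and third Vandermonde determinant of the numerator, expanded. -/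
lemma numer_small_factors_eq {R : Type*} [CommRing R] {m : ℕ} (x : Fin (3 + m) → R) :
    (∏ k : Fin 3, x (Fin.castAdd m k)) *
        (∏ i : Fin 3, ∏ j ∈ Ioi i, (x (Fin.castAdd m i) ^ 2 - x (Fin.castAdd m j) ^ 2)) *
        (∏ i : Fin m, ∏ j ∈ Ioi i, (x (Fin.natAdd 3 i) - x (Fin.natAdd 3 j))) =
      -∑ τ : Equiv.Perm (Fin 3), ∑ π : Equiv.Perm (Fin m),
        ((Equiv.Perm.sign τ : ℤ) * (Equiv.Perm.sign π : ℤ) : ℤ) *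
          ∏ i, x i ^ termExp τ π i := by
  have h1 : ∏ i : Fin 3, ∏ j ∈ Ioi i, (x (Fin.castAdd m i) ^ 2 - x (Fin.castAdd m j) ^ 2) =
      -∏ i : Fin 3, ∏ j ∈ Ioi i, (x (Fin.castAdd m j) ^ 2 - x (Fin.castAdd m i) ^ 2) := by
    have h6 : (Ioi (0 : Fin 3)) = {1, 2} := by decide
    have h7 : (Ioi (1 : Fin 3)) = {2} := by decide
    have h8 : (Ioi (2 : Fin 3)) = ∅ := by decide
    simp [Fin.prod_univ_three, h6, h7, h8]
    ring
  rw [h1, ← det_vandermonde, prod_Ioi_sub_eq_det, ← det_transpose, ← det_transpose (of _),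
    det_apply', det_apply', mul_neg, neg_mul, mul_assoc, Finset.sum_mul_sum, Finset.mul_sum]
  congr 1
  refine Finset.sum_congr rfl fun τ _ => ?_
  rw [Finset.mul_sum]
  refine Finset.sum_congr rfl fun π _ => ?_
  simp only [Fin.prod_univ_add, termExp, Fin.append_left, Fin.append_right, transpose_apply,
    vandermonde_apply, of_apply, pow_mul, pow_succ, Finset.prod_mul_distrib, Int.cast_mul]
  ring

/-- The `3! m!` terms in the expansion of the two small Vandermonde determinants contribute
equally; the remaining factor `8` comes from the diagonal factors `x_k + x_k`. -/
lemma prodFunctional_numer (m : ℕ) :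
    prodFunctional (leadWeight (2 * (3 + m)) (tailIdx (3 + m)))
      (numer (MvPolynomial.X : Fin (3 + m) → MvPolynomial (Fin (3 + m)) ℂ)) =
      -(48 * (m.factorial : ℂ) * tailDet m) := by
  have h8 : (8 : MvPolynomial (Fin (3 + m)) ℂ) = ((8 : ℤ) : MvPolynomial (Fin (3 + m)) ℂ) := by
    norm_cast
  rw [numer_eq, numer_small_factors_eq, prod_Ioi_sub_eq_det, h8, mul_assoc, mul_neg,
    prodFunctional_intCast_mul, map_neg]
  simp only [Finset.mul_sum, map_sum, ← pow_mul]
  have hterm : ∀ (τ : Equiv.Perm (Fin 3)) (π : Equiv.Perm (Fin m)),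
      prodFunctional (leadWeight (2 * (3 + m)) (tailIdx (3 + m)))
        ((of fun i j : Fin (3 + m) => (MvPolynomial.X i ^ (2 * (j.rev : ℕ)) :
          MvPolynomial (Fin (3 + m)) ℂ)).det *
          ((((Equiv.Perm.sign τ : ℤ) * (Equiv.Perm.sign π : ℤ) : ℤ) :
            MvPolynomial (Fin (3 + m)) ℂ) * ∏ i, MvPolynomial.X i ^ termExp τ π i)) =
        tailDet m := by
    intro τ π
    rw [mul_left_comm, prodFunctional_intCast_mul, prodFunctional_det_mul,
      det_leadWeight_termExp, ← mul_assoc]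
    have h1 : ((Equiv.Perm.sign τ : ℤ) : ℂ) * ((Equiv.Perm.sign τ : ℤ) : ℂ) = 1 := by
      rw [← Int.cast_mul, ← Units.val_mul, Int.units_mul_self]; simp
    have h2 : ((Equiv.Perm.sign π : ℤ) : ℂ) * ((Equiv.Perm.sign π : ℤ) : ℂ) = 1 := by
      rw [← Int.cast_mul, ← Units.val_mul, Int.units_mul_self]; simp
    push_cast
    linear_combination ((Equiv.Perm.sign π : ℤ) : ℂ) * ((Equiv.Perm.sign π : ℤ) : ℂ) *
      tailDet m * h1 + tailDet m * h2
  simp only [hterm, Finset.sum_const, Finset.card_univ, Fintype.card_perm, Fintype.card_fin,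
    nsmul_eq_mul]
  norm_num [Nat.factorial]
  ring

/-- Up to factors depending on the row or on the column only, the weights are falling factorials. -/
lemma tailWeight_eq {m : ℕ} (j l : Fin m) :
    tailWeight m (2 * l + j) = (-1) ^ ((j : ℕ) + 1) *
      ((((2 * m + 5 - 2 * l).factorial : ℂ))⁻¹ *
        ((2 * m + 5 - 2 * (l : ℕ)).descFactorial j : ℂ)) := by
  unfold tailWeight
  have hj := j.2
  have hl := l.2
  split_ifs with h
  · have h1 := Nat.factorial_mul_descFactorial (n := 2 * m + 5 - 2 * l) (k := j) (by omega)
    rw [show 2 * m + 5 - 2 * (l : ℕ) - j = 2 * m + 5 - (2 * l + j) by omega] at h1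
    have h2 : (-1 : ℂ) ^ (2 * m + 5 - (2 * l + j)) = (-1) ^ ((j : ℕ) + 1) :=
      neg_one_pow_congr (by rw [Nat.even_iff, Nat.even_iff]; omega)
    have h3 : ((2 * m + 5 - 2 * (l : ℕ)).descFactorial j : ℂ) ≠ 0 :=
      Nat.cast_ne_zero.2 fun h0 => by rw [Nat.descFactorial_eq_zero_iff_lt] at h0; omega
    rw [h2, ← h1, Nat.cast_mul, mul_inv, mul_assoc, inv_mul_cancel₀ h3, mul_one, div_eq_mul_inv]
  · rw [Nat.descFactorial_eq_zero_iff_lt.2 (by omega)]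
    simp

lemma factRatio_eq (m : ℕ) : factRatio (3 + m) =
    (∏ k ∈ range m, (k.factorial : ℂ)) *
      ∏ l : Fin m, (((2 * m + 5 - 2 * (l : ℕ)).factorial : ℂ))⁻¹ := by
  have h : ∏ l : Fin m, (((2 * m + 5 - 2 * (l : ℕ)).factorial : ℂ))⁻¹ =
      (∏ k ∈ Icc 4 (3 + m), ((2 * k - 1).factorial : ℂ))⁻¹ := by
    rw [Finset.prod_inv_distrib, Fin.prod_univ_eq_prod_range
      (fun l => ((2 * m + 5 - 2 * l).factorial : ℂ)), ← Finset.prod_range_reflect,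
      ← Finset.Ico_add_one_right_eq_Icc, Finset.prod_Ico_eq_prod_range,
      show 3 + m + 1 - 4 = m by omega]
    congr 1
    refine Finset.prod_congr rfl fun l hl => ?_
    have := Finset.mem_range.1 hl
    congr 2
    omega
  rw [h, factRatio, Nat.add_sub_cancel_left, div_eq_mul_inv]

/-- The falling factorials in the tail determinant may be replaced by powers, which makes it a
Vandermonde determinant in an arithmetic progression. -/
lemma tailDet_eq {m : ℕ} (hm : 0 < m) :
    tailDet m = (-1) ^ m * 2 ^ (m * (m - 1) / 2) * factRatio (3 + m) := by
  have h1 : (of fun j l : Fin m => tailWeight m (2 * l + j)) =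
      of fun j l : Fin m => (-1 : ℂ) ^ ((j : ℕ) + 1) * (of fun j l : Fin m =>
        (((2 * m + 5 - 2 * (l : ℕ)).factorial : ℂ))⁻¹ * (of fun j l : Fin m =>
          ((2 * m + 5 - 2 * (l : ℕ)).descFactorial j : ℂ)) j l) j l := by
    ext j l
    simp [tailWeight_eq]
  -- the falling factorials are monic polynomials, so their determinant is a Vandermonde
  have h2 : (of fun j l : Fin m => ((2 * m + 5 - 2 * (l : ℕ)).descFactorial j : ℂ)).det =
      (∏ j : Fin m, (-2 : ℂ) ^ (j : ℕ)) * ∏ k ∈ range m, (k.factorial : ℂ) := by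
    have e1 := det_eval_matrixOfPolynomials_eq_det_vandermonde
      (fun l : Fin m => ((2 * m + 5 - 2 * (l : ℕ) : ℕ) : ℂ)) (fun j => descPochhammer ℂ j)
      (fun j => descPochhammer_natDegree ℂ j) (fun j => monic_descPochhammer ℂ j)
    simp only [descPochhammer_eval_eq_descFactorial] at e1
    rw [← det_transpose]
    refine Eq.trans ?_ (e1.symm.trans ?_)
    · rfl
    have e2 : (fun l : Fin m => ((2 * m + 5 - 2 * (l : ℕ) : ℕ) : ℂ)) =
        fun l : Fin m => -2 * (l : ℂ) + (2 * m + 5) := by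
      ext l
      have := l.2
      rw [Nat.cast_sub (by omega)]
      push_cast
      ring
    have e3 : vandermonde (fun l : Fin m => -2 * (l : ℂ)) =
        of fun i j : Fin m => (-2 : ℂ) ^ (j : ℕ) * vandermonde (fun l : Fin m => (l : ℂ)) i j := by
      ext i j
      rw [vandermonde_apply, of_apply, vandermonde_apply, mul_pow]
    rw [e2, det_vandermonde_add, e3, det_mul_row]
    congr 1
    obtain ⟨k, rfl⟩ := Nat.exists_eq_succ_of_ne_zero hm.ne'
    rw [det_vandermonde_id_eq_superFactorial, Finset.prod_range_succ',
      ← Nat.prod_range_factorial_succ, Nat.cast_prod]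
    simp
  rw [tailDet, h1, det_mul_column, det_mul_row, h2, factRatio_eq]
  have h3 : (∏ j : Fin m, (-1 : ℂ) ^ ((j : ℕ) + 1)) * ∏ j : Fin m, (-2 : ℂ) ^ (j : ℕ) =
      (-1) ^ m * 2 ^ (m * (m - 1) / 2) := by
    rw [← Finset.prod_mul_distrib, ← Finset.sum_range_id, ← Fin.sum_univ_eq_sum_range (fun i => i),
      ← Finset.prod_pow_eq_pow_sum, ← Fin.prod_const, ← Finset.prod_mul_distrib]
    refine Finset.prod_congr rfl fun j _ => ?_
    rw [pow_succ, mul_right_comm, ← mul_pow]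
    norm_num
  rw [← h3]
  ring

/-! ### The integration kernel in Cayley coordinates -/

@[fun_prop]
lemma analyticAt_apply {n : ℕ} (i : Fin n) (c : Fin n → ℂ) :
    AnalyticAt ℂ (fun z : Fin n → ℂ => z i) c :=
  (ContinuousLinearMap.proj (R := ℂ) (φ := fun _ : Fin n => ℂ) i).analyticAt c

lemma exists_ball_of_analyticAt {n : ℕ} {f : (Fin n → ℂ) → ℂ} {c : Fin n → ℂ}
    (hf : AnalyticAt ℂ f c) : ∃ ρ : ℝ, 0 < ρ ∧ SepHol c ρ f := by
  obtain ⟨ρ, hρ, h⟩ := Metric.eventually_nhds_iff_ball.1 hf.eventually_analyticAt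
  exact ⟨ρ, hρ, .of_differentiableOn fun z hz => (h z hz).differentiableAt.differentiableWithinAt⟩

lemma eval_numer {m : ℕ} (x : Fin (3 + m) → ℂ) :
    MvPolynomial.eval x (numer (MvPolynomial.X : Fin (3 + m) → MvPolynomial (Fin (3 + m)) ℂ)) =
      numer x := by
  simp [numer, map_prod]

/-- The factor `(u + 1) (v + 1) / 2` which relates `u - v` and `u v - 1` to the difference and the
sum of the Cayley coordinates of `u` and `v`. -/
def cayleyFactor (u v : ℂ) : ℂ := (u + 1) * (v + 1) / 2

lemma sub_eq_cayley {u v : ℂ} (hu : u + 1 ≠ 0) (hv : v + 1 ≠ 0) :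
    u - v = ((u - 1) / (u + 1) - (v - 1) / (v + 1)) * cayleyFactor u v := by
  unfold cayleyFactor
  field_simp
  ring

lemma one_sub_mul_eq_cayley {u v : ℂ} (hu : u + 1 ≠ 0) (hv : v + 1 ≠ 0) :
    1 - u * v = ((u - 1) / (u + 1) + (v - 1) / (v + 1)) * -cayleyFactor u v := by
  unfold cayleyFactor
  field_simp
  ring

variable {m : ℕ}

/-- The denominator of the kernel, without the pole at the centre. -/
def kernelDen (z : Fin (3 + m) → ℂ) : ℂ :=
  ((∏ k : Fin 3, ∏ l ∈ tailIdx (3 + m), (1 + z (Fin.castAdd m k) * z l) *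
      ((z (Fin.castAdd m k))⁻¹ + (z (Fin.castAdd m k) ^ 2)⁻¹ * z l))
    * ∏ k ∈ tailIdx (3 + m), ∏ l ∈ (tailIdx (3 + m)).filter (fun l => k ≤ l), (1 + z k * z l))
    * (∏ i, z i) ^ (3 + m)

/-- The smooth factor of the kernel. -/
def kernelReg (z : Fin (3 + m) → ℂ) : ℂ :=
  ((∏ i, ∏ j ∈ Ioi i, cayleyFactor (z i) (z j) ^ expE i j * -cayleyFactor (z i) (z j)) *
    ∏ k : Fin 3, ∏ l ∈ Ici k, -cayleyFactor (z (Fin.castAdd m k)) (z (Fin.castAdd m l))) /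
    kernelDen z

/-- The kernel in Cayley coordinates, with the pole at the centre made explicit. -/
lemma kernel_eq (hr : 4 ≤ 3 + m) {z : Fin (3 + m) → ℂ} (hz : ∀ i, z i + 1 ≠ 0) :
    kernel hr z = kernelReg z * numer (fun i => (z i - 1) / (z i + 1)) /
      ∏ i, (z i - 1) ^ (2 * (3 + m)) := by
  have h1 : ∀ i j, (z i - z j) ^ expE i j * (1 - z i * z j) =
      (((z i - 1) / (z i + 1) - (z j - 1) / (z j + 1)) ^ expE i j *
        ((z i - 1) / (z i + 1) + (z j - 1) / (z j + 1))) *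
      (cayleyFactor (z i) (z j) ^ expE i j * -cayleyFactor (z i) (z j)) := by
    intro i j
    rw [one_sub_mul_eq_cayley (hz i) (hz j)]
    nth_rw 1 [sub_eq_cayley (hz i) (hz j)]
    rw [mul_pow]
    ring
  have h2 : ∀ k l : Fin 3, 1 - head hr z k * head hr z l =
      ((z (Fin.castAdd m k) - 1) / (z (Fin.castAdd m k) + 1) +
        (z (Fin.castAdd m l) - 1) / (z (Fin.castAdd m l) + 1)) *
        -cayleyFactor (z (Fin.castAdd m k)) (z (Fin.castAdd m l)) := fun k l =>
    one_sub_mul_eq_cayley (hz _) (hz _)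
  have h3 : ∀ i, (1 - z i) ^ (2 * (3 + m)) = (z i - 1) ^ (2 * (3 + m)) := fun i => by
    rw [← neg_sub, Even.neg_pow (even_two_mul _)]
  simp only [kernel, h1, h2, h3, Finset.prod_mul_distrib]
  simp only [← Finset.prod_mul_distrib]
  rw [kernelReg, numer, kernelDen]
  have h4 : ∀ k, head hr z k = z (Fin.castAdd m k) := fun _ => rfl
  simp only [h4, Finset.prod_mul_distrib, div_eq_mul_inv, mul_inv]
  ring

lemma tailIdx_eq_map (m : ℕ) :
    tailIdx (3 + m) = univ.map (Fin.natAddEmb 3 : Fin m ↪ Fin (3 + m)) := by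
  ext j
  simp only [tailIdx, mem_filter, mem_univ, true_and, mem_map, Fin.natAddEmb_apply]
  constructor
  · intro h
    exact ⟨⟨j - 3, by omega⟩, Fin.ext (by simp; omega)⟩
  · rintro ⟨i, rfl⟩
    simp

lemma card_tailIdx (m : ℕ) : #(tailIdx (3 + m)) = m := by
  rw [tailIdx_eq_map, card_map, card_univ, Fintype.card_fin]

lemma sum_card_tailIdx (m : ℕ) :
    ∑ k ∈ tailIdx (3 + m), #((tailIdx (3 + m)).filter (fun l => k ≤ l)) = m * (m + 1) / 2 := by
  rw [tailIdx_eq_map, sum_map]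
  have h : ∀ i : Fin m, #((univ.map (Fin.natAddEmb 3 : Fin m ↪ Fin (3 + m))).filter
      (fun l => (Fin.natAddEmb 3) i ≤ l)) = #(Ioi i) + 1 := by
    intro i
    rw [filter_map, card_map]
    have : univ.filter ((fun l => (Fin.natAddEmb 3) i ≤ l) ∘
        (Fin.natAddEmb 3 : Fin m ↪ Fin (3 + m))) = Ici i := by
      ext j
      simp
    rw [this, Fin.card_Ici, Fin.card_Ioi]
    omega
  simp_rw [h]
  rw [Finset.sum_add_distrib, sum_card_Ioi, Finset.sum_const, card_univ, Fintype.card_fin,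
    smul_eq_mul, mul_one]
  obtain _ | k := m
  · rfl
  · rw [Nat.add_sub_cancel, ← Nat.add_mul_div_right _ _ two_pos]
    congr 1
    ring

lemma kernelDen_one : kernelDen (fun _ : Fin (3 + m) => 1) =
    2 ^ (6 * m) * 2 ^ (m * (m + 1) / 2) := by
  simp only [kernelDen, Finset.prod_const, card_tailIdx, Finset.prod_pow_eq_pow_sum,
    sum_card_tailIdx]
  norm_num [← pow_mul]
  rw [show 6 * m = 2 * (m * 3) by ring, pow_mul 2 2]
  norm_num

lemma kernelReg_analyticAt : AnalyticAt ℂ (kernelReg (m := m)) (fun _ => 1) := by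
  have hc : ∀ i j : Fin (3 + m), AnalyticAt ℂ (fun z : Fin (3 + m) → ℂ =>
      cayleyFactor (z i) (z j)) (fun _ => 1) := fun i j => by
    unfold cayleyFactor
    fun_prop
  refine .div (.mul (Finset.analyticAt_fun_prod _ fun i _ => Finset.analyticAt_fun_prod _
    fun j _ => ((hc i j).pow _).mul (hc i j).neg) (Finset.analyticAt_fun_prod _
    fun i _ => Finset.analyticAt_fun_prod _ fun j _ => (hc _ _).neg)) (.mul (.mul
    (Finset.analyticAt_fun_prod _ fun i _ => Finset.analyticAt_fun_prod _ fun j _ => ?_)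
    (Finset.analyticAt_fun_prod _ fun i _ => Finset.analyticAt_fun_prod _ fun j _ => ?_))
    (.pow (Finset.analyticAt_fun_prod _ fun i _ => ?_) _)) ?_
  · fun_prop (disch := simp)
  · fun_prop
  · fun_prop
  · exact kernelDen_one.trans_ne (by simp)

lemma kernelReg_one : kernelReg (fun _ : Fin (3 + m) => 1) =
    (-1) ^ ((3 + m) * (2 + m) / 2) * 2 ^ numerDeg m / (2 ^ (6 * m) * 2 ^ (m * (m + 1) / 2)) := by
  have h1 : cayleyFactor 1 1 = 2 := by norm_num [cayleyFactor]
  have h2 : ∀ i j : Fin (3 + m), (2 : ℂ) ^ expE i j * -2 = -1 * 2 ^ (expE i j + 1) :=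
    fun i j => by ring
  have h3 : ∏ k : Fin 3, ∏ _l ∈ Ici k, (-2 : ℂ) = ∏ k : Fin 3, ∏ _l ∈ Ici k, 2 ^ 1 := by
    simp [Fin.prod_univ_three]
    norm_num
  have h4 : ∑ i : Fin (3 + m), #(Ioi i) = (3 + m) * (2 + m) / 2 := by
    rw [sum_card_Ioi, show 3 + m - 1 = 2 + m by omega]
  rw [kernelReg, kernelDen_one, h1, h3, numerDeg, pow_add]
  congr 1
  simp only [h2, Finset.prod_mul_distrib, Finset.prod_const, Finset.prod_pow_eq_pow_sum, h4,
    pow_one, mul_assoc, Finset.sum_const, smul_eq_mul, mul_one]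

/-- The leading term of the integrals, for an arbitrary function in place of the product of
`𝒢` and the Euler product. -/
theorem exists_polynomial_integral (hr : 4 ≤ 3 + m) : ∃ ρ₁ : ℝ, 0 < ρ₁ ∧
    ∀ (ρ : ℝ) (f : (Fin (3 + m) → ℂ) → ℂ), 0 < ρ → ρ ≤ ρ₁ → SepHol (fun _ => 1) ρ f →
    (∀ r : ℝ, 0 < r → r < ρ → ∀ D : ℕ, TorusIntegrable
        (fun z => f z / (∏ j ∈ tailIdx (3 + m), z j ^ D) * kernel hr z)
        (fun _ => 1) (fun _ => r)) ∧
    ∃ P : ℂ[X], P.natDegree ≤ m * (m + 13) / 2 ∧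
      P.coeff (m * (m + 13) / 2) = 3 * (2 : ℂ) ^ (25 - 7 * ((3 + m : ℕ) : ℤ)) *
        (m.factorial : ℂ) * factRatio (3 + m) * f (fun _ => 1) ∧
      ∀ r : ℝ, 0 < r → r < ρ → ∀ D : ℕ,
        (-1) ^ ((3 + m) * (3 + m + 1) / 2) / (2 * Real.pi * Complex.I) ^ (3 + m) *
          torusIntegral (fun z => f z / (∏ j ∈ tailIdx (3 + m), z j ^ D) * kernel hr z)
          (fun _ => 1) (fun _ => r) = P.eval (D : ℂ) := by
  obtain ⟨ρ₂, hρ₂, hΨ⟩ := exists_ball_of_analyticAt (kernelReg_analyticAt (m := m))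
  refine ⟨min ρ₂ 1, lt_min hρ₂ one_pos, fun ρ f hρ hρ₁ hf => ?_⟩
  have hρ1 : ρ ≤ 1 := hρ₁.trans (min_le_right _ _)
  have hfΨ := hf.mul (hΨ.mono (hρ₁.trans (min_le_left _ _)))
  have hne : ∀ z ∈ Metric.ball (fun _ => 1 : Fin (3 + m) → ℂ) ρ, ∀ i, z i + 1 ≠ 0 := by
    intro z hz i h
    have h1 := apply_mem_ball hz i
    rw [eq_neg_of_add_eq_zero_left h, Metric.mem_ball, dist_eq_norm] at h1
    norm_num at h1
    linarith
  have hne0 : ∀ z ∈ Metric.ball (fun _ => 1 : Fin (3 + m) → ℂ) ρ, ∀ i, z i ≠ 0 :=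
    fun z hz i => ne_zero_of_mem_ball_one hρ1 (apply_mem_ball hz i)
  -- on the polydisc the integrand has the shape required by `exists_residue_polynomial`
  have hEq : ∀ (D : ℕ), ∀ z ∈ Metric.ball (fun _ => 1 : Fin (3 + m) → ℂ) ρ,
      f z / (∏ j ∈ tailIdx (3 + m), z j ^ D) * kernel hr z =
      polar (fun _ => 1) (2 * (3 + m)) (fun z => f z * kernelReg z *
        MvPolynomial.eval (fun i => (z i - 1) / (z i + 1)) (numer MvPolynomial.X) *
        ∏ i ∈ tailIdx (3 + m), (z i ^ D)⁻¹) z := by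
    intro D z hz
    rw [kernel_eq hr (hne z hz), polar, eval_numer, Finset.prod_inv_distrib]
    ring
  have hR : ∀ r : ℝ, 0 < r → r < ρ →
      ∀ i : Fin (3 + m), 0 < (fun _ => r) i ∧ (fun _ => r) i < ρ := fun r h1 h2 _ => ⟨h1, h2⟩
  have hN : numerDeg m + m * (m + 13) / 2 = (3 + m) * (2 * (3 + m) - 1) := numerDeg_add m
  obtain ⟨Q, hQ1, hQ2, hQ3⟩ := exists_residue_polynomial hρ hρ1 (K := 2 * (3 + m)) (by omega)
    (tailIdx (3 + m)) hfΨ (numer_isHomogeneous m) hN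
  refine ⟨fun r h1 h2 D => ?_, C ((-1) ^ ((3 + m) * (3 + m + 1) / 2)) * Q,
    (natDegree_C_mul_le _ _).trans hQ1, ?_, fun r h1 h2 D => ?_⟩
  · have hnum : SepHol (fun _ => 1) ρ fun z : Fin (3 + m) → ℂ =>
        MvPolynomial.eval (fun i => (z i - 1) / (z i + 1)) (numer MvPolynomial.X) := by
      refine .of_differentiableOn fun z hz => ?_
      simp_rw [← MvPolynomial.coe_aeval_eq_eval]
      refine (AnalyticAt.aeval_mvPolynomial (fun i => ?_) _).differentiableAt.differentiableWithinAt
      have := hne z hz i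
      fun_prop (disch := assumption)
    have hint := ((hfΨ.mul hnum).mul (.finset_prod (tailIdx (3 + m)) (f := fun i z => (z i ^ D)⁻¹)
      fun i _ => .of_differentiableOn (DifferentiableOn.inv (by fun_prop)
        fun z hz => pow_ne_zero _ (hne0 z hz i)))).torusIntegrable_polar hρ (hR r h1 h2)
        (2 * (3 + m))
    unfold TorusIntegrable at hint ⊢
    refine hint.congr_fun (fun θ _ => ?_) measurableSet_Icc
    exact (hEq D _ (torusMap_mem_ball hρ (hR r h1 h2) θ)).symm
  · rw [coeff_C_mul, hQ2, prodFunctional_numer, tailDet_eq (by omega), kernelReg_one]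
    have h2 : (2 : ℂ) ≠ 0 := two_ne_zero
    have e1 : (2 : ℂ) ^ (25 - 7 * ((3 + m : ℕ) : ℤ)) = 2 ^ 4 / 2 ^ (7 * m) := by
      rw [show (25 - 7 * ((3 + m : ℕ) : ℤ)) = (4 : ℕ) - ((7 * m : ℕ) : ℤ) by push_cast; ring,
        zpow_sub₀ h2, zpow_natCast, zpow_natCast]
    have e2 : (2 : ℂ) ^ (m * (m + 1) / 2) = 2 ^ (m * (m - 1) / 2) * 2 ^ m := by
      obtain _ | k := m
      · omega
      rw [← pow_add, Nat.add_sub_cancel, ← Nat.add_mul_div_right _ _ two_pos]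
      congr 2
      ring
    -- the exponents add up to `(3 + m) ^ 2 + m`, which is odd
    have e3 : (-1 : ℂ) ^ ((3 + m) * (3 + m + 1) / 2) * (-1) ^ ((3 + m) * (2 + m) / 2) * (-1) ^ m =
        -1 := by
      have h : (3 + m) * (3 + m + 1) / 2 + (3 + m) * (2 + m) / 2 = (3 + m) * (3 + m) := by
        have h3 : (3 + m) * (3 + m + 1) = (3 + m) * (2 + m) + (3 + m) * 2 := by ring
        have h4 : (3 + m) * (2 + m) / 2 * 2 = (3 + m) * (2 + m) := by
          refine Nat.div_mul_cancel (even_iff_two_dvd.1 ?_)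
          rw [show 3 + m = (2 + m) + 1 by ring, mul_comm]
          exact Nat.even_mul_succ_self _
        rw [h3, Nat.add_mul_div_right _ _ two_pos]
        nlinarith
      rw [← pow_add, ← pow_add, h]
      refine Odd.neg_one_pow ?_
      rcases Nat.even_or_odd m with hm | hm
      · exact (((by decide : Odd 3).add_even hm).mul ((by decide : Odd 3).add_even hm)).add_even hm
      · exact (((by decide : Odd 3).add_odd hm).mul_right _).add_odd hm
    rw [e1, e2]
    have h4 : (2 : ℂ) ^ numerDeg m ≠ 0 := pow_ne_zero _ h2
    have h5 : (2 : ℂ) ^ (m * (m - 1) / 2) ≠ 0 := pow_ne_zero _ h2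
    field_simp
    linear_combination (-48 * 2 ^ (7 * m) * f (fun _ => 1) * m.factorial * factRatio (3 + m)) * e3
  · rw [torusIntegral_congr fun θ => hEq D _ (torusMap_mem_ball hρ (hR r h1 h2) θ),
      hQ3 r h1 h2 D, eval_mul, eval_C, ← mul_assoc,
      div_mul_cancel₀ _ (pow_ne_zero _ Complex.two_pi_I_ne_zero)]

/-! ### The regularized local factor as a polynomial -/

section RegPoly

variable {A : Type*} [CommRing A] {m : ℕ}

/-- The bracket in the regularized local factor, after clearing the denominators. With
`e = |p| ^ (-1/4)`, `θ = 1 / (ζ ξ₁ ξ₂ ξ₃)` and `a_k = ξ_k ^ 2`, the quantities `u_k` are the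
arguments `y_k` of `R`, and `v = |p| ^ (1/2) y₁ y₂ y₃ / χ`, so that `(1 - v ^ 2)⁻¹` is the first
factor of `R`; moreover `κ a_k = 1 / (|p| y_k)` and `κ = 1 / (|p| v)`. Finally `h = 1/2`, and `ip`, `im`
stand for `∏ (1 ∓ e ^ 2 ξ_j ^ 2)⁻¹`. The variables `α`, `β`, `γ` are, up to the denominators, the
contributions of the three diagonal entries of `M(v)` to the row vector `L`. -/
def regBracket (h e χ θ ip im a₀ a₁ a₂ : A) : A :=
  let u₀ := e * χ * θ * (a₁ * a₂)
  let u₁ := e * χ * θ * (a₀ * a₂)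
  let u₂ := e * χ * θ * (a₀ * a₁)
  let v := e * χ * θ * (a₀ * a₁ * a₂)
  let κ := e ^ 3 * θ
  let p := (1 - κ * a₀) * (1 - κ * a₁) * (1 - κ * a₂) * ((1 + u₀) * (1 + u₁) * (1 + u₂))
  let n := (1 + κ * a₀) * (1 + κ * a₁) * (1 + κ * a₂) * ((1 - u₀) * (1 - u₁) * (1 - u₂))
  let d := (1 + u₀) * (1 + u₁) * (1 + u₂) * ((1 - u₀) * (1 - u₁) * (1 - u₂))
  let α := h ^ 2 * (p + n + (κ * d + κ * d)) * ((1 - κ) * (1 + v))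
  let γ := h ^ 2 * (p + n - (κ * d + κ * d)) * ((1 + κ) * (1 - v))
  let β := h * (p - n) * (e * θ * (1 - v ^ 2))
  κ * (α - γ) + h * (α + γ + β) * ip + h * (α + γ - β) * im

/-- The regularized local factor as a polynomial in `e = |p| ^ (-1/4)`, in `θ = 1 / (ζ ξ₁ ξ₂ ξ₃)`,
in `a_k = ξ_k ^ 2`, `b_k = ξ_k ^ (-2)` for `k ≤ 3`, in `s_j = ξ_j ^ 2` for `j > 3`, and in
`ip, im = ∏ (1 ∓ e ^ 2 ξ_j ^ 2)⁻¹`. -/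
def regPoly (h e χ θ ip im : A) (a b : Fin 3 → A) (s : Fin m → A) : A :=
  (1 - e ^ 4) * ((1 - e ^ 2 * χ * a 0) * (1 - e ^ 2 * χ * a 1) * (1 - e ^ 2 * χ * a 2))
    * regBracket h e χ θ ip im (a 0) (a 1) (a 2)
    * (∏ i, ∏ j, (1 - e ^ 4 * (a i * s j)) * (1 - e ^ 4 * (b i * s j)))
    * ∏ k, ∏ l ∈ Ici k, (1 - e ^ 4 * (s k * s l))

lemma map_regPoly {B : Type*} [CommRing B] (f : A →+* B) (h e χ θ ip im : A) (a b : Fin 3 → A)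
    (s : Fin m → A) :
    f (regPoly h e χ θ ip im a b s) = regPoly (f h) (f e) (f χ) (f θ) (f ip) (f im)
      (fun i => f (a i)) (fun i => f (b i)) (fun j => f (s j)) := by
  simp [regPoly, regBracket, map_prod]

lemma prod_one_sub_trunc {e : A} (he : e ^ 6 = 0) {ι : Type*} (t : Finset ι) (c : ι → A) :
    ∏ i ∈ t, (1 - e ^ 4 * c i) = 1 - e ^ 4 * ∑ i ∈ t, c i := by
  induction t using Finset.cons_induction with
  | empty => simp
  | cons i t hi ih =>
    rw [Finset.prod_cons, ih, Finset.sum_cons]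
    linear_combination (e ^ 2 * c i * ∑ i ∈ t, c i) * he

lemma prod_Ici_succ {M : Type*} [CommMonoid M] (f : Fin (m + 1) → Fin (m + 1) → M) :
    ∏ k, ∏ l ∈ Ici k, f k l = (∏ l, f 0 l) * ∏ k : Fin m, ∏ l ∈ Ici k, f k.succ l.succ := by
  have h : ∀ (n : ℕ) (g : Fin n → M) (k : Fin n),
      ∏ l ∈ Ici k, g l = ∏ l, if k ≤ l then g l else 1 := by
    intro n g k
    rw [← Finset.prod_filter]
    congr 1
    ext l
    simp
  simp only [h]
  rw [Fin.prod_univ_succ]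
  congr 1
  refine Finset.prod_congr rfl fun k _ => ?_
  rw [Fin.prod_univ_succ]
  simp

/-- The products over the tail variables up to order six: `ε` is their second elementary symmetric
polynomial, so that `(∑ s_j) ^ 2 - ε` is the complete one. -/
lemma exists_tail_trunc {e : A} (he : e ^ 6 = 0) (s : Fin m → A) : ∃ ε : A,
    ∏ j, (1 - e ^ 2 * s j) = 1 - e ^ 2 * ∑ j, s j + e ^ 4 * ε ∧
    ∏ j, (1 + e ^ 2 * s j) = 1 + e ^ 2 * ∑ j, s j + e ^ 4 * ε ∧
    ∏ k, ∏ l ∈ Ici k, (1 - e ^ 4 * (s k * s l)) = 1 - e ^ 4 * ((∑ j, s j) ^ 2 - ε) := by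
  induction m with
  | zero => exact ⟨0, by simp⟩
  | succ m ih =>
    obtain ⟨ε, h1, h2, h3⟩ := ih fun j => s j.succ
    set t := ∑ j : Fin m, s j.succ with ht
    refine ⟨ε + s 0 * t, ?_, ?_, ?_⟩
    · rw [Fin.prod_univ_succ, h1, Fin.sum_univ_succ, ← ht]
      linear_combination (-(s 0 * ε)) * he
    · rw [Fin.prod_univ_succ, h2, Fin.sum_univ_succ, ← ht]
      linear_combination (s 0 * ε) * he
    · rw [prod_Ici_succ, h3, prod_one_sub_trunc he, ← Finset.mul_sum, Fin.sum_univ_succ, ← ht]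
      linear_combination (e ^ 2 * s 0 * (s 0 + t) * (t ^ 2 - ε)) * he

/-- The bracket up to terms of order six. -/
lemma regBracket_trunc {h e χ θ ip im a₀ a₁ a₂ f g : A} (he : e ^ 6 = 0) (hh : 2 * h = 1)
    (hχ : χ ^ 2 = 1) (hθ : θ ^ 2 * (a₀ * a₁ * a₂) = χ)
    (hip : ip = 1 + e ^ 2 * f + e ^ 4 * g) (him : im = 1 - e ^ 2 * f + e ^ 4 * g) :
    regBracket h e χ θ ip im a₀ a₁ a₂ = 1 + e ^ 2 * (χ * (a₀ + a₁ + a₂)) + e ^ 4 * (1 + g +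
      χ * θ ^ 2 * (a₀ * a₁ + a₀ * a₂ + a₁ * a₂) * (f - (a₀ + a₁ + a₂))) := by
  set σ := a₀ + a₁ + a₂ with hσ
  set b := a₀ * a₁ + a₀ * a₂ + a₁ * a₂ with hb
  set P := a₀ * a₁ * a₂ with hP
  -- the elementary symmetric polynomials in the `u_k / e`
  have hU2 : χ ^ 2 * θ ^ 2 * (P * σ) = χ * σ := by
    linear_combination χ ^ 2 * σ * hθ + χ * σ * hχ
  have hv : θ * (χ * θ * P) = 1 := by linear_combination χ * hθ + hχ
  have hK : ∀ c : A, (1 + c * (e ^ 3 * θ) * a₀) * (1 + c * (e ^ 3 * θ) * a₁) *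
      (1 + c * (e ^ 3 * θ) * a₂) = 1 + c * e ^ 3 * (θ * σ) := by
    intro c
    rw [hσ]
    linear_combination (c ^ 2 * θ ^ 2 * (a₀ * a₁ + a₀ * a₂ + a₁ * a₂) +
      c ^ 3 * e ^ 3 * θ ^ 3 * (a₀ * a₁ * a₂)) * he
  have hU : ∀ c : A, (1 + c * (e * χ * θ * (a₁ * a₂))) * (1 + c * (e * χ * θ * (a₀ * a₂))) *
      (1 + c * (e * χ * θ * (a₀ * a₁))) = 1 + c * e * (χ * θ * b) + c ^ 2 * e ^ 2 * (χ * σ) +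
        c ^ 3 * e ^ 3 * (χ ^ 3 * θ ^ 3 * P ^ 2) := by
    intro c
    rw [← hU2, hσ, hb, hP]
    ring
  set K := θ * σ with hKdef
  set U₁ := χ * θ * b with hU₁
  set U₂ := χ * σ with hU₂
  set U₃ := χ ^ 3 * θ ^ 3 * P ^ 2 with hU₃
  set V := χ * θ * P with hV
  have hκ1 : (1 - e ^ 3 * θ * a₀) * (1 - e ^ 3 * θ * a₁) * (1 - e ^ 3 * θ * a₂) =
      1 - e ^ 3 * K := by linear_combination hK (-1)
  have hκ2 : (1 + e ^ 3 * θ * a₀) * (1 + e ^ 3 * θ * a₁) * (1 + e ^ 3 * θ * a₂) =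
      1 + e ^ 3 * K := by linear_combination hK 1
  have hu1 : (1 + e * χ * θ * (a₁ * a₂)) * (1 + e * χ * θ * (a₀ * a₂)) *
      (1 + e * χ * θ * (a₀ * a₁)) = 1 + e * U₁ + e ^ 2 * U₂ + e ^ 3 * U₃ := by
    linear_combination hU 1
  have hu2 : (1 - e * χ * θ * (a₁ * a₂)) * (1 - e * χ * θ * (a₀ * a₂)) *
      (1 - e * χ * θ * (a₀ * a₁)) = 1 - e * U₁ + e ^ 2 * U₂ - e ^ 3 * U₃ := by
    linear_combination hU (-1)
  have h4 : 4 * h ^ 2 = 1 := by linear_combination (2 * h + 1) * hh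
  -- even and odd part of the first product, and the product of the two factors in `u`
  set S := 1 + e ^ 2 * U₂ - e ^ 4 * (K * U₁) with hS
  set O := U₁ + e ^ 2 * (U₃ - K) - e ^ 4 * (K * U₂) with hO
  have hp : (1 - e ^ 3 * K) * (1 + e * U₁ + e ^ 2 * U₂ + e ^ 3 * U₃) = S + e * O := by
    rw [hS, hO]
    linear_combination (-(K * U₃)) * he
  have hn : (1 + e ^ 3 * K) * (1 - e * U₁ + e ^ 2 * U₂ - e ^ 3 * U₃) = S - e * O := by
    rw [hS, hO]
    linear_combination (-(K * U₃)) * he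
  obtain ⟨d', hd⟩ : ∃ d', (1 + e * U₁ + e ^ 2 * U₂ + e ^ 3 * U₃) *
      (1 - e * U₁ + e ^ 2 * U₂ - e ^ 3 * U₃) = 1 + e ^ 2 * d' :=
    ⟨2 * U₂ - U₁ ^ 2 + e ^ 2 * (U₂ ^ 2 - 2 * U₁ * U₃) - e ^ 4 * U₃ ^ 2, by ring⟩
  have hS' : e ^ 4 * S = e ^ 4 := by
    rw [hS]
    linear_combination (U₂ - e ^ 2 * (K * U₁)) * he
  have hveq : e * χ * θ * P = e * V := by rw [hV]; ring
  have hκv : e ^ 3 * θ * (e * V) = e ^ 4 := by linear_combination e ^ 4 * hv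
  have hκκ : (e ^ 3 * θ) * (e ^ 3 * θ) = 0 := by linear_combination θ ^ 2 * he
  unfold regBracket
  dsimp only
  rw [hκ1, hκ2, hu1, hu2, hp, hn, hd, ← hP, hveq]
  generalize e ^ 3 * θ = κ at hκv hκκ ⊢
  set α := h ^ 2 * (S + e * O + (S - e * O) + (κ * (1 + e ^ 2 * d') + κ * (1 + e ^ 2 * d'))) *
    ((1 - κ) * (1 + e * V)) with hα
  set γ := h ^ 2 * (S + e * O + (S - e * O) - (κ * (1 + e ^ 2 * d') + κ * (1 + e ^ 2 * d'))) *
    ((1 + κ) * (1 - e * V)) with hγ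
  have hαγ : α + γ = S := by
    have : α + γ = 4 * h ^ 2 * (S * (1 - κ * (e * V)) +
        (1 + e ^ 2 * d') * (κ * (e * V) - κ * κ)) := by rw [hα, hγ]; ring
    rw [this, h4, hκv, hκκ]
    linear_combination d' * he - hS'
  have hαγ' : κ * (α - γ) = e ^ 4 := by
    have : κ * (α - γ) = 4 * h ^ 2 * (S * (κ * (e * V) - κ * κ) +
        (1 + e ^ 2 * d') * (κ * κ) * (1 - κ * (e * V))) := by rw [hα, hγ]; ring
    rw [this, h4, hκv, hκκ]
    linear_combination hS'
  have hβ : h * (S + e * O - (S - e * O)) * (e * θ * (1 - (e * V) ^ 2)) * e ^ 2 =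
      e ^ 4 * (θ * U₁) := by
    rw [hO]
    linear_combination e ^ 4 * θ * (U₁ + e ^ 2 * (U₃ - K) - e ^ 4 * (K * U₂)) *
      (1 - (e * V) ^ 2) * hh + θ * (U₃ - K - e ^ 2 * (K * U₂) -
        V ^ 2 * (U₁ + e ^ 2 * (U₃ - K) - e ^ 4 * (K * U₂))) * he
  generalize h * (S + e * O - (S - e * O)) * (e * θ * (1 - (e * V) ^ 2)) = β at hβ ⊢
  rw [hαγ, hαγ', hip, him, show χ * θ ^ 2 * b * (f - σ) = θ * U₁ * f - K * U₁ by
    rw [hU₁, hKdef]; ring]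
  linear_combination (S * (1 + e ^ 4 * g) + β * e ^ 2 * f) * hh + f * hβ + g * hS' + hS

/-- The regularized local factor is `1` up to terms of order six in `e`. This is the cancellation
that makes the Euler product of the regularized factors converge. -/
theorem regPoly_eq_one {h e χ θ ip im : A} {a b : Fin 3 → A} {s : Fin m → A} (he : e ^ 6 = 0)
    (hh : 2 * h = 1) (hχ : χ ^ 2 = 1) (hθ : θ ^ 2 * (a 0 * a 1 * a 2) = χ)
    (hab : ∀ k, a k * b k = 1)
    (hip : ip * ((∏ k, (1 - e ^ 2 * a k)) * ∏ j, (1 - e ^ 2 * s j)) = 1)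
    (him : im * ((∏ k, (1 + e ^ 2 * a k)) * ∏ j, (1 + e ^ 2 * s j)) = 1) :
    regPoly h e χ θ ip im a b s = 1 := by
  obtain ⟨ε, h1, h2, h3⟩ := exists_tail_trunc he s
  set τ := ∑ j, s j with hτ
  set σ := a 0 + a 1 + a 2 with hσ
  set c := a 0 * a 1 + a 0 * a 2 + a 1 * a 2 with hc
  set E := c + σ * τ + ε with hE
  have hm : ∀ x : A, (1 - e ^ 2 * (x * a 0)) * (1 - e ^ 2 * (x * a 1)) *
      (1 - e ^ 2 * (x * a 2)) = 1 - e ^ 2 * (x * σ) + e ^ 4 * (x ^ 2 * c) := by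
    intro x
    rw [hσ, hc]
    linear_combination (-(x ^ 3 * (a 0 * a 1 * a 2))) * he
  have hd1 : (∏ k, (1 - e ^ 2 * a k)) * ∏ j, (1 - e ^ 2 * s j) =
      1 - e ^ 2 * (σ + τ) + e ^ 4 * E := by
    rw [h1, Fin.prod_univ_three, hE]
    linear_combination (1 - e ^ 2 * τ + e ^ 4 * ε) * hm 1 - (σ * ε + c * τ - e ^ 2 * c * ε) * he
  have hd2 : (∏ k, (1 + e ^ 2 * a k)) * ∏ j, (1 + e ^ 2 * s j) =
      1 + e ^ 2 * (σ + τ) + e ^ 4 * E := by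
    rw [h2, Fin.prod_univ_three, hE]
    linear_combination (1 + e ^ 2 * τ + e ^ 4 * ε) * hm (-1) + (σ * ε + c * τ + e ^ 2 * c * ε) * he
  rw [hd1] at hip
  rw [hd2] at him
  have hip' : ip = 1 + e ^ 2 * (σ + τ) + e ^ 4 * ((σ + τ) ^ 2 - E) := by
    linear_combination (1 + e ^ 2 * (σ + τ) + e ^ 4 * ((σ + τ) ^ 2 - E)) * hip +
      ip * ((σ + τ) ^ 3 - 2 * (σ + τ) * E - e ^ 2 * E * ((σ + τ) ^ 2 - E)) * he
  have him' : im = 1 - e ^ 2 * (σ + τ) + e ^ 4 * ((σ + τ) ^ 2 - E) := by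
    linear_combination (1 - e ^ 2 * (σ + τ) + e ^ 4 * ((σ + τ) ^ 2 - E)) * him +
      im * (-((σ + τ) ^ 3 - 2 * (σ + τ) * E) - e ^ 2 * E * ((σ + τ) ^ 2 - E)) * he
  have hb : χ * θ ^ 2 * c = b 0 + b 1 + b 2 := by
    have e0 := hab 0
    have e1 := hab 1
    have e2 := hab 2
    -- `χ θ² a₀ a₁ a₂ = 1`, so that `χ θ² a₁ a₂ = b₀` and so on
    have hP : χ * θ ^ 2 * (a 0 * a 1 * a 2) = 1 := by linear_combination χ * hθ + hχ
    rw [hc]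
    linear_combination (b 0 + b 1 + b 2) * hP - χ * θ ^ 2 * (a 1 * a 2 * e0 + a 0 * a 2 * e1 +
      a 0 * a 1 * e2)
  have hW : ∏ i, ∏ j, (1 - e ^ 4 * (a i * s j)) * (1 - e ^ 4 * (b i * s j)) =
      1 - e ^ 4 * (τ * (σ + (b 0 + b 1 + b 2))) := by
    simp only [Finset.prod_mul_distrib, prod_one_sub_trunc he, ← Finset.mul_sum]
    simp only [Fin.sum_univ_three, ← hτ, hσ]
    linear_combination (e ^ 2 * τ ^ 2 * (a 0 + a 1 + a 2) * (b 0 + b 1 + b 2)) * he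
  have hmχ : (1 - e ^ 2 * χ * a 0) * (1 - e ^ 2 * χ * a 1) * (1 - e ^ 2 * χ * a 2) =
      1 - e ^ 2 * (χ * σ) + e ^ 4 * c := by
    linear_combination hm χ + e ^ 4 * c * hχ
  unfold regPoly
  rw [regBracket_trunc he hh hχ hθ hip' him', hW, h3, hmχ, ← hσ, ← hc, hb]
  have hprod : ∀ x y : A, (1 + e ^ 4 * x) * (1 + e ^ 4 * y) = 1 + e ^ 4 * (x + y) := by
    intro x y
    linear_combination (e ^ 2 * x * y) * he
  set g := 1 + ((σ + τ) ^ 2 - E) + (b 0 + b 1 + b 2) * (σ + τ - σ) with hg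
  have h5 : (1 - e ^ 2 * (χ * σ) + e ^ 4 * c) * (1 + e ^ 2 * (χ * σ) + e ^ 4 * g) =
      1 + e ^ 4 * (c + g - σ ^ 2) := by
    linear_combination (χ * σ * c - χ * σ * g + e ^ 2 * c * g) * he - e ^ 4 * σ ^ 2 * hχ
  rw [show 1 - e ^ 4 = 1 + e ^ 4 * (-1) by ring,
    show 1 - e ^ 4 * (τ * (σ + (b 0 + b 1 + b 2))) =
      1 + e ^ 4 * (-(τ * (σ + (b 0 + b 1 + b 2)))) by ring,
    show 1 - e ^ 4 * (τ ^ 2 - ε) = 1 + e ^ 4 * (-(τ ^ 2 - ε)) by ring,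
    mul_assoc (1 + e ^ 4 * (-1)), h5, hprod, hprod, hprod, hg, hE]
  ring

end RegPoly

/-! ### The bound for the regularized local factor -/

/-- The functions bounded by `C * B ^ k` for some constants `C` and `k`. -/
def polyBounded {Ω : Type*} (B : Ω → ℝ) (hB : ∀ ω, 1 ≤ B ω) : Subring (Ω → ℂ) where
  carrier := {f | ∃ (C : ℝ) (k : ℕ), 0 ≤ C ∧ ∀ ω, ‖f ω‖ ≤ C * B ω ^ k}
  mul_mem' := by
    rintro f g ⟨C, k, hC, hf⟩ ⟨C', k', hC', hg⟩
    refine ⟨C * C', k + k', by positivity, fun ω => ?_⟩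
    have := hB ω
    calc ‖f ω * g ω‖ = ‖f ω‖ * ‖g ω‖ := norm_mul _ _
      _ ≤ (C * B ω ^ k) * (C' * B ω ^ k') :=
        mul_le_mul (hf ω) (hg ω) (norm_nonneg _) (by positivity)
      _ = C * C' * B ω ^ (k + k') := by ring
  one_mem' := ⟨1, 0, zero_le_one, fun ω => by simp⟩
  add_mem' := by
    rintro f g ⟨C, k, hC, hf⟩ ⟨C', k', hC', hg⟩
    refine ⟨C + C', k + k', by positivity, fun ω => ?_⟩
    have hω := hB ω
    have h1 : B ω ^ k ≤ B ω ^ (k + k') := pow_le_pow_right₀ hω (by omega)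
    have h2 : B ω ^ k' ≤ B ω ^ (k + k') := pow_le_pow_right₀ hω (by omega)
    calc ‖f ω + g ω‖ ≤ ‖f ω‖ + ‖g ω‖ := norm_add_le _ _
      _ ≤ C * B ω ^ k + C' * B ω ^ k' := add_le_add (hf ω) (hg ω)
      _ ≤ C * B ω ^ (k + k') + C' * B ω ^ (k + k') := by gcongr
      _ = (C + C') * B ω ^ (k + k') := by ring
  zero_mem' := ⟨0, 0, le_rfl, fun ω => by simp⟩
  neg_mem' := by
    rintro f ⟨C, k, hC, hf⟩
    exact ⟨C, k, hC, fun ω => by simpa using hf ω⟩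

lemma polyBounded_of_le {Ω : Type*} {B : Ω → ℝ} {hB : ∀ ω, 1 ≤ B ω} {f : Ω → ℂ} {C : ℝ}
    (hC : 0 ≤ C) (k : ℕ) (h : ∀ ω, ‖f ω‖ ≤ C * B ω ^ k) : f ∈ polyBounded B hB :=
  ⟨C, k, hC, h⟩

/-- The regularized local factor with norm `e ^ (-4)`, and with character value `ζ ^ 2`. -/
def regFactor {m : ℕ} (e ζ : ℂ) (x : Fin (3 + m) → ℂ) : ℂ :=
  regPoly (1 / 2) e (ζ ^ 2) (ζ * (x (Fin.castAdd m 0) * x (Fin.castAdd m 1) *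
      x (Fin.castAdd m 2)))⁻¹
    (∏ j, (1 - e ^ 2 * x j ^ 2))⁻¹ (∏ j, (1 + e ^ 2 * x j ^ 2))⁻¹
    (fun k => x (Fin.castAdd m k) ^ 2) (fun k => (x (Fin.castAdd m k) ^ 2)⁻¹)
    (fun j => x (Fin.natAdd 3 j) ^ 2)

/-- The parameters of a regularized local factor, together with a bound `B` for the variables and
their inverses. -/
structure LocalParam (m : ℕ) where
  e : ℝ
  B : ℝ
  ζ : ℂ
  x : Fin (3 + m) → ℂ
  e_pos : 0 < e
  e_le : e ≤ 1
  one_le : 1 ≤ B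
  ζ_pow : ζ ^ 4 = 1
  x_ne : ∀ i, x i ≠ 0
  x_le : ∀ i, ‖x i‖ ≤ B
  inv_le : ∀ i, ‖(x i)⁻¹‖ ≤ B
  small : e ^ 2 * B ^ 2 ≤ 1 / 2

lemma norm_eq_one_of_pow_four {ζ : ℂ} (hζ : ζ ^ 4 = 1) : ‖ζ‖ = 1 := by
  have h : ‖ζ‖ ^ 4 = 1 := by rw [← norm_pow, hζ, norm_one]
  exact (pow_eq_one_iff_of_nonneg (norm_nonneg _) (by norm_num)).1 h

lemma ne_zero_of_pow_four {ζ : ℂ} (hζ : ζ ^ 4 = 1) : ζ ≠ 0 :=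
  norm_pos_iff.1 (by rw [norm_eq_one_of_pow_four hζ]; exact one_pos)

namespace LocalParam

variable {m : ℕ} (p : LocalParam m)

lemma ζ_norm : ‖p.ζ‖ = 1 := norm_eq_one_of_pow_four p.ζ_pow

lemma ζ_ne : p.ζ ≠ 0 := ne_zero_of_pow_four p.ζ_pow

lemma norm_sq_le (i : Fin (3 + m)) : ‖(p.e : ℂ) ^ 2 * p.x i ^ 2‖ ≤ 1 / 2 := by
  rw [norm_mul, norm_pow, norm_pow, Complex.norm_real, Real.norm_of_nonneg p.e_pos.le]
  refine le_trans ?_ p.small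
  have := p.x_le i
  gcongr

lemma half_le_one_sub (i : Fin (3 + m)) : 1 / 2 ≤ ‖1 - (p.e : ℂ) ^ 2 * p.x i ^ 2‖ := by
  have h1 := norm_sub_norm_le (1 : ℂ) ((p.e : ℂ) ^ 2 * p.x i ^ 2)
  have h2 := p.norm_sq_le i
  rw [norm_one] at h1
  linarith

lemma half_le_one_add (i : Fin (3 + m)) : 1 / 2 ≤ ‖1 + (p.e : ℂ) ^ 2 * p.x i ^ 2‖ := by
  have h1 := norm_sub_norm_le (1 : ℂ) (-((p.e : ℂ) ^ 2 * p.x i ^ 2))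
  have h2 := p.norm_sq_le i
  rw [norm_one, norm_neg, sub_neg_eq_add] at h1
  linarith

lemma one_sub_ne (i : Fin (3 + m)) : 1 - (p.e : ℂ) ^ 2 * p.x i ^ 2 ≠ 0 := by
  have := p.half_le_one_sub i
  exact norm_pos_iff.1 (by linarith)

lemma one_add_ne (i : Fin (3 + m)) : 1 + (p.e : ℂ) ^ 2 * p.x i ^ 2 ≠ 0 := by
  have := p.half_le_one_add i
  exact norm_pos_iff.1 (by linarith)

end LocalParam

/-- The regularized local factors are `1 + O(|p| ^ (-3/2))`, polynomially in the size of the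
variables. -/
theorem exists_norm_regFactor_sub_one_le (m : ℕ) : ∃ (C : ℝ) (k : ℕ), 0 ≤ C ∧
    ∀ p : LocalParam m, ‖regFactor p.e p.ζ p.x - 1‖ ≤ C * p.e ^ 6 * p.B ^ k := by
  set R := polyBounded (fun p : LocalParam m => p.B) fun p => p.one_le with hR
  have hone : ∀ f : LocalParam m → ℂ, (∀ p, ‖f p‖ ≤ 1) → f ∈ R := fun f hf =>
    polyBounded_of_le zero_le_one 0 fun p => by simpa using hf p
  have hBB : ∀ f : LocalParam m → ℂ, (∀ p, ‖f p‖ ≤ p.B) → f ∈ R := fun f hf =>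
    polyBounded_of_le zero_le_one 1 fun p => by simpa using hf p
  have htwo : ∀ f : LocalParam m → ℂ, (∀ p, 1 / 2 ≤ ‖f p‖) → (fun p => (f p)⁻¹) ∈ R :=
    fun f hf => polyBounded_of_le zero_le_two 0 fun p => by
      rw [norm_inv, pow_zero, mul_one]
      exact inv_le_of_inv_le₀ two_pos (by simpa using hf p)
  have hx : ∀ i, (fun p : LocalParam m => p.x i) ∈ R := fun i => hBB _ fun p => p.x_le i
  have hxi : ∀ i, (fun p : LocalParam m => (p.x i)⁻¹) ∈ R := fun i => hBB _ fun p => p.inv_le i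
  have hζ : (fun p : LocalParam m => p.ζ) ∈ R := hone _ fun p => p.ζ_norm.le
  have hζi : (fun p : LocalParam m => p.ζ⁻¹) ∈ R := hone _ fun p => by
    rw [norm_inv, p.ζ_norm, inv_one]
  have he : (fun p : LocalParam m => (p.e : ℂ)) ∈ R := hone _ fun p => by
    rw [Complex.norm_real, Real.norm_of_nonneg p.e_pos.le]
    exact p.e_le
  let h' : R := ⟨fun _ => 1 / 2, hone _ fun p => by norm_num⟩
  let e' : R := ⟨_, he⟩
  let χ' : R := ⟨fun p => p.ζ ^ 2, R.pow_mem hζ 2⟩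
  let θ' : R := ⟨fun p => (p.ζ * (p.x (Fin.castAdd m 0) * p.x (Fin.castAdd m 1) *
      p.x (Fin.castAdd m 2)))⁻¹, by
    simp only [mul_inv]
    exact R.mul_mem hζi (R.mul_mem (R.mul_mem (hxi _) (hxi _)) (hxi _))⟩
  let ip' : R := ⟨fun p => (∏ j, (1 - (p.e : ℂ) ^ 2 * p.x j ^ 2))⁻¹, by
    have := R.prod_mem (t := univ) (f := fun j p => (1 - (p.e : ℂ) ^ 2 * p.x j ^ 2)⁻¹)
      fun j _ => htwo _ fun p => p.half_le_one_sub j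
    convert this using 1
    ext p
    simp⟩
  let im' : R := ⟨fun p => (∏ j, (1 + (p.e : ℂ) ^ 2 * p.x j ^ 2))⁻¹, by
    have := R.prod_mem (t := univ) (f := fun j p => (1 + (p.e : ℂ) ^ 2 * p.x j ^ 2)⁻¹)
      fun j _ => htwo _ fun p => p.half_le_one_add j
    convert this using 1
    ext p
    simp⟩
  let a' : Fin 3 → R := fun k => ⟨fun p => p.x (Fin.castAdd m k) ^ 2, R.pow_mem (hx _) 2⟩
  let b' : Fin 3 → R := fun k => ⟨fun p => (p.x (Fin.castAdd m k) ^ 2)⁻¹, by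
    simp only [← inv_pow]
    exact R.pow_mem (hxi _) 2⟩
  let s' : Fin m → R := fun j => ⟨fun p => p.x (Fin.natAdd 3 j) ^ 2, R.pow_mem (hx _) 2⟩
  -- the cancellation takes place in the quotient of `R` by the sixth power of `e`
  let π := Ideal.Quotient.mk (Ideal.span {e' ^ 6})
  have key : π (regPoly h' e' χ' θ' ip' im' a' b' s') = 1 := by
    rw [map_regPoly]
    have hval : ∀ {u v : R}, (∀ p, u.1 p = v.1 p) → π u = π v := fun h =>
      congrArg π (Subtype.ext (funext h))
    refine regPoly_eq_one ?_ ?_ ?_ ?_ ?_ ?_ ?_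
    · rw [← map_pow]
      exact Ideal.Quotient.eq_zero_iff_mem.2 (Ideal.mem_span_singleton_self _)
    · have : (2 : R ⧸ Ideal.span {e' ^ 6}) = π 2 := rfl
      rw [this, ← map_mul, ← map_one π]
      exact hval fun p => by
        change (2 : ℂ) * (1 / 2) = 1
        norm_num
    · rw [← map_pow, ← map_one π]
      exact hval fun p => by
        change (p.ζ ^ 2) ^ 2 = 1
        rw [← pow_mul]
        exact p.ζ_pow
    · simp only [← map_pow, ← map_mul]
      exact hval fun p => by
        change ((p.ζ * (p.x (Fin.castAdd m 0) * p.x (Fin.castAdd m 1) *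
          p.x (Fin.castAdd m 2)))⁻¹) ^ 2 * (p.x (Fin.castAdd m 0) ^ 2 *
          p.x (Fin.castAdd m 1) ^ 2 * p.x (Fin.castAdd m 2) ^ 2) = p.ζ ^ 2
        have h0 := p.x_ne (Fin.castAdd m 0)
        have h1 := p.x_ne (Fin.castAdd m 1)
        have h2 := p.x_ne (Fin.castAdd m 2)
        have h3 := p.ζ_ne
        field_simp
        exact p.ζ_pow.symm
    · intro k
      rw [← map_mul, ← map_one π]
      exact hval fun p => by
        change p.x (Fin.castAdd m k) ^ 2 * (p.x (Fin.castAdd m k) ^ 2)⁻¹ = 1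
        exact mul_inv_cancel₀ (pow_ne_zero _ (p.x_ne _))
    · simp only [← map_pow, ← map_mul, ← map_one π, ← map_sub, ← map_prod]
      exact hval fun p => by
        have : ((∏ k, (1 - e' ^ 2 * a' k)) * ∏ j, (1 - e' ^ 2 * s' j) : R).1 p =
            ∏ j, (1 - (p.e : ℂ) ^ 2 * p.x j ^ 2) := by
          rw [Fin.prod_univ_add]
          simp [e', a', s', Finset.prod_apply]
        change (∏ j, (1 - (p.e : ℂ) ^ 2 * p.x j ^ 2))⁻¹ *
          ((∏ k, (1 - e' ^ 2 * a' k)) * ∏ j, (1 - e' ^ 2 * s' j) : R).1 p = 1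
        rw [this]
        exact inv_mul_cancel₀ (Finset.prod_ne_zero_iff.2 fun j _ => p.one_sub_ne j)
    · simp only [← map_pow, ← map_mul, ← map_one π, ← map_add, ← map_prod]
      exact hval fun p => by
        have : ((∏ k, (1 + e' ^ 2 * a' k)) * ∏ j, (1 + e' ^ 2 * s' j) : R).1 p =
            ∏ j, (1 + (p.e : ℂ) ^ 2 * p.x j ^ 2) := by
          rw [Fin.prod_univ_add]
          simp [e', a', s', Finset.prod_apply]
        change (∏ j, (1 + (p.e : ℂ) ^ 2 * p.x j ^ 2))⁻¹ *
          ((∏ k, (1 + e' ^ 2 * a' k)) * ∏ j, (1 + e' ^ 2 * s' j) : R).1 p = 1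
        rw [this]
        exact inv_mul_cancel₀ (Finset.prod_ne_zero_iff.2 fun j _ => p.one_add_ne j)
  rw [← map_one π, Ideal.Quotient.mk_eq_mk_iff_sub_mem, Ideal.mem_span_singleton] at key
  obtain ⟨g, hg⟩ := key
  obtain ⟨C, k, hC, hgC⟩ := g.2
  refine ⟨C, k, hC, fun p => ?_⟩
  have hev : ((regPoly h' e' χ' θ' ip' im' a' b' s' : R) : LocalParam m → ℂ) p =
      regFactor p.e p.ζ p.x := by
    have := map_regPoly ((Pi.evalRingHom (fun _ : LocalParam m => ℂ) p).comp R.subtype)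
      h' e' χ' θ' ip' im' a' b' s'
    exact this
  have hgp := congrArg (fun u : R => (u : LocalParam m → ℂ) p) hg
  have h1 : regFactor p.e p.ζ p.x - 1 = (p.e : ℂ) ^ 6 * (g : LocalParam m → ℂ) p := by
    rw [← hev]
    exact hgp
  rw [h1, norm_mul, norm_pow, Complex.norm_real, Real.norm_of_nonneg p.e_pos.le]
  calc p.e ^ 6 * ‖(g : LocalParam m → ℂ) p‖ ≤ p.e ^ 6 * (C * p.B ^ k) :=
        mul_le_mul_of_nonneg_left (hgC p) (pow_nonneg p.e_pos.le _)
    _ = C * p.e ^ 6 * p.B ^ k := by ring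

/-! ### The local factor in terms of the cleared polynomial -/

section Reflect

variable (q : ℝ) (z₀ z₁ z₂ z₃ : ℂ)

lemma reflect_zero : reflect q (0 : Fin 4) ![z₀, z₁, z₂, z₃] =
    ![1 / (q * z₀), z₁, z₂, rp q (1 / 2) * z₀ * z₃] := by
  ext j
  fin_cases j <;> simp [reflect, Fin.ext_iff]

lemma reflect_one : reflect q (1 : Fin 4) ![z₀, z₁, z₂, z₃] =
    ![z₀, 1 / (q * z₁), z₂, rp q (1 / 2) * z₁ * z₃] := by
  ext j
  fin_cases j <;> simp [reflect, Fin.ext_iff]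

lemma reflect_two : reflect q (2 : Fin 4) ![z₀, z₁, z₂, z₃] =
    ![z₀, z₁, 1 / (q * z₂), rp q (1 / 2) * z₂ * z₃] := by
  ext j
  fin_cases j <;> simp [reflect, Fin.ext_iff]

lemma reflect_three : reflect q (3 : Fin 4) ![z₀, z₁, z₂, z₃] =
    ![rp q (1 / 2) * z₃ * z₀, rp q (1 / 2) * z₃ * z₁, rp q (1 / 2) * z₃ * z₂, 1 / (q * z₃)] := by
  ext j
  fin_cases j <;> simp [reflect, Fin.ext_iff]

end Reflect

lemma rp_half_mul_self {q : ℝ} (hq : 0 < q) : rp q (1 / 2) * rp q (1 / 2) = q := by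
  unfold rp
  rw [← Complex.ofReal_mul, ← Real.rpow_add hq]
  norm_num

lemma rp_ne_zero {q : ℝ} (hq : 0 < q) (s : ℝ) : rp q s ≠ 0 :=
  Complex.ofReal_ne_zero.2 (Real.rpow_pos_of_pos hq s).ne'

/-- The powers `q ^ (k / 4)` in terms of `e = q ^ (-1/4)`. -/
lemma rp_eq_zpow {q : ℝ} (hq : 0 < q) (k : ℤ) {s : ℝ} (hs : s = -k / 4) :
    rp q s = (rp q (-1 / 4)) ^ k := by
  unfold rp
  rw [← Complex.ofReal_zpow, ← Real.rpow_mul_intCast hq.le]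
  congr 2
  rw [hs]
  ring

lemma ofReal_eq_inv_pow_rp {q : ℝ} (hq : 0 < q) : (q : ℂ) = (rp q (-1 / 4) ^ 4)⁻¹ := by
  have := rp_eq_zpow hq (-4) (s := 1) (by norm_num)
  rw [← zpow_natCast, ← _root_.zpow_neg]
  simpa [rp] using this

lemma rp_half {q : ℝ} (hq : 0 < q) : rp q (1 / 2) = (rp q (-1 / 4) ^ 2)⁻¹ := by
  rw [rp_eq_zpow hq (-2) (by norm_num), ← zpow_natCast, ← _root_.zpow_neg]
  rfl

lemma rp_neg_half {q : ℝ} (hq : 0 < q) : rp q (-1 / 2) = rp q (-1 / 4) ^ 2 := by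
  rw [rp_eq_zpow hq 2 (by norm_num)]
  norm_cast

lemma rp_three_quarters {q : ℝ} (hq : 0 < q) : rp q (3 / 4) = (rp q (-1 / 4) ^ 3)⁻¹ := by
  rw [rp_eq_zpow hq (-3) (by norm_num), ← zpow_natCast, ← _root_.zpow_neg]
  rfl

lemma rp_quarter {q : ℝ} (hq : 0 < q) : rp q (1 / 4) = (rp q (-1 / 4))⁻¹ := by
  rw [rp_eq_zpow hq (-1) (by norm_num), _root_.zpow_neg_one]

/-- The cocycle at the inverse of `w_1 w_2 w_3 w_{r+1}`: the reflections in the first three variables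
commute and have diagonal matrices. -/
lemma cocycle_wAlphaInv {q : ℝ} (hq : 0 < q) {z₀ z₁ z₂ z₃ : ℂ} (h₀ : z₀ ≠ 0) (h₁ : z₁ ≠ 0)
    (h₂ : z₂ ≠ 0) (h₃ : z₃ ≠ 0) :
    cocycle q wAlphaInv (wordAct q wAlpha ![z₀, z₁, z₂, z₃]) =
      baseMatrix (1 / (q * (rp q (1 / 2) * z₃ * z₀))) q *
        baseMatrix (1 / (q * (rp q (1 / 2) * z₃ * z₁))) q *
        baseMatrix (1 / (q * (rp q (1 / 2) * z₃ * z₂))) q *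
        (matU * baseMatrix (1 / (q * z₃)) q * matU) := by
  have hs : rp q (1 / 2) ≠ 0 := rp_ne_zero hq _
  have hq' : (q : ℂ) ≠ 0 := Complex.ofReal_ne_zero.2 hq.ne'
  simp only [cocycle, wAlphaInv, wAlpha, wordAct, List.foldr, reflect_zero, reflect_one,
    reflect_two, reflect_three, simpleCocycle, one_mul]
  have hlast : Fin.last 3 = (3 : Fin 4) := rfl
  have e0 : ((0 : Fin 4) = 3) = False := by simp
  have e1 : ((1 : Fin 4) = 3) = False := by simp
  have e2 : ((2 : Fin 4) = 3) = False := by simp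
  simp only [hlast, e0, e1, e2, if_false, if_true]
  congr 4
  change rp q (1 / 2) * _ * _ = _
  have hss := rp_half_mul_self hq
  generalize rp q (1 / 2) = s at hs hss ⊢
  simp only [← hss]
  field_simp

/-- The matrix `M(u, q)` for `q = e ^ (-4)`. Everything is written in `1 / u` so that no power of `q`
remains in a denominator. -/
lemma baseMatrix_eq {q : ℝ} {e : ℂ} (he : e ≠ 0) (hq : (q : ℂ) = (e ^ 4)⁻¹)
    (hs : rp q (1 / 2) = (e ^ 2)⁻¹) {u : ℂ} (hu : u ≠ 0) :
    baseMatrix u q = Matrix.diagonal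
      ![(1 - e ^ 4 / u) / (1 - u), e ^ 2 / u, (1 + e ^ 4 / u) / (1 + u)] := by
  unfold baseMatrix
  rw [hq, hs]
  congr 1
  ext j
  fin_cases j
  · change -((1 - (e ^ 4)⁻¹ * u) / ((e ^ 4)⁻¹ * u * (1 - u))) = _
    rw [← div_div, ← neg_div]
    change _ = (1 - e ^ 4 / u) / (1 - u)
    congr 1
    field_simp
    ring
  · change 1 / ((e ^ 2)⁻¹ * u) = e ^ 2 / u
    field_simp
  · change (1 + (e ^ 4)⁻¹ * u) / ((e ^ 4)⁻¹ * u * (1 + u)) = _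
    rw [← div_div]
    change _ = (1 + e ^ 4 / u) / (1 + u)
    congr 1
    field_simp
    ring

/-- The row vector `(1/2, χ, 1/2) M`, when `M` is a product of diagonal matrices and of one
conjugate of a diagonal matrix by `U`. -/
lemma row_mul_diagonal (χ : ℂ) (d₀ d₁ d₂ δ : Fin 3 → ℂ) :
    (![1 / 2, χ, 1 / 2] ᵥ* (Matrix.diagonal d₀ * Matrix.diagonal d₁ * Matrix.diagonal d₂ *
      (matU * Matrix.diagonal δ * matU))) ᵥ*
      (!![0, 1, 1; 1, 0, 0; 0, -1, 1] : Matrix (Fin 3) (Fin 3) ℂ) =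
    let α := d₀ 0 * d₁ 0 * d₂ 0
    let κ := χ * (d₀ 1 * d₁ 1 * d₂ 1)
    let γ := d₀ 2 * d₁ 2 * d₂ 2
    ![(α + γ + 2 * κ) / 4 * δ 0 - (α + γ - 2 * κ) / 4 * δ 2, (α - γ) / 2 * δ 1,
      (α + γ + 2 * κ) / 4 * δ 0 + (α + γ - 2 * κ) / 4 * δ 2] := by
  have h : matU * Matrix.diagonal δ * matU *
      (!![0, 1, 1; 1, 0, 0; 0, -1, 1] : Matrix (Fin 3) (Fin 3) ℂ) =
      matU * Matrix.diagonal δ * !![1, 0, 1; 0, 1, 0; -1, 0, 1] := by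
    rw [mul_assoc]
    congr 1
    ext i j
    fin_cases i <;> fin_cases j <;> simp [matU, Matrix.mul_apply, Fin.sum_univ_three] <;> norm_num
  rw [Matrix.vecMul_vecMul, mul_assoc, h, Matrix.diagonal_mul_diagonal,
    Matrix.diagonal_mul_diagonal, ← mul_assoc, ← Matrix.vecMul_vecMul, ← mul_assoc,
    ← Matrix.vecMul_vecMul, ← Matrix.vecMul_vecMul]
  ext j
  fin_cases j <;>
    · simp [Matrix.vecMul, dotProduct, Fin.sum_univ_three, matU, Matrix.diagonal_apply,
        -mul_eq_mul_right_iff]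
      ring

/-- The row vector `(L^{(1)}, L^{(2)}, L^{(3)})` in terms of `e = q ^ (-1/4)`, of `θ = 1 / (ζ X)`
and of the arguments `y_k = ζ X / (q ^ (1/4) ξ_k ^ 2)` and `Y = ζ X / q ^ (1/4)` of `M`. -/
lemma localL_polePoint {q : ℝ} (hq : 0 < q) {e ζ θ : ℂ} (he : e = rp q (-1 / 4)) {x : Fin 3 → ℂ}
    (hζ : ζ ^ 4 = 1) (hx : ∀ k, x k ≠ 0) (hθ : θ = (ζ * (x 0 * x 1 * x 2))⁻¹) (y : Fin 3 → ℂ)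
    (hy : ∀ k, y k = e * (ζ * (x 0 * x 1 * x 2)) / x k ^ 2) (Y : ℂ)
    (hY : Y = e * (ζ * (x 0 * x 1 * x 2))) :
    localL q (ζ ^ 2) (polePoint q ζ x) =
      let α := ∏ k, (1 - e ^ 3 * θ * x k ^ 2) / (1 - y k)
      let κ := e ^ 3 * θ
      let γ := ∏ k, (1 + e ^ 3 * θ * x k ^ 2) / (1 + y k)
      ![(α + γ + 2 * κ) / 4 * ((1 - κ) / (1 - Y)) - (α + γ - 2 * κ) / 4 * ((1 + κ) / (1 + Y)),
        (α - γ) / 2 * (e * θ),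
        (α + γ + 2 * κ) / 4 * ((1 - κ) / (1 - Y)) + (α + γ - 2 * κ) / 4 * ((1 + κ) / (1 + Y))] := by
  have he0 : e ≠ 0 := he ▸ rp_ne_zero hq _
  have hζ0 : ζ ≠ 0 := ne_zero_of_pow_four hζ
  have h0 := hx 0
  have h1 := hx 1
  have h2 := hx 2
  have hq1 : (q : ℂ) = (e ^ 4)⁻¹ := he ▸ ofReal_eq_inv_pow_rp hq
  have hs : rp q (1 / 2) = (e ^ 2)⁻¹ := he ▸ rp_half hq
  have hs' : rp q (-1 / 2) = e ^ 2 := he ▸ rp_neg_half hq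
  have hs3 : rp q (3 / 4) = (e ^ 3)⁻¹ := he ▸ rp_three_quarters hq
  have hX : ζ * (x 0 * x 1 * x 2) ≠ 0 := by
    simp [hζ0, h0, h1, h2]
  have hy0 : ∀ k, y k ≠ 0 := fun k => by
    rw [hy]
    exact div_ne_zero (mul_ne_zero he0 hX) (pow_ne_zero _ (hx k))
  have hY0 : Y ≠ 0 := by
    rw [hY]
    exact mul_ne_zero he0 hX
  unfold localL polePoint
  rw [cocycle_wAlphaInv hq (by rw [hs']; simp [he0, h0]) (by rw [hs']; simp [he0, h1])
    (by rw [hs']; simp [he0, h2]) (by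
      rw [hs3, mul_assoc]
      exact one_div_ne_zero (mul_ne_zero (inv_ne_zero (pow_ne_zero _ he0)) hX))]
  have harg : ∀ k, 1 / (q * (rp q (1 / 2) * (1 / (rp q (3 / 4) * ζ * (x 0 * x 1 * x 2))) *
      (rp q (-1 / 2) * x k ^ 2))) = y k := by
    intro k
    have := hx k
    rw [hq1, hs, hs', hs3, hy]
    field_simp
  have harg' : 1 / (q * (1 / (rp q (3 / 4) * ζ * (x 0 * x 1 * x 2)))) = Y := by
    rw [hq1, hs3, hY]
    field_simp
  rw [harg 0, harg 1, harg 2, harg', baseMatrix_eq he0 hq1 hs (hy0 0),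
    baseMatrix_eq he0 hq1 hs (hy0 1), baseMatrix_eq he0 hq1 hs (hy0 2),
    baseMatrix_eq he0 hq1 hs hY0, row_mul_diagonal]
  have h4 : ∀ k, e ^ 4 / y k = e ^ 3 * θ * x k ^ 2 := by
    intro k
    have := hx k
    rw [hy, hθ]
    field_simp
  have h2' : ∀ k, e ^ 2 / y k = e * θ * x k ^ 2 := by
    intro k
    have := hx k
    rw [hy, hθ]
    field_simp
  have h4' : e ^ 4 / Y = e ^ 3 * θ := by
    rw [hY, hθ]
    field_simp
  have h2Y : e ^ 2 / Y = e * θ := by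
    rw [hY, hθ]
    field_simp
  have hκ : ζ ^ 2 * (e * θ * x 0 ^ 2 * (e * θ * x 1 ^ 2) * (e * θ * x 2 ^ 2)) = e ^ 3 * θ := by
    rw [hθ]
    field_simp
  simp only [h4, h2', h4', h2Y, Fin.prod_univ_three, Matrix.cons_val_zero, Matrix.cons_val_one,
    Matrix.cons_val, hκ]

/-- The bracket of the local factor, with its denominators cleared. -/
lemma regBracket_eq {e χ θ ip im a₀ a₁ a₂ y₀ y₁ y₂ Y : ℂ} (h₀ : y₀ = e * χ * θ * (a₁ * a₂))
    (h₁ : y₁ = e * χ * θ * (a₀ * a₂)) (h₂ : y₂ = e * χ * θ * (a₀ * a₁))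
    (hY : Y = e * χ * θ * (a₀ * a₁ * a₂)) (hy₀ : y₀ ^ 2 ≠ 1) (hy₁ : y₁ ^ 2 ≠ 1) (hy₂ : y₂ ^ 2 ≠ 1)
    (hY1 : Y ^ 2 ≠ 1) {κ α γ : ℂ} (hκ : κ = e ^ 3 * θ)
    (hα : α = (1 - κ * a₀) / (1 - y₀) * ((1 - κ * a₁) / (1 - y₁)) * ((1 - κ * a₂) / (1 - y₂)))
    (hγ : γ = (1 + κ * a₀) / (1 + y₀) * ((1 + κ * a₁) / (1 + y₁)) * ((1 + κ * a₂) / (1 + y₂)))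
    {A B C : ℂ} (hA : A = (α + γ + 2 * κ) / 4 * ((1 - κ) / (1 - Y)))
    (hB : B = (α - γ) / 2 * (e * θ)) (hC : C = (α + γ - 2 * κ) / 4 * ((1 + κ) / (1 + Y))) :
    (κ * (A - C) + (A + B + C) / 2 * ip + (A - B + C) / 2 * im) *
      ((1 - Y ^ 2) * ((1 - y₀ ^ 2) * (1 - y₁ ^ 2) * (1 - y₂ ^ 2))) =
      regBracket (1 / 2) e χ θ ip im a₀ a₁ a₂ := by
  have hsplit : ∀ {u : ℂ}, u ^ 2 ≠ 1 → 1 - u ≠ 0 ∧ 1 + u ≠ 0 := by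
    intro u hu
    constructor
    · intro h
      exact hu (by linear_combination -(1 + u) * h)
    · intro h
      exact hu (by linear_combination -(1 - u) * h)
  obtain ⟨p0, n0⟩ := hsplit hy₀
  obtain ⟨p1, n1⟩ := hsplit hy₁
  obtain ⟨p2, n2⟩ := hsplit hy₂
  obtain ⟨pY, nY⟩ := hsplit hY1
  set N := (1 - y₀ ^ 2) * (1 - y₁ ^ 2) * (1 - y₂ ^ 2) with hN
  have hαN : α * N = (1 - κ * a₀) * (1 - κ * a₁) * (1 - κ * a₂) *
      ((1 + y₀) * (1 + y₁) * (1 + y₂)) := by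
    rw [hα, hN]
    field_simp
    ring
  have hγN : γ * N = (1 + κ * a₀) * (1 + κ * a₁) * (1 + κ * a₂) *
      ((1 - y₀) * (1 - y₁) * (1 - y₂)) := by
    rw [hγ, hN]
    field_simp
    ring
  have hAN : A * ((1 - Y ^ 2) * N) = (α * N + γ * N + 2 * κ * N) / 4 * ((1 - κ) * (1 + Y)) := by
    rw [hA]
    field_simp
    ring
  have hCN : C * ((1 - Y ^ 2) * N) = (α * N + γ * N - 2 * κ * N) / 4 * ((1 + κ) * (1 - Y)) := by
    rw [hC]
    field_simp
    ring
  have hBN : B * ((1 - Y ^ 2) * N) = (α * N - γ * N) / 2 * (e * θ * (1 - Y ^ 2)) := by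
    rw [hB]
    ring
  unfold regBracket
  dsimp only
  have hd : (1 + y₀) * (1 + y₁) * (1 + y₂) * ((1 - y₀) * (1 - y₁) * (1 - y₂)) = N := by
    rw [hN]
    ring
  rw [← h₀, ← h₁, ← h₂, ← hY, ← hκ, hd, ← hαN, ← hγN]
  linear_combination (κ + ip / 2 + im / 2) * hAN + (-κ + ip / 2 + im / 2) * hCN +
    (ip / 2 - im / 2) * hBN

lemma prod_tailIdx_pairs {m : ℕ} (f : Fin (3 + m) → Fin (3 + m) → ℂ) :
    ∏ k ∈ tailIdx (3 + m), ∏ l ∈ (tailIdx (3 + m)).filter (fun l => k ≤ l), f k l =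
      ∏ k : Fin m, ∏ l ∈ Ici k, f (Fin.natAdd 3 k) (Fin.natAdd 3 l) := by
  rw [tailIdx_eq_map, prod_map]
  refine Finset.prod_congr rfl fun k _ => ?_
  rw [filter_map, prod_map]
  refine Finset.prod_congr ?_ fun l _ => rfl
  ext j
  simp

lemma prod_pairs_three (f : Fin 3 → Fin 3 → ℂ) :
    ∏ i, ∏ j ∈ Ici i, f i j = f 0 0 * f 0 1 * f 0 2 * (f 1 1 * f 1 2) * f 2 2 := by
  have i0 : (Ici 0 : Finset (Fin 3)) = {0, 1, 2} := rfl
  have i1 : (Ici 1 : Finset (Fin 3)) = {1, 2} := rfl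
  have i2 : (Ici 2 : Finset (Fin 3)) = {2} := rfl
  rw [Fin.prod_univ_three, i0, i1, i2]
  simp [← mul_assoc]

/-- The regularized local factor, wherever the cocycle has no pole. -/
theorem localReg_eq_regFactor {m : ℕ} (hr : 4 ≤ 3 + m) {q : ℝ} (hq : 0 < q) {ζ : ℂ}
    (hζ : ζ ^ 4 = 1) {ξ : Fin (3 + m) → ℂ} (hξ : ∀ i, ξ i ≠ 0)
    (hy : ∀ k : Fin 3, (rp q (-1 / 4) * (ζ * (ξ (Fin.castAdd m 0) * ξ (Fin.castAdd m 1) *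
      ξ (Fin.castAdd m 2))) / ξ (Fin.castAdd m k) ^ 2) ^ 2 ≠ 1)
    (hY : (rp q (-1 / 4) * (ζ * (ξ (Fin.castAdd m 0) * ξ (Fin.castAdd m 1) *
      ξ (Fin.castAdd m 2)))) ^ 2 ≠ 1) :
    localReg hr q ζ (ζ ^ 2) ξ = regFactor (rp q (-1 / 4)) ζ ξ := by
  set x : Fin 3 → ℂ := fun k => ξ (Fin.castAdd m k) with hx
  have hhead : head hr ξ = x := rfl
  have hx0 : ∀ k, x k ≠ 0 := fun k => hξ _
  set e := rp q (-1 / 4) with he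
  have he0 : e ≠ 0 := rp_ne_zero hq _
  have hζ0 : ζ ≠ 0 := ne_zero_of_pow_four hζ
  have h0 := hx0 0
  have h1 := hx0 1
  have h2 := hx0 2
  have hq1 : (q : ℂ) = (e ^ 4)⁻¹ := he ▸ ofReal_eq_inv_pow_rp hq
  have hs' : rp q (-1 / 2) = e ^ 2 := he ▸ rp_neg_half hq
  have hs3 : rp q (3 / 4) = (e ^ 3)⁻¹ := he ▸ rp_three_quarters hq
  have hs1 : rp q (1 / 4) = e⁻¹ := he ▸ rp_quarter hq
  obtain ⟨X, hX⟩ : ∃ X, X = x 0 * x 1 * x 2 := ⟨_, rfl⟩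
  have hX0 : X ≠ 0 := hX ▸ mul_ne_zero (mul_ne_zero h0 h1) h2
  obtain ⟨y, hydef⟩ : ∃ y : Fin 3 → ℂ, ∀ k, y k = e * (ζ * X) / x k ^ 2 := ⟨_, fun _ => rfl⟩
  obtain ⟨Y, hYdef⟩ : ∃ Y, Y = e * (ζ * X) := ⟨_, rfl⟩
  have hy' : ∀ k, y k ^ 2 ≠ 1 := fun k => by
    rw [hydef, hX]
    exact hy k
  have hY' : Y ^ 2 ≠ 1 := by
    rw [hYdef, hX]
    exact hY
  -- the arguments of `localR` are the `y_k`
  have hR : (localR q ![ζ * x 1 * x 2 / (rp q (1 / 4) * x 0), ζ * x 0 * x 2 / (rp q (1 / 4) * x 1),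
        ζ * x 0 * x 1 / (rp q (1 / 4) * x 2)])⁻¹ =
      (1 - e ^ 2 * ζ ^ 2 * x 0 ^ 2) * (1 - e ^ 2 * ζ ^ 2 * x 1 ^ 2) *
        (1 - e ^ 2 * ζ ^ 2 * x 2 ^ 2) * ((1 - Y ^ 2) *
        ((1 - y 0 ^ 2) * (1 - y 1 ^ 2) * (1 - y 2 ^ 2))) := by
    have e0 : ζ * x 1 * x 2 / (rp q (1 / 4) * x 0) = y 0 := by
      rw [hs1, hydef, hX]
      field_simp
    have e1 : ζ * x 0 * x 2 / (rp q (1 / 4) * x 1) = y 1 := by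
      rw [hs1, hydef, hX]
      field_simp
    have e2 : ζ * x 0 * x 1 / (rp q (1 / 4) * x 2) = y 2 := by
      rw [hs1, hydef, hX]
      field_simp
    have p01 : y 0 * y 1 = e ^ 2 * ζ ^ 2 * x 2 ^ 2 := by
      rw [hydef, hydef, hX]
      field_simp
    have p02 : y 0 * y 2 = e ^ 2 * ζ ^ 2 * x 1 ^ 2 := by
      rw [hydef, hydef, hX]
      field_simp
    have p12 : y 1 * y 2 = e ^ 2 * ζ ^ 2 * x 0 ^ 2 := by
      rw [hydef, hydef, hX]
      field_simp
    have pY : q * (y 0 * y 1 * y 2) ^ 2 = Y ^ 2 := by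
      have : y 0 * y 1 * y 2 = e ^ 3 * ζ ^ 3 * X := by
        rw [hydef, hydef, hydef, hX]
        field_simp
      rw [this, hq1, hYdef]
      field_simp
      linear_combination hζ
    rw [e0, e1, e2]
    unfold localR
    rw [p01] at pY
    rw [prod_pairs_three]
    simp only [Matrix.cons_val_zero, Matrix.cons_val_one, Matrix.cons_val, mul_inv, inv_inv, pY,
      p01, p02, p12]
    ring
  have hL := localL_polePoint hq he hζ hx0 (by rw [← hX]) y (fun k => by rw [← hX, hydef]) Y
    (by rw [← hX, hYdef]) (θ := (ζ * X)⁻¹)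
  simp only [Fin.prod_univ_three] at hL
  obtain ⟨κ, hκdef⟩ : ∃ κ, κ = e ^ 3 * (ζ * X)⁻¹ := ⟨_, rfl⟩
  rw [← hκdef] at hL
  obtain ⟨α, hα⟩ : ∃ α, α = (1 - κ * x 0 ^ 2) / (1 - y 0) * ((1 - κ * x 1 ^ 2) / (1 - y 1)) *
    ((1 - κ * x 2 ^ 2) / (1 - y 2)) := ⟨_, rfl⟩
  obtain ⟨γ, hγ⟩ : ∃ γ, γ = (1 + κ * x 0 ^ 2) / (1 + y 0) * ((1 + κ * x 1 ^ 2) / (1 + y 1)) *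
    ((1 + κ * x 2 ^ 2) / (1 + y 2)) := ⟨_, rfl⟩
  rw [← hα, ← hγ] at hL
  obtain ⟨A, hA⟩ : ∃ A, A = (α + γ + 2 * κ) / 4 * ((1 - κ) / (1 - Y)) := ⟨_, rfl⟩
  obtain ⟨B, hB⟩ : ∃ B, B = (α - γ) / 2 * (e * (ζ * X)⁻¹) := ⟨_, rfl⟩
  obtain ⟨D, hD⟩ : ∃ D, D = (α + γ - 2 * κ) / 4 * ((1 + κ) / (1 + Y)) := ⟨_, rfl⟩
  rw [← hA, ← hB, ← hD] at hL
  have hbr := regBracket_eq (e := e) (χ := ζ ^ 2) (θ := (ζ * X)⁻¹)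
    (ip := (∏ j, (1 - e ^ 2 * ξ j ^ 2))⁻¹) (im := (∏ j, (1 + e ^ 2 * ξ j ^ 2))⁻¹)
    (a₀ := x 0 ^ 2) (a₁ := x 1 ^ 2) (a₂ := x 2 ^ 2) (y₀ := y 0) (y₁ := y 1) (y₂ := y 2) (Y := Y)
    (by rw [hydef, hX]; field_simp) (by rw [hydef, hX]; field_simp)
    (by rw [hydef, hX]; field_simp) (by rw [hYdef, hX]; field_simp) (hy' 0) (hy' 1) (hy' 2) hY'
    hκdef hα hγ hA hB hD
  have hT := prod_tailIdx_pairs fun k l => 1 - ξ k ^ 2 * ξ l ^ 2 / q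
  have hqi : ∀ u : ℂ, u / q = e ^ 4 * u := by
    intro u
    rw [hq1, div_inv_eq_mul, mul_comm]
  have hκ : ∀ u : ℂ, u / ((e ^ 3)⁻¹ * ζ * (x 0 * x 1 * x 2)) = u * κ := by
    intro u
    rw [hκdef, hX]
    field_simp
  have hX' : ξ (Fin.castAdd m 0) * ξ (Fin.castAdd m 1) * ξ (Fin.castAdd m 2) = X := hX.symm
  have hregroup : ∀ G M₁ M₂ : ℂ, (1 - e ^ 4 * 1) * ((A - D) * κ + (B + (A + D)) / (2 * M₁) +
      (A + D - B) / (2 * M₂)) * (G * ((1 - Y ^ 2) *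
        ((1 - y 0 ^ 2) * (1 - y 1 ^ 2) * (1 - y 2 ^ 2)))) =
      (1 - e ^ 4) * G * ((κ * (A - D) + (A + B + D) / 2 * M₁⁻¹ + (A - B + D) / 2 * M₂⁻¹) *
        ((1 - Y ^ 2) * ((1 - y 0 ^ 2) * (1 - y 1 ^ 2) * (1 - y 2 ^ 2)))) := by
    intro G M₁ M₂
    rw [← div_div, ← div_div]
    simp only [div_eq_mul_inv]
    ring
  unfold localReg localS regFactor regPoly
  rw [hhead]
  dsimp only
  rw [hR, hL, hT, tailIdx_eq_map, hs3, hκ, hs', hX']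
  change _ = _ * regBracket (1 / 2) e (ζ ^ 2) (ζ * X)⁻¹ _ _ (x 0 ^ 2) (x 1 ^ 2) (x 2 ^ 2) * _ * _
  rw [← hbr]
  simp only [Finset.prod_map, hqi, Fin.natAddEmb_apply]
  congr 1
  congr 1
  exact hregroup _ _ _

/-! ### The local factor at the point `(1, …, 1)` -/

/-- The bracket when all variables are `1`. It depends on `e` and `χ` only through `t = χ e ^ 2`,
except for the difference `ip - im`, which changes sign with `χ`. -/
lemma regBracket_one {e χ θ ip im y t : ℂ} (hχ : χ ^ 2 = 1) (hy : y = e * χ * θ)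
    (ht : t = y ^ 2) (hκ : e ^ 3 * θ = t * y) :
    regBracket (1 / 2) e χ θ ip im 1 1 1 = (1 - t) ^ 4 * ((t + t ^ 2) * (t + 6 * t ^ 2 + t ^ 3) +
      ((1 + t) ^ 4 + 3 * t * (1 + t) ^ 2 + t ^ 2) * (ip + im) / 2 +
      χ * t * (3 * (1 + t) ^ 2 + t) * (ip - im) / 2) := by
  have hθ : e * θ = χ * y := by
    rw [hy]
    linear_combination -(e * θ) * hχ
  unfold regBracket
  simp only [mul_one]
  rw [hκ, ← hy, hθ, ht]
  ring

/-- At the point `(1, …, 1)` the regularized local factor is given by the function `P_r`. -/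
theorem regFactor_one {m : ℕ} {e ζ : ℂ} (he : ‖e‖ < 1) (hζ : ζ ^ 4 = 1) :
    regFactor e ζ (fun _ : Fin (3 + m) => 1) = polyP (3 + m) (ζ ^ 2 * e ^ 2) := by
  have hζ0 : ζ ≠ 0 := ne_zero_of_pow_four hζ
  have hχ : (ζ ^ 2) ^ 2 = 1 := by rw [← pow_mul]; exact hζ
  set t := ζ ^ 2 * e ^ 2 with ht
  have hnt : ‖t‖ < 1 := by
    have h1 := norm_eq_one_of_pow_four hζ
    rw [ht, norm_mul, norm_pow, norm_pow, h1, one_pow, one_mul]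
    exact pow_lt_one₀ (norm_nonneg _) he two_ne_zero
  have hp : 1 + t ≠ 0 := by
    intro h
    rw [eq_neg_of_add_eq_zero_right h, norm_neg, norm_one] at hnt
    exact lt_irrefl _ hnt
  have he4 : e ^ 4 = t ^ 2 := by
    rw [ht]
    linear_combination -e ^ 4 * hχ
  have hbr := regBracket_one (e := e) (χ := ζ ^ 2) (θ := ζ⁻¹) (ip := ((1 - e ^ 2) ^ (3 + m))⁻¹)
    (im := ((1 + e ^ 2) ^ (3 + m))⁻¹) (y := e * ζ) (t := t) hχ (by field_simp)
    (by rw [ht]; ring) (by rw [ht]; field_simp; linear_combination -e ^ 3 * hζ)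
  have hpairs : ∏ k : Fin m, ∏ l ∈ Ici k, (1 - t ^ 2 : ℂ) = (1 - t ^ 2) ^ (m * (m + 1) / 2) := by
    rw [← prod_tailIdx_pairs fun _ _ => 1 - t ^ 2]
    simp only [Finset.prod_const]
    rw [Finset.prod_pow_eq_pow_sum, sum_card_tailIdx]
  have hquart : ((1 + t) ^ 4 + 3 * t * (1 + t) ^ 2 + t ^ 2) * (((1 - e ^ 2) ^ (3 + m))⁻¹ +
      ((1 + e ^ 2) ^ (3 + m))⁻¹) / 2 + ζ ^ 2 * t * (3 * (1 + t) ^ 2 + t) *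
      (((1 - e ^ 2) ^ (3 + m))⁻¹ - ((1 + e ^ 2) ^ (3 + m))⁻¹) / 2 =
      1 / 2 * (1 + t) ^ (4 - ((3 + m : ℕ) : ℤ)) + 1 / 2 * (1 - t) ^ (-((3 + m : ℕ) : ℤ)) *
        (1 + 10 * t + 20 * t ^ 2 + 10 * t ^ 3 + t ^ 4) := by
    have h4 : (1 + t) ^ (4 - ((3 + m : ℕ) : ℤ)) = (1 + t) ^ 4 * ((1 + t) ^ (3 + m))⁻¹ := by
      rw [zpow_sub₀ hp, zpow_natCast, div_eq_mul_inv]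
      norm_cast
    rw [h4, _root_.zpow_neg, zpow_natCast]
    rcases mul_eq_zero.1 (show (ζ ^ 2 - 1) * (ζ ^ 2 + 1) = 0 by linear_combination hχ) with h | h
    · have h1 : ζ ^ 2 = 1 := by linear_combination h
      have h2 : e ^ 2 = t := by rw [ht, h1, one_mul]
      rw [h1, h2]
      ring
    · have h1 : ζ ^ 2 = -1 := by linear_combination h
      have h2 : e ^ 2 = -t := by rw [ht, h1]; ring
      rw [h1, h2, sub_neg_eq_add, ← sub_eq_add_neg]
      ring
  have hm2 : m * (m + 1) / 2 * 2 = m * (m + 1) :=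
    Nat.div_mul_cancel (Nat.even_mul_succ_self m).two_dvd
  have e1 : ((3 + m) ^ 2 + 7 * (3 + m) - 14) / 2 = 8 + 6 * m + m * (m + 1) / 2 := by
    have : (3 + m) ^ 2 + 7 * (3 + m) = 30 + 13 * m + m * m := by ring
    rw [this]
    have : m * (m + 1) = m * m + m := by ring
    omega
  have e2 : ((3 + m) ^ 2 + 7 * (3 + m) - 28) / 2 = 1 + 6 * m + m * (m + 1) / 2 := by
    have : (3 + m) ^ 2 + 7 * (3 + m) = 30 + 13 * m + m * m := by ring
    rw [this]
    have : m * (m + 1) = m * m + m := by ring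
    omega
  unfold regFactor regPoly
  simp only [one_pow, mul_one, inv_one, Finset.prod_const, card_univ, Fintype.card_fin] at hpairs ⊢
  rw [he4, hpairs, hbr, add_assoc ((t + t ^ 2) * _), hquart]
  unfold polyP
  rw [e1, e2, show e ^ 2 * ζ ^ 2 = t by rw [ht]; ring, add_assoc ((t + t ^ 2) * _)]
  generalize (t + t ^ 2) * (t + 6 * t ^ 2 + t ^ 3) + _ = G
  rw [show 1 - t ^ 2 = (1 - t) * (1 + t) by ring]
  simp only [mul_pow, pow_add, ← pow_mul]
  ring

/-! ### Primes and quadratic symbols of constants -/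

section Primes

variable {F : Type*} [Field F] [Fintype F]

lemma five_le_card (hq : Fintype.card F % 4 = 1) : 5 ≤ Fintype.card F := by
  have := Fintype.one_lt_card (α := F)
  omega

/-- Euler's criterion over the extension of degree `d`: the exponent `(q ^ d - 1) / 2` is
`(q - 1) / 2` times `1 + q + ⋯ + q ^ (d - 1)`, a sum of `d` odd numbers. -/
lemma pow_card_pow_half (hodd : Odd (Fintype.card F)) {ε : F} {a : F}
    (ha : a ^ (Fintype.card F / 2) = ε) (hε : ε = 1 ∨ ε = -1) (d : ℕ) :
    a ^ (Fintype.card F ^ d / 2) = ε ^ d := by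
  have h2 : 2 * (Fintype.card F / 2) + 1 = Fintype.card F := Nat.two_mul_div_two_add_one_of_odd hodd
  have h3 : 2 * (Fintype.card F ^ d / 2) + 1 = Fintype.card F ^ d :=
    Nat.two_mul_div_two_add_one_of_odd hodd.pow
  have h4 : Fintype.card F ^ d / 2 = Fintype.card F / 2 * ∑ i ∈ range d, Fintype.card F ^ i := by
    have h6 : ∀ n k : ℕ, (∑ i ∈ range n, (2 * k + 1) ^ i) * (2 * k) + 1 = (2 * k + 1) ^ n := by
      intro n k
      induction n with
      | zero => simp
      | succ n ih =>
        rw [sum_range_succ, pow_succ]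
        linarith
    have h7 := h6 d (Fintype.card F / 2)
    rw [h2] at h7
    nlinarith
  rw [h4, pow_mul, ha, ← Finset.prod_pow_eq_pow_sum]
  rcases hε with rfl | rfl
  · simp
  · rw [Finset.prod_congr rfl fun i _ => (hodd.pow (n := i)).neg_one_pow]
    simp

/-- The quadratic symbol of a constant is a power of its sign. -/
theorem chi_eq_sgn_pow (hq : Fintype.card F % 4 = 1) (a : Fˣ) (p : MonicPrime F) :
    chi a p = sgn a ^ p.1.natDegree := by
  classical
  obtain ⟨p, hm, hi⟩ := p
  have : Fact (Irreducible p) := ⟨hi⟩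
  have hodd : Odd (Fintype.card F) := Nat.odd_iff.2 (by omega)
  have hF : ringChar F ≠ 2 := fun h => by
    have := FiniteField.even_card_of_char_two h
    omega
  have : Module.Finite F (AdjoinRoot p) := hm.finite_adjoinRoot
  have : Finite (AdjoinRoot p) := Module.finite_of_finite F
  let _ : Fintype (AdjoinRoot p) := Fintype.ofFinite _
  have hcard : Fintype.card (AdjoinRoot p) = Fintype.card F ^ p.natDegree := by
    rw [Module.card_eq_pow_finrank (K := F), (AdjoinRoot.powerBasis hi.ne_zero).finrank,
      AdjoinRoot.powerBasis_dim]
  have hK : ringChar (AdjoinRoot p) ≠ 2 := fun h => by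
    have h1 := FiniteField.even_card_of_char_two h
    have h2 := Nat.odd_iff.1 (hodd.pow (n := p.natDegree))
    rw [hcard] at h1
    omega
  have hdvd : ¬ p ∣ C (a : F) := fun h =>
    hi.not_isUnit (isUnit_of_dvd_unit h (Polynomial.isUnit_C.2 a.isUnit))
  have hsq : (∃ g : F[X], p ∣ g ^ 2 - C (a : F)) ↔ IsSquare (AdjoinRoot.of p a) := by
    constructor
    · rintro ⟨g, hg⟩
      refine ⟨AdjoinRoot.mk p g, ?_⟩
      rw [← AdjoinRoot.mk_eq_zero, map_sub, sub_eq_zero, AdjoinRoot.mk_C] at hg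
      rw [← hg, map_pow, sq]
    · rintro ⟨b, hb⟩
      obtain ⟨g, rfl⟩ := AdjoinRoot.mk_surjective b
      refine ⟨g, ?_⟩
      rw [← AdjoinRoot.mk_eq_zero, map_sub, sub_eq_zero, AdjoinRoot.mk_C, map_pow, sq, hb]
  have ha0 : AdjoinRoot.of p (a : F) ≠ 0 := by
    rw [Ne, map_eq_zero]
    exact a.ne_zero
  have hpow : IsSquare (AdjoinRoot.of p (a : F)) ↔
      (a : F) ^ (Fintype.card F ^ p.natDegree / 2) = 1 := by
    rw [FiniteField.isSquare_iff hK ha0, hcard, ← map_pow, ← map_one (AdjoinRoot.of p)]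
    exact (AdjoinRoot.of p).injective.eq_iff
  have hmain := FiniteField.pow_dichotomy hF a.ne_zero
  rw [chi, quadSymbol, if_neg hdvd, sgn]
  simp only [hsq, hpow, FiniteField.isSquare_iff hF a.ne_zero]
  rw [pow_card_pow_half hodd rfl hmain]
  have hne : (-1 : F) ≠ 1 := fun h => hF (by
    by_contra h2
    exact Ring.neg_one_ne_one_of_char_ne_two h2 h)
  rcases hmain with h | h
  · simp [h]
  · rw [h, if_neg hne]
    rcases Nat.even_or_odd p.natDegree with hd | hd
    · simp [hd.neg_one_pow]
    · simp [hd.neg_one_pow, hne]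

/-- There are at most `q ^ d` monic primes of degree `d`. -/
lemma summable_pow_natDegree {c : ℝ} (hc : 0 ≤ c) (hcq : c * Fintype.card F < 1) :
    Summable fun p : MonicPrime F => c ^ p.1.natDegree := by
  have hs : Summable fun x : Σ n : ℕ, (Fin n → F) => c ^ x.1 := by
    rw [summable_sigma_of_nonneg fun x => pow_nonneg hc _]
    refine ⟨fun n => (hasSum_fintype _).summable, ?_⟩
    have h : ∀ n : ℕ, ∑' _ : Fin n → F, c ^ n = (c * Fintype.card F) ^ n := by
      intro n
      rw [tsum_fintype, Finset.sum_const, card_univ, Fintype.card_fun, Fintype.card_fin,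
        nsmul_eq_mul, mul_pow, mul_comm]
      push_cast
      rfl
    simp only [h]
    exact summable_geometric_of_lt_one (by positivity) hcq
  refine hs.comp_injective (i := fun p : MonicPrime F =>
    (⟨p.1.natDegree, fun i => p.1.coeff i⟩ : Σ n : ℕ, (Fin n → F))) ?_
  rintro ⟨p, hp, hi⟩ ⟨p', hp', hi'⟩ h
  -- a monic polynomial is determined by its degree and its lower coefficients
  simp only [Sigma.mk.injEq] at h
  obtain ⟨hd, hcoe⟩ := h
  refine Subtype.ext (Polynomial.ext fun n => ?_)
  rcases lt_trichotomy n p.natDegree with hn | hn | hn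
  · have hfun : ∀ (d d' : ℕ) (u : Fin d → F) (u' : Fin d' → F), d = d' → u ≍ u' →
        ∀ (h1 : n < d) (h2 : n < d'), u ⟨n, h1⟩ = u' ⟨n, h2⟩ := by
      rintro d _ u u' rfl h h1 h2
      rw [eq_of_heq h]
    exact hfun _ _ _ _ hd hcoe hn (hd ▸ hn)
  · have h1 := hp.coeff_natDegree
    have h2 := hp'.coeff_natDegree
    rw [← hd] at h2
    rw [hn]
    exact h1.trans h2.symm
  · exact (coeff_eq_zero_of_natDegree_lt hn).trans
      (coeff_eq_zero_of_natDegree_lt (hd ▸ hn)).symm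

end Primes

/-! ### The Euler product -/

/-- Infinite products of separately holomorphic functions, with a uniform majorant. -/
lemma SepHol.tprod {n : ℕ} {c : Fin n → ℂ} {ρ : ℝ} {ι : Type*} {f : ι → (Fin n → ℂ) → ℂ}
    {u : ι → ℝ} (hf : ∀ i, SepHol c ρ (f i)) (hu : Summable u)
    (hfu : ∀ i, ∀ z ∈ Metric.ball c ρ, ‖f i z - 1‖ ≤ u i) :
    SepHol c ρ fun z => ∏' i, f i z := by
  have heq : ∀ i (z : Fin n → ℂ), f i z = 1 + (f i z - 1) := fun i z => by ring
  constructor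
  · have h := Summable.hasProdLocallyUniformlyOn_one_add (f := fun i z => f i z - 1) Metric.isOpen_ball hu
      (Filter.Eventually.of_forall hfu) fun i => (hf i).cont.sub continuousOn_const
    simp only [← heq] at h
    refine TendstoLocallyUniformlyOn.continuousOn h ?_
    exact Filter.Frequently.of_forall fun s => continuousOn_finsetProd _ fun i _ => (hf i).cont
  · intro z hz j
    have hmem : ∀ w ∈ Metric.ball (c j) ρ, Function.update z j w ∈ Metric.ball c ρ :=
      fun w hw => update_mem_ball hz j hw
    have h := Summable.hasProdLocallyUniformlyOn_one_add
      (f := fun i w => f i (Function.update z j w) - 1) (K := Metric.ball (c j) ρ)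
      Metric.isOpen_ball hu (Filter.Eventually.of_forall fun i w hw => hfu i _ (hmem w hw))
      fun i => ((hf i).diff z hz j).continuousOn.sub continuousOn_const
    simp only [← heq] at h
    refine TendstoLocallyUniformlyOn.differentiableOn h ?_ Metric.isOpen_ball
    refine Filter.Eventually.of_forall fun s => ?_
    exact DifferentiableOn.fun_finsetProd fun i _ => (hf i).diff z hz j

/-- The functions which are differentiable at a point. -/
def differentiableSubring {E : Type*} [NormedAddCommGroup E] [NormedSpace ℂ E] (z : E) :
    Subring (E → ℂ) where
  carrier := {f | DifferentiableAt ℂ f z}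
  mul_mem' hf hg := DifferentiableAt.mul hf hg
  one_mem' := differentiableAt_const _
  add_mem' hf hg := DifferentiableAt.add hf hg
  zero_mem' := differentiableAt_const _
  neg_mem' hf := DifferentiableAt.neg hf

lemma coe_regPoly_apply {E : Type*} {D : Subring (E → ℂ)} {m : ℕ} (h e χ θ ip im : D)
    (a b : Fin 3 → D) (s : Fin m → D) (w : E) :
    ((regPoly h e χ θ ip im a b s : D) : E → ℂ) w = regPoly ((h : E → ℂ) w) ((e : E → ℂ) w)
      ((χ : E → ℂ) w) ((θ : E → ℂ) w) ((ip : E → ℂ) w) ((im : E → ℂ) w)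
      (fun k => (a k : E → ℂ) w) (fun k => (b k : E → ℂ) w) fun j => (s j : E → ℂ) w :=
  map_regPoly ((Pi.evalRingHom (fun _ : E => ℂ) w).comp D.subtype) h e χ θ ip im a b s

lemma regPoly_differentiableAt {E : Type*} [NormedAddCommGroup E] [NormedSpace ℂ E] {z : E} {m : ℕ}
    (h e χ : ℂ) {θ ip im : E → ℂ} {a b : Fin 3 → E → ℂ} {s : Fin m → E → ℂ}
    (hθ : DifferentiableAt ℂ θ z) (hip : DifferentiableAt ℂ ip z) (him : DifferentiableAt ℂ im z)
    (ha : ∀ k, DifferentiableAt ℂ (a k) z) (hb : ∀ k, DifferentiableAt ℂ (b k) z)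
    (hs : ∀ j, DifferentiableAt ℂ (s j) z) :
    DifferentiableAt ℂ (fun w => regPoly h e χ (θ w) (ip w) (im w) (fun k => a k w)
      (fun k => b k w) fun j => s j w) z := by
  -- a polynomial expression stays in the subring of differentiable functions
  have hc : ∀ c : ℂ, ∃ g : differentiableSubring z, (g : E → ℂ) = fun _ => c :=
    fun c => ⟨⟨_, differentiableAt_const c⟩, rfl⟩
  have hf : ∀ {f : E → ℂ}, DifferentiableAt ℂ f z → ∃ g : differentiableSubring z,
    (g : E → ℂ) = f := fun hf => ⟨⟨_, hf⟩, rfl⟩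
  obtain ⟨h', eh⟩ := hc h
  obtain ⟨e', ee⟩ := hc e
  obtain ⟨χ', eχ⟩ := hc χ
  obtain ⟨θ', eθ⟩ := hf hθ
  obtain ⟨ip', eip⟩ := hf hip
  obtain ⟨im', eim⟩ := hf him
  choose a' ea using fun k => hf (ha k)
  choose b' eb using fun k => hf (hb k)
  choose s' es using fun j => hf (hs j)
  have hG : (fun w => regPoly h e χ (θ w) (ip w) (im w) (fun k => a k w)
      (fun k => b k w) fun j => s j w) = ((regPoly h' e' χ' θ' ip' im' a' b' s' :
        differentiableSubring z) : E → ℂ) := by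
    ext w
    rw [coe_regPoly_apply]
    simp only [eh, ee, eχ, eθ, eip, eim, ea, eb, es]
  rw [hG]
  exact (regPoly h' e' χ' θ' ip' im' a' b' s').2

/-- The regularized local factor is holomorphic where its denominators do not vanish. -/
lemma regFactor_differentiableAt {m d : ℕ} {e ζ : ℂ} (hζ : ζ ≠ 0) {z : Fin (3 + m) → ℂ}
    (hz : ∀ i, z i ≠ 0) (h1 : ∀ i, 1 - e ^ 2 * (z i ^ d) ^ 2 ≠ 0)
    (h2 : ∀ i, 1 + e ^ 2 * (z i ^ d) ^ 2 ≠ 0) :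
    DifferentiableAt ℂ (fun w : Fin (3 + m) → ℂ => regFactor e ζ fun i => w i ^ d) z := by
  have h3 : ζ * (z (Fin.castAdd m 0) ^ d * z (Fin.castAdd m 1) ^ d *
      z (Fin.castAdd m 2) ^ d) ≠ 0 := by
    simp [hζ, hz]
  have h4 : ∏ j, (1 - e ^ 2 * (z j ^ d) ^ 2) ≠ 0 := Finset.prod_ne_zero_iff.2 fun j _ => h1 j
  have h5 : ∏ j, (1 + e ^ 2 * (z j ^ d) ^ 2) ≠ 0 := Finset.prod_ne_zero_iff.2 fun j _ => h2 j
  have h6 : ∀ k, (z (Fin.castAdd m k) ^ d) ^ 2 ≠ 0 := fun k => by simp [hz]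
  unfold regFactor
  exact regPoly_differentiableAt _ _ _ (DifferentiableAt.fun_inv (by fun_prop) h3)
    (DifferentiableAt.fun_inv (by fun_prop) h4) (DifferentiableAt.fun_inv (by fun_prop) h5)
    (fun k => by fun_prop) (fun k => DifferentiableAt.fun_inv (by fun_prop) (h6 k))
    fun j => by fun_prop

section Euler

variable {F : Type*} [Field F] [Fintype F]

lemma one_lt_qF : 1 < qF F := by
  unfold qF
  exact_mod_cast Fintype.one_lt_card

lemma pnorm_pos (p : MonicPrime F) : 0 < pnorm p := pow_pos (zero_lt_one.trans one_lt_qF) _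

lemma rp_pnorm (p : MonicPrime F) (s : ℝ) : rp (pnorm p) s = (((qF F) ^ s) ^ p.1.natDegree : ℝ) := by
  have hq : 0 ≤ qF F := (zero_lt_one.trans one_lt_qF).le
  unfold rp pnorm
  rw [← Real.rpow_natCast, ← Real.rpow_mul hq, mul_comm, Real.rpow_mul hq, Real.rpow_natCast]

omit [Fintype F] in
lemma natDegree_pos (p : MonicPrime F) : 0 < p.1.natDegree := p.2.2.natDegree_pos

/-- Near `(1, …, 1)` the regularized local factors have no poles, and they are as close to `1` as a
convergent Euler product requires. -/
theorem exists_euler_bound {m : ℕ} (hr : 4 ≤ 3 + m) (hq : Fintype.card F % 4 = 1) (a : Fˣ) {ζ : ℂ}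
    (hζ : ζ ^ 2 = sgn a) : ∃ δ : ℝ, 0 < δ ∧ ∃ u : MonicPrime F → ℝ, Summable u ∧
      (∀ p, SepHol (fun _ => 1) δ (Sreg hr a ζ p)) ∧
      (∀ p, ∀ z ∈ Metric.ball (fun _ => 1 : Fin (3 + m) → ℂ) δ, ‖Sreg hr a ζ p z - 1‖ ≤ u p) ∧
      ∀ p, Sreg hr a ζ p (fun _ => 1) = regFactor (rp (pnorm p) (-1 / 4)) (ζ ^ p.1.natDegree)
        (fun _ : Fin (3 + m) => 1) := by
  obtain ⟨C, k, hC, hbound⟩ := exists_norm_regFactor_sub_one_le m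
  have hq5 : (5 : ℝ) ≤ qF F := by
    unfold qF
    exact_mod_cast five_le_card hq
  set c := qF F ^ (-1 / 4 : ℝ) with hc
  have hc0 : 0 < c := Real.rpow_pos_of_pos (by linarith) _
  have hc4 : c ^ 4 * qF F = 1 := by
    rw [hc, ← Real.rpow_natCast, ← Real.rpow_mul (by linarith)]
    norm_num
    rw [Real.rpow_neg_one, inv_mul_cancel₀ (by linarith)]
  have hc2 : c ^ 2 < 1 / 2 := by
    by_contra h
    push Not at h
    have : (1 / 2 : ℝ) ^ 2 ≤ (c ^ 2) ^ 2 := pow_le_pow_left₀ (by norm_num) h 2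
    nlinarith
  have hc1 : c < 1 := by nlinarith
  -- how far the variables may move away from `1`
  obtain ⟨b, hb1, hb2, hb5, hbk⟩ : ∃ b : ℝ, 1 < b ∧ c ^ 2 * b ^ 2 < 1 / 2 ∧ c * b ^ 5 < 1 ∧
      c ^ 2 * b ^ k < 1 := by
    have hev : ∀ (g : ℝ → ℝ) (K : ℝ), Continuous g → g 1 < K →
        ∀ᶠ b in nhdsWithin (1 : ℝ) (Set.Ioi 1), g b < K := fun g K hg h =>
      (hg.continuousAt.eventually_lt continuousAt_const h).filter_mono nhdsWithin_le_nhds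
    have h := ((hev (fun b => c ^ 2 * b ^ 2) (1 / 2) (by fun_prop) (by simpa using hc2)).and
      ((hev (fun b => c * b ^ 5) 1 (by fun_prop) (by simpa using hc1)).and
      (hev (fun b => c ^ 2 * b ^ k) 1 (by fun_prop) (by rw [one_pow]; linarith)))).and
      self_mem_nhdsWithin
    obtain ⟨b, ⟨h1, h2, h3⟩, h4⟩ := h.exists
    exact ⟨b, h4, h1, h2, h3⟩
  have hb0 : 0 < b := by linarith
  have hζ4 : ζ ^ 4 = 1 := by
    rw [show ζ ^ 4 = (ζ ^ 2) ^ 2 by ring, hζ, sgn]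
    split_ifs <;> norm_num
  have hδ : 0 < 1 - b⁻¹ := by
    have := inv_lt_one_of_one_lt₀ hb1
    linarith
  have hlow : ∀ z ∈ Metric.ball (fun _ => 1 : Fin (3 + m) → ℂ) (1 - b⁻¹), ∀ i,
      b⁻¹ ≤ ‖z i‖ ∧ ‖z i‖ ≤ b := by
    intro z hz i
    have h1 := apply_mem_ball hz i
    rw [Metric.mem_ball, dist_eq_norm] at h1
    have h2 := norm_sub_norm_le (1 : ℂ) (1 - z i)
    have h3 := norm_add_le (1 : ℂ) (z i - 1)
    rw [norm_one, norm_sub_rev, sub_sub_cancel] at h2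
    rw [norm_one, add_sub_cancel] at h3
    have h4 : 2 - b⁻¹ ≤ b := by
      have : 0 ≤ (b - 1) ^ 2 * b⁻¹ := by positivity
      have h5 : b * b⁻¹ = 1 := mul_inv_cancel₀ hb0.ne'
      nlinarith
    constructor <;> linarith
  -- the parameters of the local factor at `p`
  have hpar : ∀ (p : MonicPrime F), ∀ z ∈ Metric.ball (fun _ => 1 : Fin (3 + m) → ℂ) (1 - b⁻¹),
      ∃ P : LocalParam m, P.e = c ^ p.1.natDegree ∧ P.B = b ^ p.1.natDegree ∧
        P.ζ = ζ ^ p.1.natDegree ∧ P.x = fun i => z i ^ p.1.natDegree := by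
    intro p z hz
    have hd := natDegree_pos p
    have hz0 : ∀ i, z i ≠ 0 := fun i => by
      have := (hlow z hz i).1
      exact norm_pos_iff.1 ((inv_pos.2 hb0).trans_le this)
    refine ⟨⟨c ^ p.1.natDegree, b ^ p.1.natDegree, ζ ^ p.1.natDegree,
      fun i => z i ^ p.1.natDegree, by positivity, pow_le_one₀ hc0.le hc1.le,
      one_le_pow₀ hb1.le, ?_, fun i => pow_ne_zero _ (hz0 i), fun i => ?_, fun i => ?_, ?_⟩,
      rfl, rfl, rfl, rfl⟩
    · rw [← pow_mul, mul_comm, pow_mul, hζ4, one_pow]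
    · rw [norm_pow]
      exact pow_le_pow_left₀ (norm_nonneg _) (hlow z hz i).2 _
    · rw [norm_inv, norm_pow, ← inv_pow]
      refine pow_le_pow_left₀ (by positivity) ?_ _
      exact inv_le_of_inv_le₀ hb0 (hlow z hz i).1
    · calc (c ^ p.1.natDegree) ^ 2 * (b ^ p.1.natDegree) ^ 2
          = (c ^ 2 * b ^ 2) ^ p.1.natDegree := by ring
        _ ≤ c ^ 2 * b ^ 2 := pow_le_of_le_one (by positivity) (by linarith) hd.ne'
        _ ≤ 1 / 2 := hb2.le
  have he : ∀ p : MonicPrime F, rp (pnorm p) (-1 / 4) = ((c ^ p.1.natDegree : ℝ) : ℂ) :=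
    fun p => rp_pnorm p _
  have hS : ∀ (p : MonicPrime F), ∀ z ∈ Metric.ball (fun _ => 1 : Fin (3 + m) → ℂ) (1 - b⁻¹),
      Sreg hr a ζ p z = regFactor (rp (pnorm p) (-1 / 4)) (ζ ^ p.1.natDegree)
        (fun i => z i ^ p.1.natDegree) := by
    intro p z hz
    obtain ⟨P, h1, h2, h3, h4⟩ := hpar p z hz
    have hd := natDegree_pos p
    have hsmall : P.e * P.B ^ 5 < 1 := by
      rw [h1, h2]
      calc c ^ p.1.natDegree * (b ^ p.1.natDegree) ^ 5 = (c * b ^ 5) ^ p.1.natDegree := by ring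
        _ < 1 := pow_lt_one₀ (by positivity) hb5 hd.ne'
    have hone : ∀ u : ℂ, ‖u‖ ≤ P.e * P.B ^ 5 → u ^ 2 ≠ 1 := by
      intro u hu h
      have : ‖u‖ ^ 2 = 1 := by rw [← norm_pow, h, norm_one]
      have h0 := norm_nonneg u
      nlinarith
    have hX : ‖(P.e : ℂ) * (P.ζ * (P.x (Fin.castAdd m 0) * P.x (Fin.castAdd m 1) *
        P.x (Fin.castAdd m 2)))‖ ≤ P.e * P.B ^ 3 := by
      simp only [norm_mul, P.ζ_norm, one_mul, Complex.norm_real, Real.norm_of_nonneg P.e_pos.le]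
      have h0 := P.x_le (Fin.castAdd m 0)
      have h1 := P.x_le (Fin.castAdd m 1)
      have h2 := P.x_le (Fin.castAdd m 2)
      have hB : 0 ≤ P.B := zero_le_one.trans P.one_le
      refine mul_le_mul_of_nonneg_left ?_ P.e_pos.le
      calc _ ≤ P.B * P.B * P.B := by gcongr
        _ = P.B ^ 3 := by ring
    have heP : rp (pnorm p) (-1 / 4) = (P.e : ℂ) := by rw [he, h1]
    have hchi : chi a p = (ζ ^ p.1.natDegree) ^ 2 := by
      rw [chi_eq_sgn_pow hq, ← hζ, ← pow_mul, ← pow_mul, mul_comm]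
    unfold Sreg
    rw [hchi]
    have h4' : ∀ i, z i ^ p.1.natDegree = P.x i := fun i => by rw [h4]
    simp only [h4']
    rw [← h3]
    refine localReg_eq_regFactor hr (pnorm_pos p) P.ζ_pow P.x_ne (fun k => ?_) ?_
    · rw [heP]
      refine hone _ ?_
      rw [div_eq_mul_inv, norm_mul, ← inv_pow, norm_pow]
      have h5 := P.inv_le (Fin.castAdd m k)
      have hB : 0 ≤ P.B := zero_le_one.trans P.one_le
      have he0 := P.e_pos.le
      calc _ ≤ P.e * P.B ^ 3 * P.B ^ 2 := by gcongr
        _ = P.e * P.B ^ 5 := by ring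
    · rw [heP]
      refine hone _ (hX.trans ?_)
      exact mul_le_mul_of_nonneg_left (pow_le_pow_right₀ P.one_le (by norm_num)) P.e_pos.le
  refine ⟨1 - b⁻¹, hδ, fun p => C * (c ^ 6 * b ^ k) ^ p.1.natDegree, ?_, fun p => ?_, ?_, ?_⟩
  · refine (summable_pow_natDegree (by positivity) ?_).mul_left C
    calc c ^ 6 * b ^ k * Fintype.card F = c ^ 2 * b ^ k * (c ^ 4 * qF F) := by rw [qF]; ring
      _ < 1 := by rw [hc4, mul_one]; exact hbk
  · refine .of_differentiableOn fun z hz => ?_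
    obtain ⟨P, h1, h2, h3, h4⟩ := hpar p z hz
    have heP : rp (pnorm p) (-1 / 4) = (P.e : ℂ) := by rw [he, h1]
    have hz0 : ∀ i, z i ≠ 0 := fun i hi => P.x_ne i (by
      rw [h4]
      simp [hi, (natDegree_pos p).ne'])
    have h4' : ∀ i, z i ^ p.1.natDegree = P.x i := fun i => by rw [h4]
    have := regFactor_differentiableAt (d := p.1.natDegree) (e := rp (pnorm p) (-1 / 4))
      (ζ := ζ ^ p.1.natDegree) (h3 ▸ P.ζ_ne) hz0
      (fun i => by rw [heP, h4']; exact P.one_sub_ne i)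
      (fun i => by rw [heP, h4']; exact P.one_add_ne i)
    refine (this.congr_of_eventuallyEq ?_).differentiableWithinAt
    filter_upwards [Metric.isOpen_ball.mem_nhds hz] with w hw using hS p w hw
  · intro p z hz
    obtain ⟨P, h1, h2, h3, h4⟩ := hpar p z hz
    have h5 := hbound P
    rw [h1, h2, h3, h4] at h5
    rw [hS p z hz, he]
    refine h5.trans (le_of_eq ?_)
    ring
  · intro p
    rw [hS p _ (Metric.mem_ball_self hδ)]
    simp only [one_pow]

end Euler

/-! ### The values of the Euler product at the point `(1, …, 1)` -/

/-- The functions `P_r` have no real zeros near `0`. -/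
lemma polyP_ofReal_ne_zero (m : ℕ) (hr : 4 ≤ 3 + m) {t : ℝ} (ht : t ^ 2 ≤ 1 / 5) :
    polyP (3 + m) (t : ℂ) ≠ 0 := by
  have h1 : -1 / 2 < t := by nlinarith
  have h2 : t < 1 / 2 := by nlinarith
  have hp : 0 < 1 + t := by linarith
  have hn : 0 < 1 - t := by linarith
  have hpow : (1 + t) ^ (4 - ((3 + m : ℕ) : ℤ)) = ((1 + t) ^ (m - 1))⁻¹ := by
    rw [← zpow_natCast, ← _root_.zpow_neg]
    congr 1
    omega
  have hpow' : (1 - t) ^ (-((3 + m : ℕ) : ℤ)) = ((1 - t) ^ (3 + m))⁻¹ := by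
    rw [_root_.zpow_neg, zpow_natCast]
  have hpos : 0 < (t + t ^ 2) * (t + 6 * t ^ 2 + t ^ 3) + 1 / 2 * (1 + t) ^ (4 - ((3 + m : ℕ) : ℤ))
      + 1 / 2 * (1 - t) ^ (-((3 + m : ℕ) : ℤ)) *
        (1 + 10 * t + 20 * t ^ 2 + 10 * t ^ 3 + t ^ 4) := by
    rw [hpow, hpow']
    rcases le_or_gt 0 t with h | h
    · positivity
    · -- the three summands are at least `-1/5`, `1/2` and `-1/4`
      have e1 : -(1 / 5) ≤ (t + t ^ 2) * (t + 6 * t ^ 2 + t ^ 3) := by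
        have : -1 ≤ (1 + t) * (1 + 6 * t + t ^ 2) := by
          nlinarith [sq_nonneg (t + 1 / 2), mul_nonneg (sq_nonneg t) hp.le]
        nlinarith [mul_nonneg (sq_nonneg t)
          (show 0 ≤ (1 + t) * (1 + 6 * t + t ^ 2) + 1 by linarith)]
      have e2 : 1 ≤ ((1 + t) ^ (m - 1))⁻¹ :=
        (one_le_inv₀ (pow_pos hp _)).2 (pow_le_one₀ hp.le (by linarith))
      have e3 : -(1 / 2) ≤ 1 + 10 * t + 20 * t ^ 2 + 10 * t ^ 3 + t ^ 4 := by
        have : 0 ≤ (t + 1 / 3) ^ 2 * (40 / 3 + 10 * t) :=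
          mul_nonneg (sq_nonneg _) (by linarith)
        nlinarith [sq_nonneg (t ^ 2)]
      have e4 : ((1 - t) ^ (3 + m))⁻¹ ≤ 1 :=
        inv_le_one_of_one_le₀ (one_le_pow₀ (by linarith))
      have e5 : 0 < ((1 - t) ^ (3 + m))⁻¹ := inv_pos.2 (pow_pos hn _)
      nlinarith
  unfold polyP
  have hcast : ∀ (A B : ℕ) (G : ℝ), 0 < G →
      (1 - (t : ℂ)) ^ A * (1 + (t : ℂ)) ^ B * (G : ℂ) ≠ 0 := by
    intro A B G hG
    have : (1 - t) ^ A * (1 + t) ^ B * G ≠ 0 := by positivity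
    exact_mod_cast this
  have := hcast (((3 + m) ^ 2 + 7 * (3 + m) - 14) / 2) (((3 + m) ^ 2 + 7 * (3 + m) - 28) / 2) _ hpos
  push_cast at this ⊢
  exact this

section Euler

variable {F : Type*} [Field F] [Fintype F]

lemma sgn_sq (a : Fˣ) : sgn a ^ 2 = 1 := by
  unfold sgn
  split_ifs <;> norm_num

lemma pow_four_eq_one {a : Fˣ} {ζ : ℂ} (hζ : ζ ^ 2 = sgn a) : ζ ^ 4 = 1 := by
  rw [show ζ ^ 4 = (ζ ^ 2) ^ 2 by ring, hζ, sgn_sq]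

lemma qF_le_pnorm (p : MonicPrime F) : qF F ≤ pnorm p :=
  le_self_pow₀ one_lt_qF.le (natDegree_pos p).ne'

/-- The regularized local factors at the point `(1, …, 1)`. -/
theorem Sreg_one {m : ℕ} (hr : 4 ≤ 3 + m) (hq : Fintype.card F % 4 = 1) (a : Fˣ) {ζ : ℂ}
    (hζ : ζ ^ 2 = sgn a) (p : MonicPrime F) :
    Sreg hr a ζ p (fun _ => 1) = polyP (3 + m) (chi a p / rp (pnorm p) (1 / 2)) := by
  obtain ⟨_, _, _, _, _, _, h⟩ := exists_euler_bound hr hq a hζ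
  have hp := pnorm_pos p
  have hp1 : 1 < pnorm p := one_lt_qF.trans_le (qF_le_pnorm p)
  have he : ‖rp (pnorm p) (-1 / 4)‖ < 1 := by
    unfold rp
    rw [Complex.norm_real, Real.norm_of_nonneg (Real.rpow_nonneg hp.le _)]
    exact Real.rpow_lt_one_of_one_lt_of_neg hp1 (by norm_num)
  have hζ4 : (ζ ^ p.1.natDegree) ^ 4 = 1 := by
    rw [← pow_mul, mul_comm, pow_mul, pow_four_eq_one hζ, one_pow]
  rw [h, regFactor_one he hζ4, chi_eq_sgn_pow hq, ← hζ, rp_eq_zpow hp (-2) (s := 1 / 2)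
    (by norm_num), _root_.zpow_neg, div_inv_eq_mul, ← pow_mul, ← pow_mul, mul_comm 2]
  norm_cast

/-- The arguments of `P_r` in the Euler product. -/
lemma exists_real_arg (hq : Fintype.card F % 4 = 1) (a : Fˣ) (p : MonicPrime F) :
    ∃ t : ℝ, chi a p / rp (pnorm p) (1 / 2) = t ∧ t ^ 2 ≤ 1 / 5 := by
  have hp := pnorm_pos p
  have hp5 : (5 : ℝ) ≤ pnorm p := by
    refine le_trans ?_ (qF_le_pnorm p)
    unfold qF
    exact_mod_cast five_le_card hq
  obtain ⟨x, hx, hx2⟩ : ∃ x : ℝ, chi a p = x ∧ x ^ 2 = 1 := by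
    rw [chi_eq_sgn_pow hq]
    unfold sgn
    split_ifs
    · exact ⟨1, by simp⟩
    · refine ⟨(-1) ^ p.1.natDegree, by simp, ?_⟩
      rw [← pow_mul, mul_comm, pow_mul]
      norm_num
  refine ⟨x / pnorm p ^ (1 / 2 : ℝ), by rw [hx, rp]; push_cast; rfl, ?_⟩
  rw [div_pow, hx2, ← Real.rpow_natCast, ← Real.rpow_mul hp.le]
  norm_num
  rw [inv_le_comm₀ hp (by norm_num)]
  simpa using hp5

/-- An absolutely convergent product vanishes only if one of its factors does. -/
theorem tprod_Sreg_one_ne_zero {m : ℕ} (hr : 4 ≤ 3 + m) (hq : Fintype.card F % 4 = 1) (a : Fˣ)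
    {ζ : ℂ} (hζ : ζ ^ 2 = sgn a) : ∏' p : MonicPrime F, Sreg hr a ζ p (fun _ => 1) ≠ 0 := by
  obtain ⟨δ, hδ, u, hu, -, hb, -⟩ := exists_euler_bound hr hq a hζ
  have heq : ∀ p : MonicPrime F, Sreg hr a ζ p (fun _ => 1) =
      1 + (Sreg hr a ζ p (fun _ => 1) - 1) := fun p => by ring
  rw [tprod_congr heq]
  refine tprod_one_add_ne_zero_of_summable (fun p => ?_)
    (hu.of_nonneg_of_le (fun p => norm_nonneg _) fun p => hb p _ (Metric.mem_ball_self hδ))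
  rw [← heq, Sreg_one hr hq a hζ]
  obtain ⟨t, h1, h2⟩ := exists_real_arg hq a p
  rw [h1]
  exact polyP_ofReal_ne_zero m hr h2

end Euler

/-! ### The functions in front of the Euler product -/

section Gamma

lemma cocycle_wAlpha (q : ℝ) (z₀ z₁ z₂ z₃ : ℂ) :
    cocycle q wAlpha ![z₀, z₁, z₂, z₃] =
      matU * baseMatrix z₃ q * matU * baseMatrix (rp q (1 / 2) * z₃ * z₂) q *
        baseMatrix (rp q (1 / 2) * z₃ * z₁) q * baseMatrix (rp q (1 / 2) * z₃ * z₀) q := by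
  simp only [cocycle, wAlpha, wordAct, List.foldr, reflect_one,
    reflect_two, reflect_three, simpleCocycle, one_mul]
  have hlast : Fin.last 3 = (3 : Fin 4) := rfl
  have e0 : ((0 : Fin 4) = 3) = False := by simp
  have e1 : ((1 : Fin 4) = 3) = False := by simp
  have e2 : ((2 : Fin 4) = 3) = False := by simp
  simp only [hlast, e0, e1, e2, if_false, if_true]
  rfl

/-- The first two entries of the column `U D U d₂ d₁ d₀ (1, s, 1)`, for diagonal matrices. -/
def gammaEntry (s : ℂ) (δ d : Fin 3 → ℂ) (ν : Fin 2) : ℂ :=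
  ![δ 0 * (d 0 / 2 + s * d 1 + d 2 / 2) / 2 + δ 1 * (d 0 - d 2) / 2 +
      δ 2 * (d 0 / 2 - s * d 1 + d 2 / 2) / 2,
    δ 0 * (d 0 / 2 + s * d 1 + d 2 / 2) / 2 - δ 2 * (d 0 / 2 - s * d 1 + d 2 / 2) / 2] ν

/-- The diagonal of `M(u, 1 / q)`. -/
def barDiag (e u : ℂ) : Fin 3 → ℂ :=
  ![(1 - e⁻¹ ^ 4 / u) / (1 - u), e⁻¹ ^ 2 / u, (1 + e⁻¹ ^ 4 / u) / (1 + u)]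

lemma diagonal_mulVec_entries (s : ℂ) (δ d₀ d₁ d₂ : Fin 3 → ℂ) (ν : Fin 2) :
    ((matU * Matrix.diagonal δ * matU * Matrix.diagonal d₂ * Matrix.diagonal d₁ *
      Matrix.diagonal d₀) *ᵥ ![1, s, 1]) (Fin.castLE (by norm_num) ν) =
      gammaEntry s δ (fun k => d₂ k * d₁ k * d₀ k) ν := by
  rw [mul_assoc, mul_assoc, Matrix.diagonal_mul_diagonal, Matrix.diagonal_mul_diagonal,
    ← Matrix.mulVec_mulVec, ← Matrix.mulVec_mulVec, ← Matrix.mulVec_mulVec]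
  fin_cases ν <;>
    · simp [Matrix.mulVec, dotProduct, Fin.sum_univ_three, matU, Matrix.diagonal_apply, gammaEntry]
      ring

/-- The column `M̄_w (1, s, 1)` in terms of `e = q ^ (-1/4)` and `v = q ^ (1/4) / (ζ X)`. -/
lemma gammaCol_eq {q : ℝ} (hq : 0 < q) {e ζ v : ℂ} (s : ℂ) (he : e = rp q (-1 / 4)) {x : Fin 3 → ℂ}
    (hζ : ζ ≠ 0) (hx : ∀ k, x k ≠ 0) (hv : v = e⁻¹ * (ζ * (x 0 * x 1 * x 2))⁻¹) (ν : Fin 2) :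
    gammaCol q ζ s x (Fin.castLE (by norm_num) ν) = gammaEntry s (barDiag e v)
      (fun k => barDiag e (v * x 2 ^ 2) k * barDiag e (v * x 1 ^ 2) k *
        barDiag e (v * x 0 ^ 2) k) ν := by
  have he0 : e ≠ 0 := he ▸ rp_ne_zero hq _
  have h0 := hx 0
  have h1 := hx 1
  have h2 := hx 2
  have hq1 : (q : ℂ) = (e ^ 4)⁻¹ := he ▸ ofReal_eq_inv_pow_rp hq
  have hs' : rp q (-1 / 2) = e ^ 2 := he ▸ rp_neg_half hq
  have hs3 : rp q (3 / 4) = (e ^ 3)⁻¹ := he ▸ rp_three_quarters hq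
  have hb : rp (1 / q) (1 / 2) = e ^ 2 := by
    rw [← hs', rp, rp, one_div, Real.inv_rpow hq.le, ← Real.rpow_neg hq.le]
    norm_num
  have hb' : rp (1 / q) (1 / 2) = (e⁻¹ ^ 2)⁻¹ := by rw [hb, inv_pow, inv_inv]
  have hb1 : ((1 / q : ℝ) : ℂ) = (e⁻¹ ^ 4)⁻¹ := by
    rw [Complex.ofReal_div, hq1, inv_pow, Complex.ofReal_one, one_div]
  have hX : ζ * (x 0 * x 1 * x 2) ≠ 0 := by simp [hζ, h0, h1, h2]
  have hv0 : v ≠ 0 := by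
    rw [hv]
    exact mul_ne_zero (inv_ne_zero he0) (inv_ne_zero hX)
  unfold gammaCol cocycleBar polePoint
  have hfun : (fun i => (q : ℂ) * (![rp q (-1 / 2) * x 0 ^ 2, rp q (-1 / 2) * x 1 ^ 2,
      rp q (-1 / 2) * x 2 ^ 2, 1 / (rp q (3 / 4) * ζ * (x 0 * x 1 * x 2))] : Fin 4 → ℂ) i) =
      ![q * (rp q (-1 / 2) * x 0 ^ 2), q * (rp q (-1 / 2) * x 1 ^ 2),
        q * (rp q (-1 / 2) * x 2 ^ 2), q * (1 / (rp q (3 / 4) * ζ * (x 0 * x 1 * x 2)))] := by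
    ext i
    fin_cases i <;> rfl
  have hv3 : q * (1 / (rp q (3 / 4) * ζ * (x 0 * x 1 * x 2))) = v := by
    rw [hq1, hs3, hv]
    field_simp
  have hvk : ∀ k, rp (1 / q) (1 / 2) * v * (q * (rp q (-1 / 2) * x k ^ 2)) = v * x k ^ 2 := by
    intro k
    rw [hb, hs', hq1]
    field_simp
  have hu : ∀ k, v * x k ^ 2 ≠ 0 := fun k => mul_ne_zero hv0 (pow_ne_zero _ (hx k))
  have hei : e⁻¹ ≠ 0 := inv_ne_zero he0
  rw [hfun, hv3, cocycle_wAlpha, hvk, hvk, hvk, baseMatrix_eq hei hb1 hb' hv0,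
    baseMatrix_eq hei hb1 hb' (hu 0), baseMatrix_eq hei hb1 hb' (hu 1),
    baseMatrix_eq hei hb1 hb' (hu 2), diagonal_mulVec_entries]
  rfl

/-- The two entries at `(1, …, 1)`, for `w = χ q ^ (1/2)`. There `M(u, 1/q)` has polynomial entries,
as `q` is `u ^ 4` when `u = q ^ (1/4) / ζ`. -/
lemma gammaCol_one {q : ℝ} (hq : 1 < q) {ζ : ℂ} (hζ : ζ ^ 4 = 1) (ν : Fin 2) {w c : ℂ}
    (hw : w = ζ ^ 2 * rp q (1 / 2)) (hc : c = 1 + w) :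
    gammaCol q ζ (ζ ^ 2) (fun _ => 1) (Fin.castLE (by norm_num) ν) =
      ![c ^ 4 + 3 * c ^ 2 * w + w ^ 2 + ζ ^ 2 * w * (3 * c ^ 2 + w),
        rp q (1 / 4) * ζ⁻¹ * c * (c ^ 2 + 4 * w)] ν := by
  have hq0 : 0 < q := zero_lt_one.trans hq
  have hζ0 : ζ ≠ 0 := ne_zero_of_pow_four hζ
  set v := rp q (1 / 4) * ζ⁻¹ with hv
  have hei := (rp_quarter hq0).symm
  have hζ1 := norm_eq_one_of_pow_four hζ
  have hnv : 1 < ‖v‖ := by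
    rw [hv, norm_mul, norm_inv, hζ1, inv_one, mul_one, rp, Complex.norm_real,
      Real.norm_of_nonneg (Real.rpow_nonneg hq0.le _)]
    exact Real.one_lt_rpow hq (by norm_num)
  have hv0 : v ≠ 0 := norm_pos_iff.1 (by linarith)
  have hp : 1 - v ≠ 0 := by
    intro h
    rw [← sub_eq_zero.1 h, norm_one] at hnv
    exact lt_irrefl _ hnv
  have hn : 1 + v ≠ 0 := by
    intro h
    rw [eq_neg_of_add_eq_zero_right h, norm_neg, norm_one] at hnv
    exact lt_irrefl _ hnv
  have h2 : rp q (1 / 4) ^ 2 = rp q (1 / 2) := by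
    rw [← hei, inv_pow, rp_eq_zpow hq0 (-2) (s := 1 / 2) (by norm_num), _root_.zpow_neg]
    norm_cast
  have hζi : ζ⁻¹ ^ 2 = ζ ^ 2 := by
    field_simp
    exact hζ.symm
  have hvw : v ^ 2 = w := by rw [hv, mul_pow, h2, hζi, hw, mul_comm]
  have hsq : rp q (1 / 4) ^ 2 = ζ ^ 2 * v ^ 2 := by
    rw [hv, mul_pow, hζi]
    linear_combination -(rp q (1 / 4) ^ 2) * hζ
  have hd : barDiag (rp q (-1 / 4)) v = ![1 + v + v ^ 2, ζ ^ 2 * v, 1 - v + v ^ 2] := by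
    unfold barDiag
    have h4 : rp q (1 / 4) ^ 4 / v = v ^ 3 := by
      rw [div_eq_iff hv0, show rp q (1 / 4) ^ 4 = (rp q (1 / 4) ^ 2) ^ 2 by ring, hsq]
      linear_combination v ^ 4 * hζ
    rw [hei, h4, hsq]
    ext k
    fin_cases k
    · change (1 - v ^ 3) / (1 - v) = 1 + v + v ^ 2
      rw [div_eq_iff hp]
      ring
    · change ζ ^ 2 * v ^ 2 / v = ζ ^ 2 * v
      field_simp
    · change (1 + v ^ 3) / (1 + v) = 1 - v + v ^ 2
      rw [div_eq_iff hn]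
      ring
  rw [gammaCol_eq hq0 (ζ ^ 2) rfl hζ0 (fun _ => one_ne_zero) (v := v) (by rw [hei, hv]; simp)]
  simp only [one_pow, mul_one, hd]
  rw [hc, ← hvw]
  have hζ8 : ζ ^ 8 = 1 := by rw [show ζ ^ 8 = (ζ ^ 4) ^ 2 by ring, hζ, one_pow]
  fin_cases ν
  · simp [gammaEntry]
    linear_combination v ^ 4 * hζ8
  · simp [gammaEntry]
    linear_combination v ^ 3 * (1 + v ^ 2) * hζ8

lemma barDiag_analyticAt {E : Type*} [NormedAddCommGroup E] [NormedSpace ℂ E] {z : E} {u : E → ℂ}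
    (e : ℂ) (hu : AnalyticAt ℂ u z) (h0 : u z ≠ 0) (h1 : 1 - u z ≠ 0) (h2 : 1 + u z ≠ 0)
    (k : Fin 3) : AnalyticAt ℂ (fun w => barDiag e (u w) k) z := by
  fin_cases k
  · change AnalyticAt ℂ (fun w => (1 - e⁻¹ ^ 4 / u w) / (1 - u w)) z
    fun_prop (disch := assumption)
  · change AnalyticAt ℂ (fun w => e⁻¹ ^ 2 / u w) z
    fun_prop (disch := assumption)
  · change AnalyticAt ℂ (fun w => (1 + e⁻¹ ^ 4 / u w) / (1 + u w)) z
    fun_prop (disch := assumption)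

lemma one_sub_mul_rp_half_ne_zero {q : ℝ} (hq : 1 < q) {s : ℂ} (hs : ‖s‖ = 1) :
    1 - s * rp q (1 / 2) ≠ 0 := by
  intro h
  have h1 : ‖s * rp q (1 / 2)‖ = 1 := by rw [← sub_eq_zero.1 h, norm_one]
  rw [norm_mul, hs, one_mul, rp, Complex.norm_real,
    Real.norm_of_nonneg (Real.rpow_nonneg (zero_lt_one.trans hq).le _)] at h1
  exact (Real.one_lt_rpow hq (show (0 : ℝ) < 1 / 2 by norm_num)).ne' h1

lemma gammaCol_analyticAt {m : ℕ} (hr : 4 ≤ 3 + m) {q : ℝ} (hq : 1 < q) {ζ : ℂ} (hζ : ζ ^ 4 = 1)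
    (s : ℂ) (ν : Fin 2) : AnalyticAt ℂ (fun ξ : Fin (3 + m) → ℂ =>
      gammaCol q ζ s (head hr ξ) (Fin.castLE (by norm_num) ν)) fun _ => 1 := by
  have hq0 : 0 < q := zero_lt_one.trans hq
  have hζ1 := norm_eq_one_of_pow_four hζ
  have hζ0 : ζ ≠ 0 := ne_zero_of_pow_four hζ
  set e := rp q (-1 / 4) with he
  set v : (Fin (3 + m) → ℂ) → ℂ := fun ξ =>
    e⁻¹ * (ζ * (head hr ξ 0 * head hr ξ 1 * head hr ξ 2))⁻¹ with hv
  have hhead : ∀ k, AnalyticAt ℂ (fun ξ : Fin (3 + m) → ℂ => head hr ξ k) fun _ => 1 :=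
    fun k => analyticAt_apply _ _
  have hva : AnalyticAt ℂ v fun _ => 1 := by
    have h0 := hhead 0
    have h1 := hhead 1
    have h2 := hhead 2
    refine analyticAt_const.mul (AnalyticAt.inv (by fun_prop) ?_)
    simpa [head] using hζ0
  have hv1 : v (fun _ => 1) = e⁻¹ * ζ⁻¹ := by simp [hv, head]
  have hnv : 1 < ‖v fun _ => 1‖ := by
    rw [hv1, norm_mul, norm_inv ζ, hζ1, inv_one, mul_one, he, ← rp_quarter hq0, rp,
      Complex.norm_real, Real.norm_of_nonneg (Real.rpow_nonneg hq0.le _)]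
    exact Real.one_lt_rpow hq (by norm_num)
  have hv0 : v (fun _ => 1) ≠ 0 := norm_pos_iff.1 (by linarith)
  have hp : 1 - v (fun _ => 1) ≠ 0 := by
    intro h
    rw [← sub_eq_zero.1 h, norm_one] at hnv
    exact lt_irrefl _ hnv
  have hn : 1 + v (fun _ => 1) ≠ 0 := by
    intro h
    rw [eq_neg_of_add_eq_zero_right h, norm_neg, norm_one] at hnv
    exact lt_irrefl _ hnv
  have hδ := barDiag_analyticAt e hva hv0 hp hn
  have hd : ∀ i k, AnalyticAt ℂ (fun ξ => barDiag e (v ξ * head hr ξ i ^ 2) k) fun _ => 1 := by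
    intro i
    have h := hhead i
    refine barDiag_analyticAt e (by fun_prop) ?_ ?_ ?_
    · simpa [head] using hv0
    · simpa [head] using hp
    · simpa [head] using hn
  have hg : AnalyticAt ℂ (fun ξ => gammaEntry s (barDiag e (v ξ))
      (fun k => barDiag e (v ξ * head hr ξ 2 ^ 2) k * barDiag e (v ξ * head hr ξ 1 ^ 2) k *
        barDiag e (v ξ * head hr ξ 0 ^ 2) k) ν) fun _ => 1 := by
    have a0 := hδ 0
    have a1 := hδ 1
    have a2 := hδ 2
    have hD : ∀ k, AnalyticAt ℂ (fun ξ => barDiag e (v ξ * head hr ξ 2 ^ 2) k *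
        barDiag e (v ξ * head hr ξ 1 ^ 2) k * barDiag e (v ξ * head hr ξ 0 ^ 2) k) fun _ => 1 :=
      fun k => ((hd 2 k).fun_mul (hd 1 k)).fun_mul (hd 0 k)
    have b0 := hD 0
    have b1 := hD 1
    have b2 := hD 2
    unfold gammaEntry
    fin_cases ν
    · simp only [Fin.zero_eta, Matrix.cons_val_zero]
      fun_prop (disch := norm_num)
    · simp only [Fin.mk_one, Matrix.cons_val_one, Matrix.cons_val_fin_one]
      fun_prop (disch := norm_num)
  refine hg.congr ?_
  have hne : ∀ᶠ ξ : Fin (3 + m) → ℂ in nhds fun _ => 1, ∀ k, head hr ξ k ≠ 0 :=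
    Filter.eventually_all.2 fun k => (hhead k).continuousAt.eventually_ne one_ne_zero
  filter_upwards [hne] with ξ hξ
  exact (gammaCol_eq hq0 s he hζ0 hξ rfl ν).symm

lemma denomG_one (q : ℝ) (s : ℂ) : denomG q s (fun _ => 1) = (1 - s * rp q (1 / 2)) ^ 7 := by
  unfold denomG
  rw [prod_pairs_three]
  simp only [one_pow, mul_one, div_one]
  ring

lemma calG_eq {r : ℕ} (hr : 4 ≤ r) (q : ℝ) (ζ s : ℂ) (ν : Fin 2) (ξ : Fin r → ℂ) :
    calG hr q ζ s ν ξ = ![∏ j, (1 - rp q (1 / 2) * ξ j ^ 2), ∏ j, ξ j] ν / denomG q s (head hr ξ) *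
      gammaCol q ζ s (head hr ξ) (Fin.castLE (by norm_num) ν) := by
  unfold calG
  fin_cases ν <;> simp [dotProduct, Fin.sum_univ_three]

/-- The denominators of `𝒢` do not vanish at `(1, …, 1)`, as they are powers of `1 - s q ^ (1/2)`. -/
theorem calG_analyticAt {m : ℕ} (hr : 4 ≤ 3 + m) {q : ℝ} (hq : 1 < q) {ζ s : ℂ} (hζ : ζ ^ 4 = 1)
    (hs : ‖s‖ = 1) (ν : Fin 2) :
    AnalyticAt ℂ (calG (r := 3 + m) hr q ζ s ν) fun _ => 1 := by
  have hγ := gammaCol_analyticAt hr hq hζ s ν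
  have hhead : ∀ k, AnalyticAt ℂ (fun ξ : Fin (3 + m) → ℂ => head hr ξ k) fun _ => 1 :=
    fun k => analyticAt_apply _ _
  have hden : AnalyticAt ℂ (fun ξ : Fin (3 + m) → ℂ => denomG q s (head hr ξ)) fun _ => 1 := by
    unfold denomG
    have h0 := hhead 0
    have h1 := hhead 1
    have h2 := hhead 2
    refine AnalyticAt.fun_mul (by fun_prop) ?_
    refine Finset.analyticAt_fun_prod _ fun i _ => Finset.analyticAt_fun_prod _ fun j _ => ?_
    have hi := hhead i
    have hj := hhead j
    refine AnalyticAt.fun_sub analyticAt_const (AnalyticAt.fun_div (by fun_prop) (by fun_prop) ?_)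
    simp [head]
  have hden0 : denomG q s (head hr fun _ => 1) ≠ 0 := by
    have : head hr (fun _ => 1) = fun _ => (1 : ℂ) := rfl
    rw [this, denomG_one]
    exact pow_ne_zero _ (one_sub_mul_rp_half_ne_zero hq hs)
  have hnum : AnalyticAt ℂ (fun ξ : Fin (3 + m) → ℂ =>
      ![∏ j, (1 - rp q (1 / 2) * ξ j ^ 2), ∏ j, ξ j] ν) fun _ => 1 := by
    fin_cases ν
    · change AnalyticAt ℂ (fun ξ : Fin (3 + m) → ℂ => ∏ j, (1 - rp q (1 / 2) * ξ j ^ 2)) _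
      exact Finset.analyticAt_fun_prod _ fun j _ => by fun_prop
    · change AnalyticAt ℂ (fun ξ : Fin (3 + m) → ℂ => ∏ j, ξ j) _
      exact Finset.analyticAt_fun_prod _ fun j _ => by fun_prop
  have heq : calG (r := 3 + m) hr q ζ s ν = fun ξ => ![∏ j, (1 - rp q (1 / 2) * ξ j ^ 2),
      ∏ j, ξ j] ν / denomG q s (head hr ξ) *
      gammaCol q ζ s (head hr ξ) (Fin.castLE (by norm_num) ν) := funext fun ξ => calG_eq ..
  rw [heq]
  exact (hnum.fun_div hden hden0).fun_mul hγ

lemma calG_one {r : ℕ} (hr : 4 ≤ r) (q : ℝ) (ζ s : ℂ) (ν : Fin 2) :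
    calG hr q ζ s ν (fun _ => 1) = ![(1 - rp q (1 / 2)) ^ r, 1] ν / (1 - s * rp q (1 / 2)) ^ 7 *
      gammaCol q ζ s (fun _ => 1) (Fin.castLE (by norm_num) ν) := by
  have : head hr (fun _ => 1) = fun _ => (1 : ℂ) := rfl
  rw [calG_eq, this, denomG_one]
  fin_cases ν <;> simp

/-- The two entries of `M̄_w (1, s, 1)` at the point `(1, …, 1)`, and their sum, do not vanish. -/
theorem gammaCol_one_ne_zero {n : ℕ} (hn : 5 ≤ n) {ζ : ℂ} (hζ : ζ ^ 4 = 1) :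
    gammaCol n ζ (ζ ^ 2) (fun _ => 1) 0 ≠ 0 ∧ gammaCol n ζ (ζ ^ 2) (fun _ => 1) 1 ≠ 0 ∧
      gammaCol n ζ (ζ ^ 2) (fun _ => 1) 0 + gammaCol n ζ (ζ ^ 2) (fun _ => 1) 1 ≠ 0 := by
  have hq : (1 : ℝ) < n := by exact_mod_cast (by omega : 1 < n)
  have hq0 : (0 : ℝ) < n := by linarith
  have h0 := gammaCol_one hq hζ 0 rfl rfl
  have h1 := gammaCol_one hq hζ 1 rfl rfl
  change gammaCol n ζ (ζ ^ 2) (fun _ => 1) 0 = _ at h0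
  change gammaCol n ζ (ζ ^ 2) (fun _ => 1) 1 = _ at h1
  simp only [Matrix.cons_val_zero, Matrix.cons_val_one, Matrix.cons_val_fin_one] at h0 h1
  obtain ⟨V, hV⟩ : ∃ V : ℝ, V = (n : ℝ) ^ (1 / 4 : ℝ) := ⟨_, rfl⟩
  have hV1 : 1 < V := hV ▸ Real.one_lt_rpow hq (by norm_num)
  have hV4 : V ^ 4 = n := by
    rw [hV, ← Real.rpow_natCast, ← Real.rpow_mul hq0.le]
    norm_num
  have hV2 : (n : ℝ) ^ (1 / 2 : ℝ) = V ^ 2 := by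
    rw [hV, ← Real.rpow_natCast, ← Real.rpow_mul hq0.le]
    norm_num
  have hr4 : rp n (1 / 4) = V := by rw [rp, hV]
  have hr2 : rp n (1 / 2) = (V : ℂ) ^ 2 := by rw [rp, hV2, Complex.ofReal_pow]
  rw [hr2] at h0 h1
  rw [hr4] at h1
  have hV0 : (V : ℂ) ≠ 0 := Complex.ofReal_ne_zero.2 (by linarith)
  rcases mul_eq_zero.1 (show (ζ ^ 2 - 1) * (ζ ^ 2 + 1) = 0 by linear_combination hζ) with h | h
  · have hs : ζ ^ 2 = 1 := by linear_combination h
    rw [hs] at h0 h1 ⊢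
    -- all quantities are real
    obtain ⟨η, hη, hη2⟩ : ∃ η : ℝ, ζ⁻¹ = η ∧ η ^ 2 = 1 := by
      rcases mul_self_eq_one_iff.1 ((sq ζ).symm.trans hs) with rfl | rfl
      · exact ⟨1, by simp⟩
      · exact ⟨-1, by norm_num⟩
    have e0 : gammaCol n ζ 1 (fun _ => 1) 0 = (((1 + V ^ 2) ^ 4 + 3 * (1 + V ^ 2) ^ 2 * V ^ 2 +
        (V ^ 2) ^ 2 + V ^ 2 * (3 * (1 + V ^ 2) ^ 2 + V ^ 2) : ℝ) : ℂ) := by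
      rw [h0]
      push_cast
      ring
    have e1 : gammaCol n ζ 1 (fun _ => 1) 1 =
        ((V * η * (1 + V ^ 2) * ((1 + V ^ 2) ^ 2 + 4 * V ^ 2) : ℝ) : ℂ) := by
      rw [h1, hη]
      push_cast
      ring
    have hη0 : η ≠ 0 := by
      rintro rfl
      norm_num at hη2
    rw [e0, e1, ← Complex.ofReal_add]
    refine ⟨Complex.ofReal_ne_zero.2 (by positivity), Complex.ofReal_ne_zero.2 (by positivity),
      Complex.ofReal_ne_zero.2 (ne_of_gt ?_)⟩
    -- `2 |V| ≤ 1 + V ^ 2` bounds the second entry by the first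
    have hb : 0 ≤ (1 + V ^ 2) / 2 + V * η := by
      nlinarith [sq_nonneg (V + η)]
    have hc : 0 < (1 + V ^ 2) * ((1 + V ^ 2) ^ 2 + 4 * V ^ 2) := by positivity
    nlinarith [mul_nonneg hb hc.le, sq_nonneg (V ^ 2), pow_pos (show 0 < 1 + V ^ 2 by positivity) 4,
      mul_pos (pow_pos (show 0 < 1 + V ^ 2 by positivity) 2) (show 0 < V ^ 2 by positivity)]
  · have hs : ζ ^ 2 = -1 := by linear_combination h
    have hζ0 : ζ ≠ 0 := by
      rintro rfl
      norm_num at hζ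
    rw [hs] at h0 h1 ⊢
    have hc : 1 - V ^ 2 ≠ 0 := by nlinarith
    have e0 : gammaCol n ζ (-1) (fun _ => 1) 0 = (((1 - V ^ 2) ^ 4 : ℝ) : ℂ) := by
      rw [h0]
      push_cast
      ring
    have e1 : gammaCol n ζ (-1) (fun _ => 1) 1 =
        V * ζ⁻¹ * (((1 - V ^ 2) * ((1 - V ^ 2) ^ 2 - 4 * V ^ 2) : ℝ) : ℂ) := by
      rw [h1]
      push_cast
      ring
    -- `1 + n = 6 √n` would make `n ^ 2 - 34 n + 1` vanish
    have hquad : (1 - V ^ 2) ^ 2 - 4 * V ^ 2 ≠ 0 := by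
      intro h
      have h2 : (1 + (n : ℝ)) ^ 2 = 36 * n := by
        rw [← hV4]
        have : 1 + V ^ 4 = 6 * V ^ 2 := by linear_combination h
        rw [this]
        ring
      have h3 : (1 + n) ^ 2 = 36 * n := by exact_mod_cast h2
      have h4 : n ∣ 1 := by
        have : n ∣ (1 + n) ^ 2 - n * (n + 2) := Nat.dvd_sub ⟨36, by rw [h3, mul_comm]⟩ ⟨n + 2, rfl⟩
        rwa [show (1 + n) ^ 2 - n * (n + 2) = 1 by
          rw [show (1 + n) ^ 2 = 1 + n * (n + 2) by ring, Nat.add_sub_cancel]] at this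
      have := Nat.le_of_dvd one_pos h4
      omega
    refine ⟨?_, ?_, ?_⟩
    · rw [e0]
      exact Complex.ofReal_ne_zero.2 (pow_ne_zero _ hc)
    · rw [e1]
      exact mul_ne_zero (mul_ne_zero hV0 (inv_ne_zero hζ0))
        (Complex.ofReal_ne_zero.2 (mul_ne_zero hc hquad))
    · -- the first entry is real and the second is imaginary
      rw [e0, e1]
      intro hsum
      have hsq : ((-(V ^ 2) * ((1 - V ^ 2) * ((1 - V ^ 2) ^ 2 - 4 * V ^ 2)) ^ 2 : ℝ) : ℂ) =
          ((((1 - V ^ 2) ^ 4) ^ 2 : ℝ) : ℂ) := by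
        have hi : ζ⁻¹ ^ 2 = -1 := by rw [inv_pow, hs]; norm_num
        generalize (1 - V ^ 2) * ((1 - V ^ 2) ^ 2 - 4 * V ^ 2) = G at hsum ⊢
        generalize (1 - V ^ 2) ^ 4 = K at hsum ⊢
        push_cast
        linear_combination (V * ζ⁻¹ * G - K) * hsum - V ^ 2 * G ^ 2 * hi
      have hreal := Complex.ofReal_injective hsq
      have hpos : 0 < ((1 - V ^ 2) ^ 4) ^ 2 := by positivity
      nlinarith [mul_nonneg (sq_nonneg V)
        (sq_nonneg ((1 - V ^ 2) * ((1 - V ^ 2) ^ 2 - 4 * V ^ 2)))]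

end Gamma

/-! ### The leading terms of the integrals -/

section Leading

variable {F : Type*} [Field F] [Fintype F]

/-- The leading coefficient of the integral of the kernel alone. -/
def kernelCoeff (r : ℕ) : ℂ :=
  3 * (2 : ℂ) ^ (25 - 7 * (r : ℤ)) * ((r - 3).factorial : ℂ) * factRatio r

lemma factRatio_ne_zero (r : ℕ) : factRatio r ≠ 0 :=
  div_ne_zero (Finset.prod_ne_zero_iff.2 fun _ _ => Nat.cast_ne_zero.2 (Nat.factorial_ne_zero _))
    (Finset.prod_ne_zero_iff.2 fun _ _ => Nat.cast_ne_zero.2 (Nat.factorial_ne_zero _))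

lemma kernelCoeff_ne_zero (r : ℕ) : kernelCoeff r ≠ 0 := by
  unfold kernelCoeff
  have h1 : (2 : ℂ) ^ (25 - 7 * (r : ℤ)) ≠ 0 := zpow_ne_zero _ two_ne_zero
  have h2 : ((r - 3).factorial : ℂ) ≠ 0 := Nat.cast_ne_zero.2 (Nat.factorial_ne_zero _)
  have h3 := factRatio_ne_zero r
  simp [h1, h2, h3]

lemma norm_sgn (a : Fˣ) : ‖sgn a‖ = 1 := by
  unfold sgn
  split_ifs <;> simp

/-- The integrals are polynomials in `D`, and the coefficient of the expected degree is given by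
the value at the point `(1, …, 1)`. -/
theorem exists_polynomial_Ltilde {m : ℕ} (hr : 4 ≤ 3 + m) (hq : Fintype.card F % 4 = 1) (a : Fˣ)
    {ζ : ℂ} (hζ : ζ ^ 2 = sgn a) : ∃ ρ₀ : ℝ, 0 < ρ₀ ∧
      (∀ z : Fin (3 + m) → ℂ, (∀ i, ‖z i - 1‖ < ρ₀) →
        Summable fun p : MonicPrime F => ‖Sreg hr a ζ p z - 1‖) ∧
      ∀ ν : Fin 2,
        (∀ ρ : ℝ, 0 < ρ → ρ < ρ₀ → ∀ D : ℕ,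
          TorusIntegrable (integrand hr a ζ ν D) (fun _ => 1) (fun _ => ρ)) ∧
        ∃ P : ℂ[X],
          (∀ ρ : ℝ, 0 < ρ → ρ < ρ₀ → ∀ D : ℕ, Ltilde hr a ζ ν ρ D = P.eval (D : ℂ)) ∧
          P.natDegree ≤ m * (m + 13) / 2 ∧
          P.coeff (m * (m + 13) / 2) = kernelCoeff (3 + m) *
            calG hr (qF F) ζ (sgn a) ν (fun _ => 1) *
            ∏' p : MonicPrime F, Sreg hr a ζ p (fun _ => 1) := by
  obtain ⟨δ, hδ, u, hu, hS, hb, -⟩ := exists_euler_bound hr hq a hζ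
  obtain ⟨ρ₁, hρ₁, hmain⟩ := exists_polynomial_integral hr
  have hG : ∃ ρ₂ : ℝ, 0 < ρ₂ ∧ ∀ ν, SepHol (fun _ => 1) ρ₂ (calG hr (qF F) ζ (sgn a) ν) := by
    have h := fun ν => exists_ball_of_analyticAt
      (calG_analyticAt hr (one_lt_qF (F := F)) (pow_four_eq_one hζ) (norm_sgn a) ν)
    choose ρ hρ hh using h
    refine ⟨min (ρ 0) (ρ 1), lt_min (hρ 0) (hρ 1), fun ν => ?_⟩
    fin_cases ν
    · exact (hh 0).mono (min_le_left _ _)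
    · exact (hh 1).mono (min_le_right _ _)
  obtain ⟨ρ₂, hρ₂, hG⟩ := hG
  have hE : SepHol (fun _ => 1) δ fun z => ∏' p : MonicPrime F, Sreg hr a ζ p z :=
    SepHol.tprod hS hu hb
  set ρ₀ := min δ (min ρ₁ ρ₂) with hρ₀
  have hpos : 0 < ρ₀ := lt_min hδ (lt_min hρ₁ hρ₂)
  refine ⟨ρ₀, hpos, fun z hz => ?_, fun ν => ?_⟩
  · refine hu.of_nonneg_of_le (fun p => norm_nonneg _) fun p => hb p z ?_
    rw [Metric.mem_ball, dist_pi_lt_iff hδ]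
    exact fun i => by
      rw [dist_eq_norm]
      exact (hz i).trans_le (min_le_left _ _)
  · have hf := ((hG ν).mono ((min_le_right _ _).trans (min_le_right _ _) : ρ₀ ≤ ρ₂)).mul
      (hE.mono (min_le_left _ _ : ρ₀ ≤ δ))
    obtain ⟨hint, P, hdeg, hcoeff, hP⟩ := hmain ρ₀ _ hpos
      ((min_le_right _ _).trans (min_le_left _ _)) hf
    refine ⟨hint, P, hP, hdeg, ?_⟩
    rw [hcoeff, kernelCoeff, Nat.add_sub_cancel_left]
    ring

lemma leading_of_coeff {P : ℂ[X]} {N : ℕ} {c : ℂ} (hdeg : P.natDegree ≤ N) (hc : P.coeff N = c)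
    (h0 : c ≠ 0) : P.natDegree = N ∧ P.leadingCoeff = c := by
  have h : P.natDegree = N := le_antisymm hdeg (le_natDegree_of_ne_zero (hc ▸ h0))
  exact ⟨h, by rw [leadingCoeff, h, hc]⟩

lemma calG_one_ne_zero {r : ℕ} (hr : 4 ≤ r) (hq : Fintype.card F % 4 = 1) (a : Fˣ) {ζ : ℂ}
    (hζ : ζ ^ 2 = sgn a) (ν : Fin 2) : calG hr (qF F) ζ (sgn a) ν (fun _ => 1) ≠ 0 := by
  obtain ⟨h0, h1, -⟩ := gammaCol_one_ne_zero (five_le_card hq) (pow_four_eq_one hζ)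
  rw [hζ] at h0 h1
  have hs : 1 - rp (qF F) (1 / 2) ≠ 0 := by
    simpa using one_sub_mul_rp_half_ne_zero one_lt_qF norm_one
  have hs' := one_sub_mul_rp_half_ne_zero (q := qF F) one_lt_qF (norm_sgn a)
  rw [calG_one]
  fin_cases ν
  · exact mul_ne_zero (div_ne_zero (pow_ne_zero _ hs) (pow_ne_zero _ hs')) h0
  · exact mul_ne_zero (div_ne_zero one_ne_zero (pow_ne_zero _ hs')) h1

/-- The fourth roots of unity `I ^ k` are the admissible values of `ζ_a`. -/
lemma I_pow_sq_eq_sgn {θ : Fˣ} (hθ : ¬ IsSquare (θ : F)) (k : Fin 4) :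
    (Complex.I ^ (k : ℕ)) ^ 2 = sgn (constOf θ k) := by
  unfold sgn constOf
  have h1 : IsSquare ((1 : Fˣ) : F) := ⟨1, by simp⟩
  have hI : (Complex.I ^ (k : ℕ)) ^ 2 = (-1) ^ (k : ℕ) := by
    rw [← pow_mul, mul_comm, pow_mul, Complex.I_sq]
  rw [hI]
  rcases Nat.even_or_odd (k : ℕ) with hk | hk
  · rw [if_pos hk, if_pos h1, hk.neg_one_pow]
  · rw [if_neg (Nat.not_even_iff_odd.2 hk), if_neg hθ, hk.neg_one_pow]

end Leading

end

end SecTerms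

theorem mainTheorem8 {F : Type*} [Field F] [Fintype F] (hq : Fintype.card F % 4 = 1)
    (r : ℕ) (hr : 4 ≤ r) :
    -- leading terms of the two integrals
    (∀ (a : Fˣ) (ζ : ℂ), ζ ^ 2 = SecTerms.sgn a →
      ∃ ρ₀ : ℝ, 0 < ρ₀ ∧
        (∀ z : Fin r → ℂ, (∀ i, ‖z i - 1‖ < ρ₀) →
          Summable fun p : SecTerms.MonicPrime F => ‖SecTerms.Sreg hr a ζ p z - 1‖) ∧
        ∀ ν : Fin 2,
          (∀ ρ : ℝ, 0 < ρ → ρ < ρ₀ → ∀ D : ℕ,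
            TorusIntegrable (SecTerms.integrand hr a ζ ν D) (fun _ => 1) (fun _ => ρ)) ∧
          ∃ P : Polynomial ℂ,
            (∀ ρ : ℝ, 0 < ρ → ρ < ρ₀ → ∀ D : ℕ,
              SecTerms.Ltilde hr a ζ ν ρ D = P.eval (D : ℂ)) ∧
            P.natDegree = (r - 3) * (r + 10) / 2 ∧
            P.leadingCoeff =
              3 * (2 : ℂ) ^ (25 - 7 * (r : ℤ)) * ((r - 3).factorial : ℂ) * SecTerms.factRatio r
                * SecTerms.calG hr (SecTerms.qF F) ζ (SecTerms.sgn a) ν (fun _ => 1)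
                * ∏' p : SecTerms.MonicPrime F, SecTerms.Sreg hr a ζ p (fun _ => 1)) ∧
    -- the Euler factors at `ξ = (1, …, 1)`
    (∀ (a : Fˣ) (ζ : ℂ), ζ ^ 2 = SecTerms.sgn a → ∀ p : SecTerms.MonicPrime F,
      SecTerms.Sreg hr a ζ p (fun _ => 1) =
        SecTerms.polyP r (SecTerms.chi a p / SecTerms.rp (SecTerms.pnorm p) (1 / 2))) ∧
    -- the resulting leading coefficient of `Q₂`
    (∀ θ : Fˣ, ¬ IsSquare (θ : F) →
      ∃ ρ₀ : ℝ, 0 < ρ₀ ∧ ∃ P : Fin 4 → Polynomial ℂ,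
        (∀ ρ : ℝ, 0 < ρ → ρ < ρ₀ → ∀ D : ℕ,
          SecTerms.Q2 hr θ ρ D =
            ∑ k : Fin 4, (Complex.I ^ (k : ℕ)) ^ D * (P k).eval (D : ℂ)) ∧
        ∀ k : Fin 4,
          (P k).natDegree = (r - 3) * (r + 10) / 2 ∧
          (P k).leadingCoeff =
            (2 : ℂ) ^ (19 - 7 * (r : ℤ)) * SecTerms.factRatio r
              * (![1, 1, 0] ⬝ᵥ SecTerms.gammaCol (SecTerms.qF F) (Complex.I ^ (k : ℕ))
                  (SecTerms.sgn (SecTerms.constOf θ k)) (fun _ => 1))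
              * (1 / (1 - SecTerms.sgn (SecTerms.constOf θ k)
                  * SecTerms.rp (SecTerms.qF F) (1 / 2))) ^ 7
              * ∏' p : SecTerms.MonicPrime F, SecTerms.polyP r
                  (SecTerms.chi (SecTerms.constOf θ k) p
                    / SecTerms.rp (SecTerms.pnorm p) (1 / 2))) := by
  obtain ⟨m, rfl⟩ : ∃ m, r = 3 + m := ⟨r - 3, by omega⟩
  have hN : (3 + m - 3) * (3 + m + 10) / 2 = m * (m + 13) / 2 := by
    rw [Nat.add_sub_cancel_left, add_right_comm, add_comm (3 + 10)]
  rw [hN]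
  refine ⟨fun a ζ hζ => ?_, fun a ζ hζ p => SecTerms.Sreg_one hr hq a hζ p, fun θ hθ => ?_⟩
  · obtain ⟨ρ₀, hρ₀, hsum, h⟩ := SecTerms.exists_polynomial_Ltilde hr hq a hζ
    refine ⟨ρ₀, hρ₀, hsum, fun ν => ?_⟩
    obtain ⟨hint, P, hP, hdeg, hcoeff⟩ := h ν
    exact ⟨hint, P, hP, SecTerms.leading_of_coeff hdeg hcoeff (mul_ne_zero
      (mul_ne_zero (SecTerms.kernelCoeff_ne_zero _) (SecTerms.calG_one_ne_zero hr hq a hζ ν))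
      (SecTerms.tprod_Sreg_one_ne_zero hr hq a hζ))⟩
  · have hζ := SecTerms.I_pow_sq_eq_sgn hθ
    choose ρ hρ hsum h using fun k =>
      SecTerms.exists_polynomial_Ltilde hr hq (SecTerms.constOf θ k) (hζ k)
    choose hint P hP hdeg hcoeff using h
    obtain ⟨ρ₀, hρ₀, hle⟩ : ∃ ρ₀ : ℝ, 0 < ρ₀ ∧ ∀ k, ρ₀ ≤ ρ k :=
      ⟨univ.inf' univ_nonempty ρ, (Finset.lt_inf'_iff _).2 fun k _ => hρ k,
        fun k => Finset.inf'_le _ (mem_univ k)⟩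
    set κ : ℂ := 1 / (2 ^ 5 * (Nat.factorial 3 : ℂ) * ((3 + m - 3).factorial : ℂ)) with hκ
    set A : ℂ := (1 - SecTerms.rp (SecTerms.qF F) (1 / 2)) ^ (-((3 + m : ℕ) : ℤ)) with hA
    refine ⟨ρ₀, hρ₀, fun k => C κ * (C A * P k 0 + P k 1), fun ρ' h0 h1 D => ?_, fun k => ?_⟩
    · unfold SecTerms.Q2
      rw [← hκ, ← hA, Finset.mul_sum]
      refine Finset.sum_congr rfl fun k _ => ?_
      rw [hP k 0 ρ' h0 (h1.trans_le (hle k)) D, hP k 1 ρ' h0 (h1.trans_le (hle k)) D]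
      simp only [eval_mul, eval_add, eval_C]
      ring
    · have hfac : ((3 + m - 3).factorial : ℂ) ≠ 0 := Nat.cast_ne_zero.2 (Nat.factorial_ne_zero _)
      have h2 : (2 : ℂ) ^ (25 - 7 * ((3 + m : ℕ) : ℤ)) = 2 ^ 6 * 2 ^ (19 - 7 * ((3 + m : ℕ) : ℤ)) := by
        rw [show (25 - 7 * ((3 + m : ℕ) : ℤ)) = ((6 : ℕ) : ℤ) + (19 - 7 * ((3 + m : ℕ) : ℤ)) by
          push_cast; ring, zpow_add₀ two_ne_zero, zpow_natCast]
      have hs : 1 - SecTerms.rp (SecTerms.qF F) (1 / 2) ≠ 0 := by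
        simpa using SecTerms.one_sub_mul_rp_half_ne_zero (SecTerms.one_lt_qF (F := F)) norm_one
      have hAA : A * (1 - SecTerms.rp (SecTerms.qF F) (1 / 2)) ^ (3 + m) = 1 := by
        rw [hA, _root_.zpow_neg, zpow_natCast, inv_mul_cancel₀ (pow_ne_zero _ hs)]
      have hκm : κ * SecTerms.kernelCoeff (3 + m) =
          (2 : ℂ) ^ (19 - 7 * ((3 + m : ℕ) : ℤ)) * SecTerms.factRatio (3 + m) := by
        have h3 : (Nat.factorial 3 : ℂ) = 6 := by norm_num [Nat.factorial]
        rw [hκ, SecTerms.kernelCoeff, h2, h3]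
        field_simp
        ring
      have hdot : ![1, 1, 0] ⬝ᵥ SecTerms.gammaCol (SecTerms.qF F) (Complex.I ^ (k : ℕ))
          (SecTerms.sgn (SecTerms.constOf θ k)) (fun _ => 1) =
          SecTerms.gammaCol (SecTerms.qF F) (Complex.I ^ (k : ℕ))
            (SecTerms.sgn (SecTerms.constOf θ k)) (fun _ => 1) 0 +
          SecTerms.gammaCol (SecTerms.qF F) (Complex.I ^ (k : ℕ))
            (SecTerms.sgn (SecTerms.constOf θ k)) (fun _ => 1) 1 := by
        simp [dotProduct, Fin.sum_univ_three]
      have hprod := tprod_congr (L := SummationFilter.unconditional _) fun p =>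
        SecTerms.Sreg_one hr hq (SecTerms.constOf θ k) (hζ k) p
      have hs' := SecTerms.one_sub_mul_rp_half_ne_zero (q := SecTerms.qF F) SecTerms.one_lt_qF
        (SecTerms.norm_sgn (SecTerms.constOf θ k))
      have hγ := (SecTerms.gammaCol_one_ne_zero (SecTerms.five_le_card hq)
        (SecTerms.pow_four_eq_one (hζ k))).2.2
      rw [hζ k] at hγ
      have hE := SecTerms.tprod_Sreg_one_ne_zero hr hq (SecTerms.constOf θ k) (hζ k)
      rw [← hprod, hdot]
      refine SecTerms.leading_of_coeff ?_ ?_ ?_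
      · refine (natDegree_C_mul_le _ _).trans (natDegree_add_le_of_degree_le ?_ (hdeg k 1))
        exact (natDegree_C_mul_le _ _).trans (hdeg k 0)
      · rw [coeff_C_mul, coeff_add, coeff_C_mul, hcoeff, hcoeff, ← hκm,
          SecTerms.calG_one, SecTerms.calG_one]
        change κ * (A * (_ * ((1 - SecTerms.rp (SecTerms.qF F) (1 / 2)) ^ (3 + m) / _ *
          SecTerms.gammaCol _ _ _ _ 0) * _) + _ * (1 / _ * SecTerms.gammaCol _ _ _ _ 1) * _) = _
        rw [_root_.one_div_pow]
        have hcomb : ∀ K W S g₀ g₁ E : ℂ, A * W = 1 →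
            κ * (A * (K * (W / S * g₀) * E) + K * (1 / S * g₁) * E) =
              κ * K * (g₀ + g₁) * (1 / S) * E := by
          intro K W S g₀ g₁ E h
          linear_combination κ * K * (1 / S) * g₀ * E * h
        exact hcomb _ _ _ _ _ _ hAA
      · exact mul_ne_zero (mul_ne_zero (mul_ne_zero (mul_ne_zero (zpow_ne_zero _ two_ne_zero)
          (SecTerms.factRatio_ne_zero _)) hγ) (pow_ne_zero _ (one_div_ne_zero hs'))) hE
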